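/- Let $X$ be a locally compact Hausdorff space equipped with an action of $\mathbb{Z}$ by homeomorphisms, and let $\mathcal{G}=\mathbb{Z}\ltimes X$ be the transformation groupoid: $\mathbb{Z}\times X$ with $\mathbb{Z}$ discrete, where $(\gamma,x)$ has source $x$ and range $\gamma x$. Let $\mathcal{Z}$ be the $\mathcal{G}$-sheaf of locally constant $\mathbb{Z}$-valued functions on $X$. Then there exist resolutions $0\to\mathcal{Z}\to\mathcal{S}^0\to\mathcal{S}^1\to\cdots$ by c-soft $\mathcal{G}$-sheaves (sheaves of abelian groups). For any such resolution: * $H_c^m(X)$ denotes the $m$-th cohomology of the complex $\Gamma_c(X;\mathcal{S}^\bullet)$ of compactly supported sections (zero for $m<0$), with the $\mathbb{Z}$-action induced by $(\gamma t)(x)=\gamma\,t(\gamma^{-1}x)$; * $H_n(\mathbb{Z}\ltimes X)$ denotes the Crainic–Moerdijk homology: let $\mathcal{G}^{(p)}$ be the space of composable strings $x_0\xleftarrow{g_1}x_1\leftarrow\cdots\xleftarrow{g_p}x_p$ and $\tau_p:\mathcal{G}^{(p)}\to X$ the map to $x_0$; then $H_n$ is the degree $n$ homology of the direct sum total complex,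 with degree $n$ part $\bigoplus_{p-q=n}\Gamma_c(\mathcal{G}^{(p)};\tau_p^*\mathcal{S}^q)$ and differential $\delta+(-1)^p d$. Here $d$ is the differential of the resolution and $\delta=\sum_i(-1)^i\delta_i$, where $\delta_i$ is summation over the fibres of the $i$-th face map $\mathcal{G}^{(p)}\to\mathcal{G}^{(p-1)}$ (which deletes $x_i$), preceded for $i=0$ by the action of $g_1^{-1}$ on germs. Then for each $n\in\mathbb{Z}$ there is a short exact sequence $$0\to H_c^{-n}(X)_{\mathbb{Z}}\xrightarrow{\ \iota\ }H_n(\mathbb{Z}\ltimes X)\xrightarrow{\ \pi\ }H_c^{1-n}(X)^{\mathbb{Z}}\to 0,$$ where $(\cdot)_{\mathbb{Z}}$ and $(\cdot)^{\mathbb{Z}}$ denote coinvariants and invariants. It is canonical in the following sense. The map $\iota$ is induced by the inclusion of the column $p=0$ of the double complex. Every class in $H_n(\mathbb{Z}\ltimes X)$ is represented by a cycle $w+z$, where $w\in\Gamma_c(X;\mathcal{S}^{-n})$ lies in the column $p=0$, and $z\in\Gamma_c(X;\mathcal{S}^{1-n})$ is a cocycle, regarded as an element of the column $p=1$ supported on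 the arrows $x\leftarrow(-1)\cdot x$ given by the generator $1\in\mathbb{Z}$ (its value at such an arrow being $z(x)$); and $\pi[w+z]=[z]$ for every such cycle. In particular $\pi:H_1(\mathbb{Z}\ltimes X)\to H_c^0(X)^{\mathbb{Z}}$ is an isomorphism, and $H_n(\mathbb{Z}\ltimes X)=0$ for $n>1$. -/

import Mathlib

open CategoryTheory Topology DirectSum

universe u v w w'

noncomputable section

/-! ## Étale groupoids -/

namespace CMHom

/-- An arrow of a category, with its source and target. -/
structure Arr (C : Type u) [Category.{v} C] where
  /-- the source -/
  {src : C}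
  /-- the target -/
  {tgt : C}
  /-- the arrow itself -/
  hom : src ⟶ tgt

/-- A composable pair of arrows. -/
structure CompPair (C : Type u) [Category.{v} C] where
  /-- source of the first arrow -/
  {x : C}
  /-- the intermediate object -/
  {y : C}
  /-- target of the second arrow -/
  {z : C}
  /-- the first arrow -/
  fst : x ⟶ y
  /-- the second arrow -/
  snd : y ⟶ z

/-- A locally compact Hausdorff étale groupoid.  The space of arrows carries a Hausdorff topology,
all structure maps are continuous (composable pairs carry the subspace topology of `Arr × Arr`),
and the source map is a local homeomorphism. -/
structure EtaleGroupoid where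
  /-- the base space -/
  Obj : Type u
  [topObj : TopologicalSpace Obj]
  [t2Obj : T2Space Obj]
  [lcObj : LocallyCompactSpace Obj]
  [grpd : Groupoid.{v} Obj]
  [topArr : TopologicalSpace (Arr Obj)]
  [t2Arr : T2Space (Arr Obj)]
  isLocalHomeomorph_src : IsLocalHomeomorph (fun f : Arr Obj => f.src)
  continuous_unit : Continuous (fun x : Obj => Arr.mk (𝟙 x))
  continuous_inv : Continuous (fun f : Arr Obj => Arr.mk (inv f.hom))
  continuous_comp :
    Continuous[TopologicalSpace.induced
      (fun p : CompPair Obj => (Arr.mk p.fst, Arr.mk p.snd)) inferInstance, inferInstance]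
      (fun p : CompPair Obj => Arr.mk (p.fst ≫ p.snd))

attribute [instance] EtaleGroupoid.topObj EtaleGroupoid.t2Obj EtaleGroupoid.lcObj
  EtaleGroupoid.grpd EtaleGroupoid.topArr EtaleGroupoid.t2Arr

/-- A continuous map with continuous local sections through every point that is locally injective
is a local homeomorphism. -/
theorem isLocalHomeomorph_of_local_sections {Y Z : Type*} [TopologicalSpace Y] [TopologicalSpace Z]
    {f : Y → Z} (hf : Continuous f)
    (hinj : ∀ y, ∃ U : Set Y, IsOpen U ∧ y ∈ U ∧ Set.InjOn f U)
    (hsec : ∀ y, ∃ (V : Set Z) (σ : Z → Y), IsOpen V ∧ f y ∈ V ∧ ContinuousOn σ V ∧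
      σ (f y) = y ∧ ∀ z ∈ V, f (σ z) = z) : IsLocalHomeomorph f := by
  refine IsLocalHomeomorph.mk f fun y => ?_
  obtain ⟨U, hU, hyU, hUi⟩ := hinj y
  obtain ⟨V, σ, hV, hyV, hσ, hσy, hσf⟩ := hsec y
  have hT : IsOpen (V ∩ σ ⁻¹' U) := hσ.isOpen_inter_preimage hV hU
  refine ⟨{
    toFun := f
    invFun := σ
    source := U ∩ f ⁻¹' (V ∩ σ ⁻¹' U)
    target := V ∩ σ ⁻¹' U
    map_source' := fun a ha => ha.2
    map_target' := fun z hz => ⟨hz.2, by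
      have h1 := hσf z hz.1
      refine ⟨h1.symm ▸ hz.1, ?_⟩
      show σ (f (σ z)) ∈ U
      rw [h1]; exact hz.2⟩
    left_inv' := fun a ha => hUi ha.2.2 ha.1 (hσf _ ha.2.1)
    right_inv' := fun z hz => hσf z hz.1
    open_source := hU.inter (hT.preimage hf)
    open_target := hT
    continuousOn_toFun := hf.continuousOn
    continuousOn_invFun := hσ.mono Set.inter_subset_left }, ?_, fun _ _ => rfl⟩
  refine ⟨hyU, hyV, ?_⟩
  show σ (f y) ∈ U
  rw [hσy]; exact hyU

namespace EtaleGroupoid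

variable (𝒢 : EtaleGroupoid.{u, v})

theorem continuous_src : Continuous (fun f : Arr 𝒢.Obj => f.src) :=
  𝒢.isLocalHomeomorph_src.continuous

theorem continuous_tgt : Continuous (fun f : Arr 𝒢.Obj => f.tgt) :=
  𝒢.continuous_src.comp 𝒢.continuous_inv

variable {𝒢}

theorem continuous_mk_inv {Y : Type*} [TopologicalSpace Y] {a b : Y → 𝒢.Obj}
    {f : ∀ y, a y ⟶ b y} (hf : Continuous fun y => Arr.mk (f y)) :
    Continuous fun y => Arr.mk (inv (f y)) :=
  𝒢.continuous_inv.comp hf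

theorem continuous_mk_comp {Y : Type*} [TopologicalSpace Y] {a b c : Y → 𝒢.Obj}
    {f : ∀ y, a y ⟶ b y} {g : ∀ y, b y ⟶ c y} (hf : Continuous fun y => Arr.mk (f y))
    (hg : Continuous fun y => Arr.mk (g y)) :
    Continuous fun y => Arr.mk (f y ≫ g y) := by
  let _ : TopologicalSpace (CompPair 𝒢.Obj) := TopologicalSpace.induced
      (fun p : CompPair 𝒢.Obj => (Arr.mk p.fst, Arr.mk p.snd)) inferInstance
  have h : Continuous fun y => CompPair.mk (f y) (g y) :=
    continuous_induced_rng.2 (hf.prodMk hg)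
  exact Continuous.comp 𝒢.continuous_comp h

theorem isLocalHomeomorph_inv : IsLocalHomeomorph (fun f : Arr 𝒢.Obj => Arr.mk (inv f.hom)) := by
  have h : ∀ f : Arr 𝒢.Obj, Arr.mk (inv (Arr.mk (inv f.hom)).hom) = f := by
    rintro ⟨f⟩; simp
  exact Homeomorph.isLocalHomeomorph
    { toFun := fun f : Arr 𝒢.Obj => Arr.mk (inv f.hom)
      invFun := fun f : Arr 𝒢.Obj => Arr.mk (inv f.hom)
      left_inv := h
      right_inv := h
      continuous_toFun := 𝒢.continuous_inv
      continuous_invFun := 𝒢.continuous_inv }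

theorem isLocalHomeomorph_tgt : IsLocalHomeomorph (fun f : Arr 𝒢.Obj => f.tgt) :=
  𝒢.isLocalHomeomorph_src.comp isLocalHomeomorph_inv

/-! ## Composable strings -/

variable (𝒢) in
/-- The space `𝒢⁽ⁿ⁾` of composable strings `x₀ ← x₁ ← ⋯ ← xₙ`, as contravariant functors from the
ordered set `{0 < 1 < ⋯ < n}` to `𝒢`. -/
def Str (n : ℕ) : Type (max u v) := (Fin (n + 1))ᵒᵖ ⥤ 𝒢.Obj

namespace Str

variable {n : ℕ}

/-- The vertex `xᵢ` of a string. -/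
def vertex (i : Fin (n + 1)) (F : Str 𝒢 n) : 𝒢.Obj := F.obj (Opposite.op i)

/-- The composite arrow `xⱼ ⟶ xᵢ` (for `i ≤ j`) of a string. -/
def arrow (F : Str 𝒢 n) {i j : Fin (n + 1)} (h : i ≤ j) : F.vertex j ⟶ F.vertex i :=
  CategoryTheory.Functor.map F (homOfLE h).op

/-- `𝒢⁽ⁿ⁾` has the topology for which `(x₀ ←g₁ x₁ ← ⋯ ←gₙ xₙ) ↦ ((x₀, …, xₙ), (g₁, …, gₙ))`
is a homeomorphism onto its image; so it is `𝒢⁽⁰⁾` for `n = 0`, and a subspace of `𝒢ⁿ`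
for `n ≥ 1`. -/
instance : TopologicalSpace (Str 𝒢 n) :=
  TopologicalSpace.induced
    (fun F : Str 𝒢 n => ((fun i => F.vertex i : Fin (n + 1) → 𝒢.Obj),
      (fun i => Arr.mk (F.arrow i.castSucc_le_succ) : Fin n → Arr 𝒢.Obj))) inferInstance

theorem continuous_iff {Y : Type*} [TopologicalSpace Y] {f : Y → Str 𝒢 n} :
    Continuous f ↔ (∀ i, Continuous fun y => (f y).vertex i) ∧
      ∀ i : Fin n, Continuous fun y => Arr.mk ((f y).arrow i.castSucc_le_succ) := by
  rw [continuous_induced_rng]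
  constructor
  · intro h
    exact ⟨fun i => (continuous_apply i).comp (continuous_fst.comp h),
      fun i => (continuous_apply i).comp (continuous_snd.comp h)⟩
  · rintro ⟨h1, h2⟩
    exact (continuous_pi h1).prodMk (continuous_pi h2)

theorem continuous_vertex (i : Fin (n + 1)) : Continuous (vertex (𝒢 := 𝒢) i) :=
  (continuous_iff.1 _root_.continuous_id).1 i

theorem arrow_self (F : Str 𝒢 n) (i : Fin (n + 1)) : F.arrow (le_refl i) = 𝟙 _ :=
  CategoryTheory.Functor.map_id F _

theorem arrow_comp (F : Str 𝒢 n) {i j k : Fin (n + 1)} (h : i ≤ j) (h' : j ≤ k) :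
    F.arrow h' ≫ F.arrow h = F.arrow (h.trans h') :=
  (CategoryTheory.Functor.map_comp F (homOfLE h').op (homOfLE h).op).symm

theorem continuous_arrow {i j : Fin (n + 1)} (h : i ≤ j) :
    Continuous fun F : Str 𝒢 n => Arr.mk (F.arrow h) := by
  induction j using Fin.induction with
  | zero =>
    obtain rfl : i = 0 := le_antisymm h (Fin.zero_le _)
    simp only [arrow_self]
    exact 𝒢.continuous_unit.comp (continuous_vertex _)
  | succ j ih =>
    rcases h.eq_or_lt with rfl | hlt
    · simp only [arrow_self]
      exact 𝒢.continuous_unit.comp (continuous_vertex _)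
    · have h' : i ≤ j.castSucc := Fin.le_castSucc_iff.2 hlt
      have := continuous_mk_comp ((continuous_iff.1 _root_.continuous_id).2 j) (ih h')
      simpa only [arrow_comp, id] using this

/-- The arrow `xᵢ ⟶ xⱼ` of a string, for arbitrary `i` and `j`. -/
def between (F : Str 𝒢 n) (i j : Fin (n + 1)) : F.vertex i ⟶ F.vertex j :=
  F.arrow (Fin.zero_le i) ≫ inv (F.arrow (Fin.zero_le j))

theorem continuous_between (i j : Fin (n + 1)) :
    Continuous fun F : Str 𝒢 n => Arr.mk (F.between i j) :=
  continuous_mk_comp (continuous_arrow _) (continuous_mk_inv (continuous_arrow _))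

theorem between_comp_inv (F : Str 𝒢 n) (i j k : Fin (n + 1)) :
    F.between i k ≫ inv (F.between j k) = F.between i j := by
  simp [between]

theorem arrow_eq_between (F : Str 𝒢 n) {i j : Fin (n + 1)} (h : i ≤ j) :
    F.arrow h = F.between j i := by
  simp [between, ← arrow_comp F (Fin.zero_le i) h]

theorem between_self (F : Str 𝒢 n) (i : Fin (n + 1)) : F.between i i = 𝟙 _ := by
  simp [between]

theorem arr_comp_inv_congr {x y c x' y' c' : 𝒢.Obj} {f : x ⟶ c} {g : y ⟶ c} {f' : x' ⟶ c'}
    {g' : y' ⟶ c'} (h : Arr.mk f = Arr.mk f') (h' : Arr.mk g = Arr.mk g') :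
    Arr.mk (f ≫ inv g) = Arr.mk (f' ≫ inv g') := by
  cases h; cases h'; rfl

theorem ext_of_between {F F' : Str 𝒢 n} (k : Fin (n + 1))
    (h : ∀ i, Arr.mk (F.between i k) = Arr.mk (F'.between i k)) : F = F' := by
  have h2 : ∀ i j, Arr.mk (F.between i j) = Arr.mk (F'.between i j) := fun i j => by
    have := arr_comp_inv_congr (h i) (h j)
    rwa [between_comp_inv, between_comp_inv] at this
  refine CategoryTheory.Functor.hext (fun i => congrArg Arr.src (h2 i.unop 0)) ?_
  intro i j f
  have := h2 i.unop j.unop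
  rw [← arrow_eq_between F f.unop.le, ← arrow_eq_between F' f.unop.le] at this
  exact (Arr.mk.inj this).2.2

instance : T2Space (Str 𝒢 n) := by
  refine T2Space.of_injective_continuous
    (f := fun F : Str 𝒢 n => fun i => Arr.mk (F.between i 0)) ?_
    (continuous_pi fun i => continuous_between i 0)
  intro F F' h
  exact ext_of_between 0 fun i => congrFun h i

/-- The string determined by a family of arrows with the same target. -/
def ofStar {c : 𝒢.Obj} {x : Fin (n + 1) → 𝒢.Obj} (b : ∀ i, x i ⟶ c) : Str 𝒢 n where
  obj i := x i.unop
  map {i j} _ := b i.unop ≫ inv (b j.unop)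
  map_id i := by simp
  map_comp f g := by simp

theorem ofStar_arrow {c : 𝒢.Obj} {x : Fin (n + 1) → 𝒢.Obj} (b : ∀ i, x i ⟶ c)
    {i j : Fin (n + 1)} (h : i ≤ j) : (ofStar b).arrow h = b j ≫ inv (b i) := rfl

theorem ofStar_between {c : 𝒢.Obj} {x : Fin (n + 1) → 𝒢.Obj} (b : ∀ i, x i ⟶ c)
    (i j : Fin (n + 1)) : (ofStar b).between i j = b i ≫ inv (b j) := by
  change (b i ≫ inv (b 0)) ≫ inv (b j ≫ inv (b 0)) = _
  simp

theorem continuousOn_ofStar {Y : Type*} [TopologicalSpace Y] {V : Set Y} {c : Y → 𝒢.Obj}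
    {x : Fin (n + 1) → Y → 𝒢.Obj} (b : ∀ y i, x i y ⟶ c y)
    (h : ∀ i, ContinuousOn (fun y => Arr.mk (b y i)) V) :
    ContinuousOn (fun y => ofStar (b y)) V := by
  rw [continuousOn_iff_continuous_domRestrict, continuous_iff]
  have h' := fun i => continuousOn_iff_continuous_domRestrict.1 (h i)
  refine ⟨fun i => 𝒢.continuous_src.comp (h' i), fun i => ?_⟩
  exact continuous_mk_comp (h' i.succ) (continuous_mk_inv (h' i.castSucc))

theorem isLocalHomeomorph_vertex (k : Fin (n + 1)) :
    IsLocalHomeomorph (vertex (𝒢 := 𝒢) k) := by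
  have key : ∀ f : Arr 𝒢.Obj, ∃ e : OpenPartialHomeomorph (Arr 𝒢.Obj) 𝒢.Obj,
      f ∈ e.source ∧ (fun f : Arr 𝒢.Obj => f.tgt) = e := isLocalHomeomorph_tgt
  choose e he1 he2 using key
  refine isLocalHomeomorph_of_local_sections (continuous_vertex k) (fun F => ?_) (fun F => ?_)
  · refine ⟨⋂ i, (fun F' : Str 𝒢 n => Arr.mk (F'.between i k)) ⁻¹'
      (e (Arr.mk (F.between i k))).source, isOpen_iInter_of_finite fun i =>
        (e _).open_source.preimage (continuous_between i k), Set.mem_iInter.2 fun i => he1 _, ?_⟩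
    intro F₁ h1 F₂ h2 h
    rw [Set.mem_iInter] at h1 h2
    refine ext_of_between k fun i => (e (Arr.mk (F.between i k))).injOn (h1 i) (h2 i) ?_
    rw [← he2]; exact h
  · let V : Set 𝒢.Obj := ⋂ i, (e (Arr.mk (F.between i k))).target
    have htgt : ∀ i, ∀ z ∈ (e (Arr.mk (F.between i k))).target,
        ((e (Arr.mk (F.between i k))).symm z).tgt = z := fun i z hz => by
      have := (e (Arr.mk (F.between i k))).right_inv hz
      rwa [← he2] at this
    have hvF : ∀ i, (e (Arr.mk (F.between i k))).symm (vertex k F) = Arr.mk (F.between i k) := by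
      intro i
      have := (e (Arr.mk (F.between i k))).left_inv (he1 _)
      rwa [← he2] at this
    -- local sections of the target map, corrected to be the unit section at `k`
    let σ : Fin (n + 1) → 𝒢.Obj → Arr 𝒢.Obj := fun i z => by
      classical
      exact if h : i ≠ k ∧ ((e (Arr.mk (F.between i k))).symm z).tgt = z then
        Arr.mk (((e (Arr.mk (F.between i k))).symm z).hom ≫ eqToHom h.2) else Arr.mk (𝟙 z)
    have hσt : ∀ i z, (σ i z).tgt = z := by
      intro i z
      simp only [σ]
      split_ifs <;> rfl
    have hmk : ∀ (f : Arr 𝒢.Obj) (z : 𝒢.Obj) (h : f.tgt = z), Arr.mk (f.hom ≫ eqToHom h) = f := by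
      rintro f z rfl; simp
    have hσk : ∀ z, σ k z = Arr.mk (𝟙 z) := fun z => by simp [σ]
    have hσe : ∀ i, i ≠ k → ∀ z ∈ V, σ i z = (e (Arr.mk (F.between i k))).symm z := by
      intro i hi z hz
      have h2 := htgt i z (Set.mem_iInter.1 hz i)
      simp only [σ]
      rw [dif_pos ⟨hi, h2⟩, hmk]
    have hσF : ∀ i, vertex k F ∈ V → σ i (vertex k F) = Arr.mk (F.between i k) := by
      intro i hV
      by_cases hi : i = k
      · subst hi; rw [hσk, between_self]
      · rw [hσe i hi _ hV, hvF]
    have hFV : vertex k F ∈ V := Set.mem_iInter.2 fun i => by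
      have := (e (Arr.mk (F.between i k))).map_source (he1 _)
      rwa [← he2] at this
    refine ⟨V, fun z => ofStar (fun i => (σ i z).hom ≫ eqToHom (hσt i z)),
      isOpen_iInter_of_finite fun i => (e _).open_target, hFV, ?_, ?_, ?_⟩
    · refine continuousOn_ofStar _ fun i => ?_
      simp only [hmk]
      by_cases hi : i = k
      · subst hi
        simp only [hσk]
        exact 𝒢.continuous_unit.continuousOn
      · exact ((e (Arr.mk (F.between i k))).continuousOn_symm.mono
          (Set.iInter_subset _ i)).congr (hσe i hi)
    · refine ext_of_between k fun i => ?_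
      have h1 : ∀ j, Arr.mk ((σ j (vertex k F)).hom ≫ eqToHom (hσt j _)) =
          Arr.mk (F.between j k) := fun j => by rw [hmk, hσF j hFV]
      have := arr_comp_inv_congr (h1 i) (h1 k)
      rw [between_self, IsIso.inv_id, Category.comp_id] at this
      rw [← this]
      exact congrArg Arr.mk (ofStar_between _ i k)
    · intro z hz
      show (σ k z).src = z
      rw [hσk]

/-- The face map `dᵢ : 𝒢⁽ⁿ⁺¹⁾ → 𝒢⁽ⁿ⁾` deleting the vertex `xᵢ` (and composing the two arrows
adjacent to it if `0 < i < n + 1`). -/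
def face (i : Fin (n + 2)) (F : Str 𝒢 (n + 1)) : Str 𝒢 n :=
  (Fin.succAboveOrderEmb i).monotone.functor.op ⋙ F

theorem continuous_face (i : Fin (n + 2)) : Continuous (face (𝒢 := 𝒢) i) :=
  continuous_iff.2 ⟨fun j => continuous_vertex (i.succAbove j),
    fun j => continuous_arrow ((Fin.succAboveOrderEmb i).monotone j.castSucc_le_succ)⟩

theorem isLocalHomeomorph_face (i : Fin (n + 2)) : IsLocalHomeomorph (face (𝒢 := 𝒢) i) :=
  IsLocalHomeomorph.of_comp (g := vertex 0) (f := face i) 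
    (isLocalHomeomorph_vertex (i.succAbove 0)) (isLocalHomeomorph_vertex 0) (continuous_face i)

end Str
end EtaleGroupoid

/-! ## Equivariant sheaves -/

/-- The total space `⨆ₓ Fₓ` of a family of sets. -/
structure EtSpace {B : Type u} (F : B → Type w) where
  /-- the base point -/
  base : B
  /-- the element of the stalk -/
  germ : F base

/-- An arrow together with an element of the stalk at its source. -/
structure ActPair {C : Type u} [Category.{v} C] (F : C → Type w) where
  /-- the source -/
  {x : C}
  /-- the target -/
  {y : C}
  /-- the arrow -/
  hom : x ⟶ y
  /-- an element of the stalk at the source -/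
  germ : F x

/-- A `𝒢`-sheaf of abelian groups, given by its étale space: a family of abelian groups (the
stalks) with a topology on the total space, such that the projection is a local homeomorphism and
the fibrewise group operations are continuous, and with a continuous action of `𝒢` by group
homomorphisms.  (Fibre products carry the subspace topology of the product.) -/
structure GSheaf (𝒢 : EtaleGroupoid.{u, v}) where
  /-- the stalks -/
  Stalk : 𝒢.Obj → Type w
  [grp : ∀ x, AddCommGroup (Stalk x)]
  [top : TopologicalSpace (EtSpace Stalk)]
  isLocalHomeomorph_base : IsLocalHomeomorph (EtSpace.base : EtSpace Stalk → 𝒢.Obj)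
  continuous_zero : Continuous (fun x => (⟨x, 0⟩ : EtSpace Stalk))
  continuous_neg : Continuous (fun e : EtSpace Stalk => (⟨e.base, -e.germ⟩ : EtSpace Stalk))
  continuous_add :
    Continuous[TopologicalSpace.induced
      (fun p : EtSpace (fun x => Stalk x × Stalk x) =>
        ((⟨p.base, p.germ.1⟩, ⟨p.base, p.germ.2⟩) : EtSpace Stalk × EtSpace Stalk))
        inferInstance, inferInstance]
      (fun p => (⟨p.base, p.germ.1 + p.germ.2⟩ : EtSpace Stalk))
  /-- the action of an arrow `x ⟶ y` -/
  act {x y : 𝒢.Obj} (f : x ⟶ y) : Stalk x →+ Stalk y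
  act_id (x : 𝒢.Obj) (a : Stalk x) : act (𝟙 x) a = a
  act_comp {x y z : 𝒢.Obj} (f : x ⟶ y) (g : y ⟶ z) (a : Stalk x) :
    act (f ≫ g) a = act g (act f a)
  continuous_act :
    Continuous[TopologicalSpace.induced
      (fun p : ActPair Stalk => ((Arr.mk p.hom, ⟨p.x, p.germ⟩) : Arr 𝒢.Obj × EtSpace Stalk))
        inferInstance, inferInstance]
      (fun p => (⟨p.y, act p.hom p.germ⟩ : EtSpace Stalk))

attribute [instance] GSheaf.grp GSheaf.top

namespace GSheaf

variable {𝒢 : EtaleGroupoid.{u, v}}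

/-- A morphism of `𝒢`-sheaves. -/
structure Hom (S : GSheaf.{u, v, w} 𝒢) (T : GSheaf.{u, v, w'} 𝒢) where
  /-- the map on stalks -/
  app (x : 𝒢.Obj) : S.Stalk x →+ T.Stalk x
  continuous_app :
    Continuous (fun e : EtSpace S.Stalk => (⟨e.base, app e.base e.germ⟩ : EtSpace T.Stalk))
  app_act {x y : 𝒢.Obj} (f : x ⟶ y) (a : S.Stalk x) : app y (S.act f a) = T.act f (app x a)

/-- A sheaf is c-soft if every section over a neighbourhood `U` of a compact set `K` agrees, on a
neighbourhood of `K`, with a global section.  (A section over `U` is given by a family of germs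
that is continuous on `U`; its values off `U` are irrelevant.) -/
def IsCSoft (S : GSheaf.{u, v, w} 𝒢) : Prop :=
  ∀ (K U : Set 𝒢.Obj), IsCompact K → IsOpen U → K ⊆ U →
    ∀ s : ∀ x, S.Stalk x, ContinuousOn (fun x => (⟨x, s x⟩ : EtSpace S.Stalk)) U →
      ∃ V, IsOpen V ∧ K ⊆ V ∧ V ⊆ U ∧
        ∃ t : ∀ x, S.Stalk x, Continuous (fun x => (⟨x, t x⟩ : EtSpace S.Stalk)) ∧
          ∀ x ∈ V, t x = s x

variable (𝒢) in
/-- The `𝒢`-sheaf `𝒵` of locally constant integer valued functions: its étale space is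
`𝒢⁽⁰⁾ × ℤ`, with the action of `𝒢` on the first factor. -/
def constInt : GSheaf.{u, v, 0} 𝒢 where
  Stalk _ := ℤ
  top := TopologicalSpace.induced (fun e => (e.base, e.germ)) inferInstance
  isLocalHomeomorph_base := by
    let _ : TopologicalSpace (EtSpace fun _ : 𝒢.Obj => ℤ) :=
      TopologicalSpace.induced (fun e => (e.base, e.germ)) inferInstance
    have hc : Continuous fun e : EtSpace fun _ : 𝒢.Obj => ℤ => (e.base, e.germ) :=
      continuous_induced_dom
    refine isLocalHomeomorph_of_local_sections (continuous_fst.comp hc) (fun e => ?_) (fun e => ?_)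
    · refine ⟨{e' | e'.germ = e.germ}, (isOpen_discrete {e.germ}).preimage
        (continuous_snd.comp hc), rfl, ?_⟩
      rintro ⟨x, m⟩ (h : m = _) ⟨y, k⟩ (h' : k = _) (h'' : x = y)
      subst h'' h h'; rfl
    · exact ⟨Set.univ, fun x => ⟨x, e.germ⟩, isOpen_univ, trivial,
        (continuous_induced_rng.2 (by fun_prop)).continuousOn, rfl, fun _ _ => rfl⟩
  continuous_zero := continuous_induced_rng.2 (by fun_prop)
  continuous_neg := by
    let _ : TopologicalSpace (EtSpace fun _ : 𝒢.Obj => ℤ) :=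
      TopologicalSpace.induced (fun e => (e.base, e.germ)) inferInstance
    have hc : Continuous fun e : EtSpace fun _ : 𝒢.Obj => ℤ => (e.base, e.germ) :=
      continuous_induced_dom
    exact continuous_induced_rng.2
      ((continuous_fst.comp hc).prodMk (continuous_snd.comp hc).neg)
  continuous_add := by
    let _ : TopologicalSpace (EtSpace fun _ : 𝒢.Obj => ℤ) :=
      TopologicalSpace.induced (fun e => (e.base, e.germ)) inferInstance
    let _ : TopologicalSpace (EtSpace fun _ : 𝒢.Obj => ℤ × ℤ) :=
      TopologicalSpace.induced (fun p => ((⟨p.base, p.germ.1⟩, ⟨p.base, p.germ.2⟩) :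
        EtSpace (fun _ : 𝒢.Obj => ℤ) × EtSpace (fun _ : 𝒢.Obj => ℤ))) inferInstance
    have hc : Continuous fun e : EtSpace fun _ : 𝒢.Obj => ℤ => (e.base, e.germ) :=
      continuous_induced_dom
    have hp : Continuous fun p : EtSpace fun _ : 𝒢.Obj => ℤ × ℤ =>
        ((⟨p.base, p.germ.1⟩, ⟨p.base, p.germ.2⟩) :
        EtSpace (fun _ : 𝒢.Obj => ℤ) × EtSpace (fun _ : 𝒢.Obj => ℤ)) := continuous_induced_dom
    have h1 : Continuous fun p : EtSpace fun _ : 𝒢.Obj => ℤ × ℤ => (p.base, p.germ.1) :=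
      hc.comp (continuous_fst.comp hp)
    have h2 : Continuous fun p : EtSpace fun _ : 𝒢.Obj => ℤ × ℤ => (p.base, p.germ.2) :=
      hc.comp (continuous_snd.comp hp)
    have h3 : Continuous fun p : EtSpace fun _ : 𝒢.Obj => ℤ × ℤ => p.germ.1 :=
      h1.snd
    have h4 : Continuous fun p : EtSpace fun _ : 𝒢.Obj => ℤ × ℤ => p.germ.2 :=
      h2.snd
    exact continuous_induced_rng.2 ((continuous_fst.comp h1).prodMk (h3.add h4))
  act _ := AddMonoidHom.id ℤ
  act_id _ _ := rfl
  act_comp _ _ _ := rfl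
  continuous_act := by
    let _ : TopologicalSpace (EtSpace fun _ : 𝒢.Obj => ℤ) :=
      TopologicalSpace.induced (fun e => (e.base, e.germ)) inferInstance
    let _ : TopologicalSpace (ActPair fun _ : 𝒢.Obj => ℤ) :=
      TopologicalSpace.induced (fun p => ((Arr.mk p.hom, ⟨p.x, p.germ⟩) :
        Arr 𝒢.Obj × EtSpace fun _ : 𝒢.Obj => ℤ)) inferInstance
    have hc : Continuous fun e : EtSpace fun _ : 𝒢.Obj => ℤ => (e.base, e.germ) :=
      continuous_induced_dom
    have hp : Continuous fun p : ActPair fun _ : 𝒢.Obj => ℤ => ((Arr.mk p.hom, ⟨p.x, p.germ⟩) :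
        Arr 𝒢.Obj × EtSpace fun _ : 𝒢.Obj => ℤ) := continuous_induced_dom
    exact continuous_induced_rng.2
      ((𝒢.continuous_tgt.comp (continuous_fst.comp hp)).prodMk
        (continuous_snd.comp (hc.comp (continuous_snd.comp hp))))

/-! ## Compactly supported sections -/

section Sections

variable (S : GSheaf.{u, v, w} 𝒢) {Y Z : Type*} [TopologicalSpace Y] [TopologicalSpace Z]

/-- The group `Γ(Y; τ^*S)` of sections of the pullback of `S` along `τ : Y → 𝒢⁽⁰⁾`, i.e. of
continuous lifts of `τ` to the étale space of `S`. -/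
def Gamma (τ : C(Y, 𝒢.Obj)) : AddSubgroup (∀ y, S.Stalk (τ y)) where
  carrier := {t | Continuous fun y => (⟨τ y, t y⟩ : EtSpace S.Stalk)}
  zero_mem' := S.continuous_zero.comp τ.continuous
  neg_mem' h := S.continuous_neg.comp h
  add_mem' {s t} hs ht := by
    let _ : TopologicalSpace (EtSpace fun x => S.Stalk x × S.Stalk x) :=
      TopologicalSpace.induced
        (fun p => ((⟨p.base, p.germ.1⟩, ⟨p.base, p.germ.2⟩) :
          EtSpace S.Stalk × EtSpace S.Stalk)) inferInstance
    have h : Continuous fun y => (⟨τ y, (s y, t y)⟩ : EtSpace fun x => S.Stalk x × S.Stalk x) :=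
      continuous_induced_rng.2 (Continuous.prodMk hs ht)
    exact Continuous.comp S.continuous_add h

/-- The group `Γ_c(Y; τ^*S)` of compactly supported sections of the pullback of `S` along
`τ : Y → 𝒢⁽⁰⁾`. -/
def GammaC (τ : C(Y, 𝒢.Obj)) : AddSubgroup (∀ y, S.Stalk (τ y)) where
  carrier := {t | t ∈ S.Gamma τ ∧ ∃ K : Set Y, IsCompact K ∧ ∀ y ∉ K, t y = 0}
  zero_mem' := ⟨zero_mem _, ∅, isCompact_empty, fun _ _ => rfl⟩
  neg_mem' := fun ⟨h, K, hK, h0⟩ => ⟨neg_mem h, K, hK, fun y hy => by simp [h0 y hy]⟩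
  add_mem' := fun ⟨h, K, hK, h0⟩ ⟨h', K', hK', h0'⟩ =>
    ⟨add_mem h h', K ∪ K', hK.union hK', fun y hy => by
      rw [Set.mem_union, not_or] at hy
      simp [h0 y hy.1, h0' y hy.2]⟩

variable {S}

/-- The map on compactly supported sections induced by a morphism of sheaves. -/
def Hom.mapGammaC {T : GSheaf.{u, v, w'} 𝒢} (φ : Hom S T) (τ : C(Y, 𝒢.Obj)) :
    S.GammaC τ →+ T.GammaC τ where
  toFun t := ⟨fun y => φ.app _ (t.1 y), Continuous.comp φ.continuous_app t.2.1, by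
    obtain ⟨K, hK, h0⟩ := t.2.2
    exact ⟨K, hK, fun y hy => by simp [h0 y hy]⟩⟩
  map_zero' := by ext; simp
  map_add' _ _ := by ext; simp

/-- Pullback of compactly supported sections along a proper map. -/
def pullGammaC (S : GSheaf.{u, v, w} 𝒢) (ρ : Y → Z) (hρ : IsProperMap ρ) (τ : C(Z, 𝒢.Obj)) :
    S.GammaC τ →+ S.GammaC (τ.comp ⟨ρ, hρ.continuous⟩) where
  toFun t := ⟨fun y => t.1 (ρ y), Continuous.comp (g := fun z => EtSpace.mk (τ z) (t.1 z))
      t.2.1 hρ.continuous, by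
    obtain ⟨K, hK, h0⟩ := t.2.2
    exact ⟨ρ ⁻¹' K, hρ.isCompact_preimage hK, fun y hy => h0 _ hy⟩⟩
  map_zero' := rfl
  map_add' _ _ := rfl

/-- Transport of compactly supported sections along a continuous family of arrows
`τ y ⟶ τ' y`. -/
def transportGammaC (S : GSheaf.{u, v, w} 𝒢) {τ τ' : C(Y, 𝒢.Obj)} (φ : ∀ y, τ y ⟶ τ' y)
    (hφ : Continuous fun y => Arr.mk (φ y)) : S.GammaC τ →+ S.GammaC τ' where
  toFun t := ⟨fun y => S.act (φ y) (t.1 y), by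
    let _ : TopologicalSpace (ActPair S.Stalk) := TopologicalSpace.induced
      (fun p => ((Arr.mk p.hom, ⟨p.x, p.germ⟩) : Arr 𝒢.Obj × EtSpace S.Stalk)) inferInstance
    have h : Continuous fun y => (⟨φ y, t.1 y⟩ : ActPair S.Stalk) :=
      continuous_induced_rng.2 (hφ.prodMk t.2.1)
    exact Continuous.comp S.continuous_act h, by
    obtain ⟨K, hK, h0⟩ := t.2.2
    exact ⟨K, hK, fun y hy => by simp [h0 y hy]⟩⟩
  map_zero' := by ext; simp
  map_add' _ _ := by ext; simp

/-- Summation over the fibres of a map `d : Y → Z`. -/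
def fibreSum (S : GSheaf.{u, v, w} 𝒢) (d : Y → Z) (τ : Z → 𝒢.Obj)
    (t : ∀ y, S.Stalk (τ (d y))) (z : Z) : S.Stalk (τ z) :=
  ∑ᶠ y : {y // d y = z}, (congrArg (fun z => S.Stalk (τ z)) y.2).mp (t y)

theorem finite_fibre_inter [T2Space Z] {d : Y → Z} (hd : IsLocalHomeomorph d) {K : Set Y}
    (hK : IsCompact K) (z : Z) : (K ∩ d ⁻¹' {z}).Finite := by
  have hK' : IsCompact (K ∩ d ⁻¹' {z}) :=
    hK.inter_right (isClosed_singleton.preimage hd.continuous)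
  choose e he1 he2 using hd
  obtain ⟨A, -, hA⟩ := hK'.elim_nhds_subcover (fun y => (e y).source)
    (fun y _ => (e y).open_source.mem_nhds (he1 y))
  refine ((A.finite_toSet.biUnion (t := fun a => (e a).source ∩ d ⁻¹' {z}) fun a _ => ?_)).subset
    (fun y hy => ?_)
  · refine Set.Subsingleton.finite fun y hy y' hy' => (e a).injOn hy.1 hy'.1 ?_
    rw [← he2]; exact hy.2.trans hy'.2.symm
  · obtain ⟨a, ha, hya⟩ := Set.mem_iUnion₂.1 (hA hy)
    exact Set.mem_iUnion₂.2 ⟨a, ha, hya, hy.2⟩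

theorem finite_support_fibre [T2Space Z] {d : Y → Z} (hd : IsLocalHomeomorph d) {τ : Z → 𝒢.Obj}
    {t : ∀ y, S.Stalk (τ (d y))} {K : Set Y} (hK : IsCompact K) (h0 : ∀ y ∉ K, t y = 0) (z : Z) :
    (Function.support fun y : {y // d y = z} =>
      (congrArg (fun z => S.Stalk (τ z)) y.2).mp (t y)).Finite := by
  refine Set.Finite.of_finite_image (f := Subtype.val)
    ((finite_fibre_inter hd hK z).subset ?_) Subtype.val_injective.injOn
  rintro _ ⟨⟨y, rfl⟩, hy, rfl⟩
  refine ⟨by_contra fun h => hy ?_, rfl⟩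
  exact h0 y h

theorem fibreSum_mem_Gamma [T2Space Y] [T2Space Z] {d : Y → Z} (hd : IsLocalHomeomorph d)
    {τ : C(Z, 𝒢.Obj)} {t : ∀ y, S.Stalk (τ (d y))}
    (ht : Continuous fun y => (⟨τ (d y), t y⟩ : EtSpace S.Stalk))
    {K : Set Y} (hK : IsCompact K) (h0 : ∀ y ∉ K, t y = 0) :
    S.fibreSum d τ t ∈ S.Gamma τ := by
  refine continuous_iff_continuousAt.2 fun z₀ => ?_
  have hD := finite_fibre_inter hd hK z₀
  set D := K ∩ d ⁻¹' {z₀} with hDdef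
  obtain ⟨U, hU, hUd⟩ := hD.t2_separation
  have hdc := hd.continuous
  choose e he1 he2 using hd
  let O : Y → Set Y := fun y => U y ∩ (e y).source
  have hO : ∀ y, IsOpen (O y) := fun y => (hU y).2.inter (e y).open_source
  have hyO : ∀ y, y ∈ O y := fun y => ⟨(hU y).1, he1 y⟩
  let N : Y → Set Z := fun y => (e y).target ∩ (e y).symm ⁻¹' O y
  have hN : ∀ y, IsOpen (N y) := fun y =>
    (e y).continuousOn_symm.isOpen_inter_preimage (e y).open_target (hO y)
  let K' : Set Y := K \ ⋃ y ∈ D, O y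
  have hK' : IsCompact K' := hK.diff (isOpen_biUnion fun y _ => hO y)
  let W : Set Z := (⋂ y ∈ D, N y) \ d '' K'
  have hW : IsOpen W := (hD.isOpen_biInter fun y _ => hN y).sdiff (hK'.image hdc).isClosed
  have hzW : z₀ ∈ W := by
    refine ⟨Set.mem_iInter₂.2 fun y hy => ?_, ?_⟩
    · have hz : z₀ = e y y := by rw [← he2]; exact hy.2.symm
      refine ⟨hz ▸ (e y).map_source (he1 y), ?_⟩
      rw [Set.mem_preimage, hz, (e y).left_inv (he1 y)]
      exact hyO y
    · rintro ⟨y, ⟨hyK, hy⟩, hyz⟩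
      exact hy (Set.mem_iUnion₂.2 ⟨y, ⟨hyK, hyz⟩, hyO y⟩)
  have hσ : ∀ y : D, ∀ z : W, d ((e y).symm z) = z := fun y z => by
    have := (e (y : Y)).right_inv (Set.mem_iInter₂.1 z.2.1 y y.2).1
    rwa [← he2] at this
  let τW : C(W, 𝒢.Obj) := τ.comp ⟨Subtype.val, continuous_subtype_val⟩
  let g : D → ∀ z : W, S.Stalk (τW z) := fun y z =>
    (congrArg (fun z => S.Stalk (τ z)) (hσ y z)).mp (t ((e y).symm z))
  have hmk : ∀ (z z' : Z) (h : z = z') (a : S.Stalk (τ z)),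
      (⟨τ z', (congrArg (fun z => S.Stalk (τ z)) h).mp a⟩ : EtSpace S.Stalk) = ⟨τ z, a⟩ := by
    rintro z _ rfl a; rfl
  have hg : ∀ y, g y ∈ S.Gamma τW := fun y => by
    have hgt : (fun z : W => (⟨τ z, g y z⟩ : EtSpace S.Stalk)) =
        (fun y => (⟨τ (d y), t y⟩ : EtSpace S.Stalk)) ∘ fun z : W => (e (y : Y)).symm z :=
      funext fun z => hmk _ _ (hσ y z) _
    have hc : ContinuousOn (e (y : Y)).symm W :=
      (e (y : Y)).continuousOn_symm.mono fun z hz => (Set.mem_iInter₂.1 hz.1 y y.2).1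
    change Continuous fun z : W => (⟨τ z, g y z⟩ : EtSpace S.Stalk)
    rw [hgt]
    exact ht.comp (continuousOn_iff_continuous_domRestrict.1 hc)
  have := hD.fintype
  have hsum : ∀ z : W, S.fibreSum d τ t z = (∑ y, g y) z := by
    intro z
    let ψ : D → {y // d y = z} := fun y => ⟨(e y).symm z, hσ y z⟩
    have hψO : ∀ y : D, (e (y : Y)).symm z ∈ O y := fun y => (Set.mem_iInter₂.1 z.2.1 y y.2).2
    have hψ : Function.Injective ψ := by
      intro y y' h
      by_contra hne
      have h2 : (e (y : Y)).symm z = (e (y' : Y)).symm z := congrArg Subtype.val h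
      exact Set.disjoint_left.1 (hUd y.2 y'.2 fun h => hne (Subtype.ext h))
        (hψO y).1 (h2 ▸ (hψO y').1)
    rw [Finset.sum_apply, ← finsum_eq_sum_of_fintype, fibreSum]
    rw [← finsum_mem_univ, ← finsum_mem_inter_support_eq' (s := Set.range ψ), finsum_mem_range hψ]
    intro y hy
    refine ⟨fun _ => trivial, fun _ => ?_⟩
    have hyK : (y : Y) ∈ K := by
      by_contra hyK
      have hcast : ∀ (z : Z) (y : {y // d y = z}), (y : Y) ∉ K →
          (congrArg (fun z => S.Stalk (τ z)) y.2).mp (t y) = 0 := by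
        rintro z ⟨y, rfl⟩ h
        exact h0 y h
      exact hy (hcast z y hyK)
    have hyK' : (y : Y) ∉ K' := fun h => z.2.2 ⟨y, h, y.2⟩
    obtain ⟨y', hy', hyO'⟩ : ∃ y' ∈ D, (y : Y) ∈ O y' := by
      by_contra hne
      refine hyK' ⟨hyK, fun h => hne ?_⟩
      obtain ⟨y', h1, h2⟩ := Set.mem_iUnion₂.1 h
      exact ⟨y', h1, h2⟩
    refine ⟨⟨y', hy'⟩, Subtype.ext ?_⟩
    change (e y').symm z = y
    have hz : (z : Z) = e y' y := by rw [← he2]; exact y.2.symm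
    exact (congrArg (e y').symm hz).trans ((e y').left_inv hyO'.2)
  have hmem : (∑ y, g y) ∈ S.Gamma τW := sum_mem fun y _ => hg y
  have hcont : ContinuousOn (fun z => (⟨τ z, S.fibreSum d τ t z⟩ : EtSpace S.Stalk)) W := by
    rw [continuousOn_iff_continuous_domRestrict]
    have heq : W.domRestrict (fun z => (⟨τ z, S.fibreSum d τ t z⟩ : EtSpace S.Stalk)) =
        fun z : W => (⟨τW z, (∑ y, g y) z⟩ : EtSpace S.Stalk) :=
      funext fun z => congrArg (EtSpace.mk (τ z)) (hsum z)
    rw [heq]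
    exact hmem
  exact hcont.continuousAt (hW.mem_nhds hzW)

/-- The pushforward `Γ_c(Y; (τ ∘ d)^*S) → Γ_c(Z; τ^*S)` along a local homeomorphism `d : Y → Z`,
given by summation over fibres: `(d_* t)(z) = ∑_{d(y) = z} t(y)`. -/
def pushGammaC (S : GSheaf.{u, v, w} 𝒢) [T2Space Y] [T2Space Z] (d : Y → Z)
    (hd : IsLocalHomeomorph d) (τ : C(Z, 𝒢.Obj)) :
    S.GammaC (τ.comp ⟨d, hd.continuous⟩) →+ S.GammaC τ where
  toFun t := ⟨S.fibreSum d τ t.1, by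
    obtain ⟨K, hK, h0⟩ := t.2.2
    refine ⟨fibreSum_mem_Gamma hd t.2.1 hK h0, d '' K, hK.image hd.continuous, fun z hz => ?_⟩
    refine finsum_eq_zero_of_forall_eq_zero ?_
    rintro ⟨y, rfl⟩
    exact h0 y fun hy => hz ⟨y, hy, rfl⟩⟩
  map_zero' := by
    refine Subtype.ext (funext fun z => finsum_eq_zero_of_forall_eq_zero ?_)
    rintro ⟨y, rfl⟩
    rfl
  map_add' t t' := by
    refine Subtype.ext (funext fun z => ?_)
    obtain ⟨K, hK, h0⟩ := t.2.2
    obtain ⟨K', hK', h0'⟩ := t'.2.2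
    refine Eq.trans (finsum_congr ?_) (finsum_add_distrib (finite_support_fibre hd hK h0 z)
      (finite_support_fibre hd hK' h0' z))
    rintro ⟨y, rfl⟩
    rfl

end Sections
end GSheaf

/-! ## Groupoid homology -/

namespace EtaleGroupoid

variable {𝒢 : EtaleGroupoid.{u, v}}

/-- The map `τₙ : 𝒢⁽ⁿ⁾ → 𝒢⁽⁰⁾` sending `x₀ ← ⋯ ← xₙ` to `x₀`. -/
def tau (n : ℕ) : C(Str 𝒢 n, 𝒢.Obj) := ⟨Str.vertex 0, Str.continuous_vertex 0⟩

theorem Str.isProperMap_tau_zero : IsProperMap (tau (𝒢 := 𝒢) 0) := by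
  let e : Str 𝒢 0 ≃ₜ 𝒢.Obj :=
    { toFun := Str.vertex 0
      invFun := fun x => Str.ofStar (fun _ : Fin 1 => 𝟙 x)
      left_inv := fun F => Str.ext_of_between 0 fun i => by
        obtain rfl : i = 0 := Fin.fin_one_eq_zero i
        rw [Str.between_self, Str.between_self]
        rfl
      right_inv := fun x => rfl
      continuous_toFun := Str.continuous_vertex 0
      continuous_invFun := Str.continuous_iff.2 ⟨fun _ => _root_.continuous_id, fun i => i.elim0⟩ }
  exact e.isProperMap

/-- The map `δᵢ : Γ_c(𝒢⁽ⁿ⁺¹⁾; Sₙ₊₁) → Γ_c(𝒢⁽ⁿ⁾; Sₙ)` given by summation over the fibres of the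
face map `dᵢ`.  A germ at the vertex `x₀` of a string is first transported to the zeroth vertex of
the face, i.e. along `g₁⁻¹ : x₀ ⟶ x₁` if `i = 0`, and along the identity if `i > 0`. -/
def faceSum (S : GSheaf.{u, v, w} 𝒢) (n : ℕ) (i : Fin (n + 2)) :
    S.GammaC (tau (𝒢 := 𝒢) (n + 1)) →+ S.GammaC (tau (𝒢 := 𝒢) n) :=
  (S.pushGammaC (Str.face i) (Str.isLocalHomeomorph_face i) (tau n)).comp
    (S.transportGammaC
      (fun F => (inv (F.arrow (Fin.zero_le (i.succAbove 0))) : F.vertex 0 ⟶ F.vertex (i.succAbove 0)))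
      (continuous_mk_inv (Str.continuous_arrow _)))

/-- The horizontal differential `δ = ∑ᵢ (-1)ⁱ δᵢ`. -/
def bar (S : GSheaf.{u, v, w} 𝒢) (n : ℕ) :
    S.GammaC (tau (𝒢 := 𝒢) (n + 1)) →+ S.GammaC (tau (𝒢 := 𝒢) n) :=
  ∑ i : Fin (n + 2), (-1 : ℤ) ^ (i : ℕ) • faceSum S n i

/-- The isomorphism `Γ_c(X; S) ≅ Γ_c(𝒢⁽⁰⁾; S₀)` for `X` the base space, induced by the
homeomorphism `τ₀` from strings of length `0` to points. -/
def toStrZero (S : GSheaf.{u, v, w} 𝒢) :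
    S.GammaC (ContinuousMap.id 𝒢.Obj) →+ S.GammaC (tau (𝒢 := 𝒢) 0) :=
  S.pullGammaC (tau 0) Str.isProperMap_tau_zero (ContinuousMap.id 𝒢.Obj)

end EtaleGroupoid

open EtaleGroupoid

/-- A resolution `0 → A → S⁰ → S¹ → ⋯` of a `𝒢`-sheaf by c-soft `𝒢`-sheaves. -/
structure SoftResolution {𝒢 : EtaleGroupoid.{u, v}} (A : GSheaf.{u, v, w'} 𝒢) where
  /-- the sheaves of the resolution -/
  S : ℕ → GSheaf.{u, v, w} 𝒢
  /-- the augmentation -/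
  ε : GSheaf.Hom A (S 0)
  /-- the differentials -/
  d (q : ℕ) : GSheaf.Hom (S q) (S (q + 1))
  isCSoft (q : ℕ) : (S q).IsCSoft
  injective (x : 𝒢.Obj) : Function.Injective (ε.app x)
  exact_zero (x : 𝒢.Obj) : Function.Exact (ε.app x) ((d 0).app x)
  exact_succ (q : ℕ) (x : 𝒢.Obj) : Function.Exact ((d q).app x) ((d (q + 1)).app x)

section Graded

variable {I : Type*} [DecidableEq I] {A : I → Type*} [∀ i, AddCommGroup (A i)]

/-- The degree `n` part of a direct sum, for a given degree function on the index set. -/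
def degPart (A : I → Type*) [∀ i, AddCommGroup (A i)] (deg : I → ℤ) (n : ℤ) :
    AddSubgroup (⨁ i, A i) where
  carrier := {c | ∀ i, deg i ≠ n → c i = 0}
  zero_mem' _ _ := rfl
  add_mem' h h' i hi := by rw [DirectSum.add_apply, h i hi, h' i hi, add_zero]
  neg_mem' h i hi := by rw [DFinsupp.neg_apply, h i hi, neg_zero]

/-- The degree `n` cycles of an endomorphism `D` of a direct sum. -/
def cycles (deg : I → ℤ) (D : (⨁ i, A i) →+ ⨁ i, A i) (n : ℤ) : AddSubgroup (⨁ i, A i) :=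
  degPart A deg n ⊓ D.ker

/-- The homology `{c of degree n | D c = 0} / {D b | b of degree m}`. -/
abbrev Homology (deg : I → ℤ) (D : (⨁ i, A i) →+ ⨁ i, A i) (m n : ℤ) : Type _ :=
  cycles deg D n ⧸ ((degPart A deg m).map D).addSubgroupOf (cycles deg D n)

/-- The homology class of a cycle. -/
def Homology.cls {deg : I → ℤ} {D : (⨁ i, A i) →+ ⨁ i, A i} {m n : ℤ} (c : ⨁ i, A i)
    (hc : c ∈ cycles deg D n) : Homology deg D m n :=
  QuotientAddGroup.mk ⟨c, hc⟩

/-- An endomorphism compatible with `D` and the grading induces a map on homology. -/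
def Homology.map {deg : I → ℤ} {D : (⨁ i, A i) →+ ⨁ i, A i} (m n : ℤ)
    (φ : (⨁ i, A i) →+ ⨁ i, A i) (hφ : ∀ k, ∀ c ∈ degPart A deg k, φ c ∈ degPart A deg k)
    (hD : ∀ c, D (φ c) = φ (D c)) : Homology deg D m n →+ Homology deg D m n :=
  QuotientAddGroup.map _ _
    ((φ.comp (cycles deg D n).subtype).codRestrict (cycles deg D n) fun c =>
      ⟨hφ n _ c.2.1, by
        have : D c = 0 := c.2.2
        simp [hD, this]⟩)
    (by
      rintro ⟨c, hc⟩ ⟨b, hb, hbc⟩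
      refine ⟨φ b, hφ m b hb, ?_⟩
      simp only [AddSubgroup.coe_subtype] at hbc
      subst hbc
      exact hD b)

end Graded

namespace SoftResolution

variable {𝒢 : EtaleGroupoid.{u, v}} {A : GSheaf.{u, v, w'} 𝒢} (R : SoftResolution.{u, v, w, w'} A)

/-- The double complex with entry `Γ_c(𝒢⁽ᵖ⁾; S^q_p)` at `(p, q)`. -/
abbrev Entry (pq : ℕ × ℕ) : Type _ := (R.S pq.2).GammaC (tau (𝒢 := 𝒢) pq.1)

/-- The horizontal differential on the total complex. -/
def horiz : ∀ pq : ℕ × ℕ, R.Entry pq →+ ⨁ pq, R.Entry pq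
  | (0, _) => 0
  | (p + 1, q) => (DirectSum.of R.Entry (p, q)).comp (bar (R.S q) p)

/-- The vertical differential on the total complex, before the sign is introduced. -/
def vert (pq : ℕ × ℕ) : R.Entry pq →+ ⨁ pq, R.Entry pq :=
  (DirectSum.of R.Entry (pq.1, pq.2 + 1)).comp ((R.d pq.2).mapGammaC (tau pq.1))

/-- The differential of the direct sum total complex, equal to `δ + (-1)ᵖ d` on `(p, q)`. -/
def totalD : (⨁ pq, R.Entry pq) →+ ⨁ pq, R.Entry pq :=
  DirectSum.toAddMonoid fun pq => R.horiz pq + (-1 : ℤ) ^ pq.1 • R.vert pq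

/-- The entry `(p, q)` of the double complex has total degree `p - q`. -/
def totalDeg (pq : ℕ × ℕ) : ℤ := pq.1 - pq.2

/-- The cycles of degree `n` in the total complex. -/
abbrev totalCycles (n : ℤ) : AddSubgroup (⨁ pq, R.Entry pq) := cycles totalDeg R.totalD n

/-- The groupoid homology `H_n(𝒢; A)`, computed with the resolution `R`: the homology in degree `n`
of the direct sum total complex. -/
abbrev GroupoidHomology (n : ℤ) : Type _ := Homology totalDeg R.totalD (n + 1) n

/-- The group `Γ_c(𝒢⁽⁰⁾; S^q)`. -/
abbrev Sec (q : ℕ) : Type _ := (R.S q).GammaC (ContinuousMap.id 𝒢.Obj)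

/-- The differential of the complex `Γ_c(𝒢⁽⁰⁾; S⁰) → Γ_c(𝒢⁽⁰⁾; S¹) → ⋯`. -/
def secD : (⨁ q, R.Sec q) →+ ⨁ q, R.Sec q :=
  DirectSum.toAddMonoid fun q => (DirectSum.of R.Sec (q + 1)).comp ((R.d q).mapGammaC _)

/-- The cocycles of degree `m` in `Γ_c(𝒢⁽⁰⁾; S^•)`. -/
abbrev cocycles (m : ℤ) : AddSubgroup (⨁ q, R.Sec q) := cycles (fun q : ℕ => (q : ℤ)) R.secD m

/-- The compactly supported sheaf cohomology `H_c^m(𝒢⁽⁰⁾; A)`, computed with the resolution `R`;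
it vanishes for `m < 0`. -/
abbrev CompactCohomology (m : ℤ) : Type _ := Homology (fun q : ℕ => (q : ℤ)) R.secD (m - 1) m

theorem totalD_of (pq : ℕ × ℕ) (t : R.Entry pq) : R.totalD (DirectSum.of R.Entry pq t) =
    R.horiz pq t + (-1 : ℤ) ^ pq.1 • R.vert pq t :=
  DirectSum.toAddMonoid_of _ pq t

theorem secD_of (q : ℕ) (z : R.Sec q) : R.secD (DirectSum.of R.Sec q z) =
    DirectSum.of R.Sec (q + 1) ((R.d q).mapGammaC _ z) :=
  DirectSum.toAddMonoid_of _ q z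

/-- The inclusion of `Γ_c(𝒢⁽⁰⁾; S^•)` as the column `p = 0` of the double complex. -/
def colZero : (⨁ q, R.Sec q) →+ ⨁ pq, R.Entry pq :=
  DirectSum.toAddMonoid fun q => (DirectSum.of R.Entry (0, q)).comp (toStrZero (R.S q))

theorem colZero_of (q : ℕ) (z : R.Sec q) : R.colZero (DirectSum.of R.Sec q z) =
    DirectSum.of R.Entry (0, q) (toStrZero (R.S q) z) :=
  DirectSum.toAddMonoid_of _ q z

theorem totalD_colZero (c : ⨁ q, R.Sec q) : R.totalD (R.colZero c) = R.colZero (R.secD c) := by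
  induction c using DirectSum.induction_on with
  | zero => simp
  | add a b ha hb => simp [ha, hb]
  | of q z =>
    rw [secD_of, colZero_of, colZero_of, totalD_of]
    change 0 + (-1 : ℤ) ^ 0 • _ = _
    rw [pow_zero, one_smul, zero_add]
    rfl

theorem colZero_mem_degPart {n : ℤ} {c : ⨁ q, R.Sec q}
    (hc : c ∈ degPart R.Sec (fun q : ℕ => (q : ℤ)) (-n)) :
    R.colZero c ∈ degPart R.Entry totalDeg n := by
  classical
  rw [← DirectSum.sum_support_of c, map_sum]
  refine sum_mem fun q hq => ?_
  rw [colZero_of]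
  intro pq hpq
  refine DirectSum.of_eq_of_ne _ _ _ fun h => hpq ?_
  subst h
  have h : (q : ℤ) = -n := by
    by_contra h
    exact DFinsupp.mem_support_iff.1 hq (hc q h)
  simp [totalDeg, h]

theorem colZero_mem_totalCycles {n : ℤ} {c : ⨁ q, R.Sec q} (hc : c ∈ R.cocycles (-n)) :
    R.colZero c ∈ R.totalCycles n := by
  refine ⟨R.colZero_mem_degPart hc.1, ?_⟩
  have h : R.secD c = 0 := hc.2
  simp [totalD_colZero, h]

end SoftResolution

/-! ## Transformation groupoids -/

section Transformation

variable (Γ : Type v) [Group Γ] (X : Type u) [TopologicalSpace X] [MulAction Γ X]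

/-- The points of `X`, as objects of the transformation groupoid. -/
def TransObj (_Γ : Type v) (X : Type u) : Type u := X

instance : TopologicalSpace (TransObj Γ X) := inferInstanceAs (TopologicalSpace X)
instance : MulAction Γ (TransObj Γ X) := inferInstanceAs (MulAction Γ X)
instance [T2Space X] : T2Space (TransObj Γ X) := inferInstanceAs (T2Space X)
instance [LocallyCompactSpace X] : LocallyCompactSpace (TransObj Γ X) :=
  inferInstanceAs (LocallyCompactSpace X)
instance [ContinuousConstSMul Γ X] : ContinuousConstSMul Γ (TransObj Γ X) :=
  inferInstanceAs (ContinuousConstSMul Γ X)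

/-- The arrows `x ⟶ y` of `Γ ⋉ X` are the `γ ∈ Γ` with `γ x = y`; i.e. the element `(γ, x)` of
`Γ × X` has source `x` and range `γ x`.  The composite of `(α, x)` followed by `(γ, α x)`
is `(γ α, x)`, and the inverse of `(γ, x)` is `(γ⁻¹, γ x)`. -/
instance transGroupoid : Groupoid.{v} (TransObj Γ X) where
  Hom x y := {γ : Γ // γ • x = y}
  id x := ⟨1, one_smul Γ x⟩
  comp f g := ⟨g.1 * f.1, by rw [mul_smul, f.2, g.2]⟩
  inv f := ⟨f.1⁻¹, inv_smul_eq_iff.2 f.2.symm⟩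
  id_comp f := Subtype.ext (mul_one f.1)
  comp_id f := Subtype.ext (one_mul f.1)
  assoc f g h := Subtype.ext (mul_assoc h.1 g.1 f.1).symm
  inv_comp f := Subtype.ext (mul_inv_cancel f.1)
  comp_inv f := Subtype.ext (inv_mul_cancel f.1)

/-- The bijection from the arrows of `Γ ⋉ X` to `Γ × X`. -/
def arrEquiv : Arr (TransObj Γ X) ≃ Γ × TransObj Γ X where
  toFun f := (f.hom.1, f.src)
  invFun p := Arr.mk (⟨p.1, rfl⟩ : p.2 ⟶ p.1 • p.2)
  left_inv := by rintro ⟨f, rfl⟩; rfl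
  right_inv _ := rfl

/-- The space of arrows of `Γ ⋉ X` is `Γ × X`, where `Γ` is discrete. -/
instance : TopologicalSpace (Arr (TransObj Γ X)) :=
  let _ : TopologicalSpace Γ := ⊥
  TopologicalSpace.induced (arrEquiv Γ X) inferInstance

variable {Γ X}

theorem continuous_arr_iff {Y : Type*} [TopologicalSpace Y] {f : Y → Arr (TransObj Γ X)} :
    Continuous f ↔ (∀ γ, IsOpen {y | (f y).hom.1 = γ}) ∧ Continuous fun y => (f y).src := by
  let _ : TopologicalSpace Γ := ⊥
  have : DiscreteTopology Γ := ⟨rfl⟩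
  rw [continuous_induced_rng]
  constructor
  · intro h
    exact ⟨fun γ => (isOpen_discrete {γ}).preimage (continuous_fst.comp h), continuous_snd.comp h⟩
  · rintro ⟨h1, h2⟩
    exact (continuous_discrete_rng.2 h1).prodMk h2

theorem continuous_arr_tgt [ContinuousConstSMul Γ X] :
    Continuous fun f : Arr (TransObj Γ X) => f.tgt := by
  have h := continuous_arr_iff.1 (continuous_id (X := Arr (TransObj Γ X)))
  refine continuous_iff_continuousAt.2 fun f => ?_
  have h2 : Continuous fun g : Arr (TransObj Γ X) => f.hom.1 • g.src := h.2.const_smul _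
  refine h2.continuousAt.congr (Filter.eventually_of_mem ((h.1 f.hom.1).mem_nhds rfl) ?_)
  intro g (hg : g.hom.1 = f.hom.1)
  change f.hom.1 • g.src = g.tgt
  rw [← hg]
  exact g.hom.2

variable (Γ X) in
/-- The transformation groupoid `Γ ⋉ X` of an action of the discrete group `Γ` by homeomorphisms
of a locally compact Hausdorff space `X`. -/
abbrev transformationGroupoid [T2Space X] [LocallyCompactSpace X] [ContinuousConstSMul Γ X] :
    EtaleGroupoid.{u, v} where
  Obj := TransObj Γ X
  t2Arr := by
    let _ : TopologicalSpace Γ := ⊥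
    have : DiscreteTopology Γ := ⟨rfl⟩
    exact T2Space.of_injective_continuous (arrEquiv Γ X).injective continuous_induced_dom
  isLocalHomeomorph_src := by
    have h := continuous_arr_iff.1 (continuous_id (X := Arr (TransObj Γ X)))
    refine isLocalHomeomorph_of_local_sections h.2 (fun f => ?_) (fun f => ?_)
    · refine ⟨_, h.1 f.hom.1, rfl, fun g hg g' hg' hs => (arrEquiv Γ X).injective ?_⟩
      exact Prod.ext (hg.trans hg'.symm) hs
    · refine ⟨Set.univ, fun x => (arrEquiv Γ X).symm (f.hom.1, x), isOpen_univ, trivial,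
        Continuous.continuousOn ?_, (arrEquiv Γ X).symm_apply_apply f, fun _ _ => rfl⟩
      exact continuous_arr_iff.2 ⟨fun γ => isOpen_const (p := _ = γ), continuous_id⟩
  continuous_unit := continuous_arr_iff.2 ⟨fun γ => isOpen_const (p := _ = γ), continuous_id⟩
  continuous_inv := by
    have h := continuous_arr_iff.1 (continuous_id (X := Arr (TransObj Γ X)))
    refine continuous_arr_iff.2 ⟨fun γ => ?_, continuous_arr_tgt⟩
    convert h.1 γ⁻¹ using 3 with f
    rw [← Groupoid.inv_eq_inv]
    exact inv_eq_iff_eq_inv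
  continuous_comp := by
    let _ : TopologicalSpace (CompPair (TransObj Γ X)) := TopologicalSpace.induced
      (fun p => (Arr.mk p.fst, Arr.mk p.snd)) inferInstance
    have hp : Continuous fun p : CompPair (TransObj Γ X) => (Arr.mk p.fst, Arr.mk p.snd) :=
      continuous_induced_dom
    have h1 := continuous_arr_iff.1 (continuous_fst.comp hp)
    have h2 := continuous_arr_iff.1 (continuous_snd.comp hp)
    refine continuous_arr_iff.2 ⟨fun γ => ?_, h1.2⟩
    have : {p : CompPair (TransObj Γ X) | (Arr.mk (p.fst ≫ p.snd)).hom.1 = γ} =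
        ⋃ α : Γ, {p | p.fst.1 = α} ∩ {p | p.snd.1 = γ * α⁻¹} := by
      ext p
      simp only [Set.mem_ofPred_eq, Set.mem_iUnion, Set.mem_inter_iff, exists_eq_left']
      exact eq_mul_inv_iff_mul_eq.symm
    rw [this]
    exact isOpen_iUnion fun α => (h1.1 α).inter (h2.1 _)

end Transformation

section Action

variable {Γ : Type v} [Group Γ] {X : Type u} [TopologicalSpace X] [MulAction Γ X] [T2Space X]
  [LocallyCompactSpace X] [ContinuousConstSMul Γ X]

/-- The arrow `γ⁻¹ x ⟶ x` of the transformation groupoid given by `γ`. -/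
def arrowTo (γ : Γ) (x : TransObj Γ X) : γ⁻¹ • x ⟶ x := ⟨γ, smul_inv_smul γ x⟩

theorem continuous_arrowTo (γ : Γ) :
    Continuous fun x : TransObj Γ X => Arr.mk (arrowTo γ x) :=
  continuous_arr_iff.2 ⟨fun δ => isOpen_const (p := γ = δ), continuous_const_smul γ⁻¹⟩

/-- The action of `γ ∈ Γ` on compactly supported sections of an equivariant sheaf:
`(γ t)(x) = γ (t (γ⁻¹ x))`. -/
def translate (S : GSheaf.{u, v, w} (transformationGroupoid Γ X)) (γ : Γ) :
    S.GammaC (ContinuousMap.id (TransObj Γ X)) →+ S.GammaC (ContinuousMap.id (TransObj Γ X)) :=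
  (S.transportGammaC (arrowTo γ) (continuous_arrowTo γ)).comp
    (S.pullGammaC (fun x : TransObj Γ X => γ⁻¹ • x) (Homeomorph.smul γ⁻¹).isProperMap
      (ContinuousMap.id (TransObj Γ X)))

theorem translate_apply (S : GSheaf.{u, v, w} (transformationGroupoid Γ X)) (γ : Γ)
    (t : S.GammaC (ContinuousMap.id (TransObj Γ X))) (x : TransObj Γ X) :
    (translate S γ t).1 x = S.act (arrowTo γ x) (t.1 (γ⁻¹ • x)) := rfl

theorem act_congr (S : GSheaf.{u, v, w} (transformationGroupoid Γ X))
    (t : ∀ x : TransObj Γ X, S.Stalk x) {x y y' : TransObj Γ X} (f : y ⟶ x) (f' : y' ⟶ x)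
    (h : y = y') (h' : f.1 = f'.1) : S.act f (t y) = S.act f' (t y') := by
  subst h
  obtain rfl : f = f' := Subtype.ext h'
  rfl

theorem translate_one (S : GSheaf.{u, v, w} (transformationGroupoid Γ X))
    (t : S.GammaC (ContinuousMap.id (TransObj Γ X))) : translate S 1 t = t := by
  refine Subtype.ext (funext fun x => ?_)
  rw [translate_apply]
  refine (act_congr S t.1 (arrowTo 1 x) (𝟙 x) (by rw [inv_one, one_smul]) rfl).trans ?_
  exact S.act_id x _

theorem translate_mul (S : GSheaf.{u, v, w} (transformationGroupoid Γ X)) (γ δ : Γ)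
    (t : S.GammaC (ContinuousMap.id (TransObj Γ X))) :
    translate S (γ * δ) t = translate S γ (translate S δ t) := by
  refine Subtype.ext (funext fun x => ?_)
  rw [translate_apply, translate_apply, translate_apply]
  refine (act_congr S t.1 (arrowTo (γ * δ) x) (arrowTo δ (γ⁻¹ • x) ≫ arrowTo γ x)
    (by rw [mul_inv_rev, mul_smul]) rfl).trans ?_
  exact S.act_comp _ _ _

theorem mapGammaC_translate {S : GSheaf.{u, v, w} (transformationGroupoid Γ X)}
    {T : GSheaf.{u, v, w'} (transformationGroupoid Γ X)} (φ : GSheaf.Hom S T) (γ : Γ)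
    (t : S.GammaC (ContinuousMap.id (TransObj Γ X))) :
    φ.mapGammaC _ (translate S γ t) = translate T γ (φ.mapGammaC _ t) :=
  Subtype.ext (funext fun x => φ.app_act (arrowTo γ x) _)

variable {A : GSheaf.{u, v, w'} (transformationGroupoid Γ X)}

namespace SoftResolution

variable (R : SoftResolution.{u, v, w, w'} A)

/-- The action of `Γ` on the complex `Γ_c(X; S^•)`. -/
def chainAction (γ : Γ) : (⨁ q, R.Sec q) →+ ⨁ q, R.Sec q :=
  DirectSum.map fun q => translate (R.S q) γ

theorem chainAction_of (γ : Γ) (q : ℕ) (t : R.Sec q) : R.chainAction γ (DirectSum.of R.Sec q t) =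
    DirectSum.of R.Sec q (translate (R.S q) γ t) :=
  DirectSum.map_of _ _ _

theorem chainAction_one (c : ⨁ q, R.Sec q) : R.chainAction (1 : Γ) c = c := by
  induction c using DirectSum.induction_on with
  | zero => simp
  | add a b ha hb => simp [ha, hb]
  | of q z => rw [chainAction_of, translate_one]

theorem chainAction_mul (γ δ : Γ) (c : ⨁ q, R.Sec q) :
    R.chainAction (γ * δ) c = R.chainAction γ (R.chainAction δ c) := by
  induction c using DirectSum.induction_on with
  | zero => simp
  | add a b ha hb => simp [ha, hb]
  | of q z => rw [chainAction_of, chainAction_of, chainAction_of, translate_mul]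

theorem chainAction_mem (γ : Γ) (m : ℤ) (c : ⨁ q, R.Sec q)
    (hc : c ∈ degPart R.Sec (fun q : ℕ => (q : ℤ)) m) :
    R.chainAction γ c ∈ degPart R.Sec (fun q : ℕ => (q : ℤ)) m := by
  intro q hq
  have h : R.chainAction γ c q = translate (R.S q) γ (c q) := DirectSum.map_apply _ _ _
  rw [h, hc q hq, map_zero]

theorem secD_chainAction (γ : Γ) (c : ⨁ q, R.Sec q) :
    R.secD (R.chainAction γ c) = R.chainAction γ (R.secD c) := by
  induction c using DirectSum.induction_on with
  | zero => simp
  | add a b ha hb => simp [ha, hb]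
  | of q z =>
    rw [chainAction_of, secD_of, secD_of, chainAction_of]
    exact congrArg _ (mapGammaC_translate _ _ _)

/-- The action of `Γ` on `H_c^m(X; A)` induced by its action on compactly supported sections. -/
def cohomologyAction (m : ℤ) : Representation ℤ Γ (R.CompactCohomology m) where
  toFun γ := (Homology.map (m - 1) m (R.chainAction γ) (R.chainAction_mem γ)
    (R.secD_chainAction γ)).toIntLinearMap
  map_one' := by
    refine LinearMap.ext fun c => ?_
    obtain ⟨c, rfl⟩ := QuotientAddGroup.mk_surjective c
    exact congrArg QuotientAddGroup.mk (Subtype.ext (R.chainAction_one c.1))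
  map_mul' γ δ := by
    refine LinearMap.ext fun c => ?_
    obtain ⟨c, rfl⟩ := QuotientAddGroup.mk_surjective c
    exact congrArg QuotientAddGroup.mk (Subtype.ext (R.chainAction_mul γ δ c.1))

end SoftResolution

/-- The string `x ← γ⁻¹ x` of length one, with arrow `γ`. -/
def strOne (γ : Γ) (x : TransObj Γ X) : Str (transformationGroupoid Γ X) 1 :=
  Str.ofStar (c := x) (x := Fin.cases x fun _ => γ⁻¹ • x)
    (Fin.cases (𝟙 x) fun _ => arrowTo γ x)

theorem strOne_arrow (γ : Γ) (x : TransObj Γ X) :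
    (strOne γ x).arrow (Fin.zero_le 1) = arrowTo γ x := by
  change arrowTo γ x ≫ inv (𝟙 x) = _
  rw [IsIso.inv_id, Category.comp_id]

theorem isLocalHomeomorph_strOne (γ : Γ) : IsLocalHomeomorph (strOne (X := X) γ) := by
  refine IsLocalHomeomorph.of_comp (g := Str.vertex 0) (Homeomorph.refl X).isLocalHomeomorph
    (Str.isLocalHomeomorph_vertex 0) (Str.continuous_iff.2 ⟨?_, ?_⟩)
  · exact Fin.cases continuous_id fun _ => continuous_const_smul γ⁻¹
  · intro i
    obtain rfl : i = 0 := Fin.fin_one_eq_zero i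
    exact (continuous_arrowTo γ).congr fun x => congrArg Arr.mk (strOne_arrow γ x).symm

/-- Extension by zero `Γ_c(X; S) → Γ_c(𝒢⁽¹⁾; S₁)` along the open embedding `x ↦ (x ← γ⁻¹ x)`:
the section `z` is placed on the strings whose arrow is given by `γ`. -/
def toStrOne (S : GSheaf.{u, v, w} (transformationGroupoid Γ X)) (γ : Γ) :
    S.GammaC (ContinuousMap.id (TransObj Γ X)) →+
      S.GammaC (tau (𝒢 := transformationGroupoid Γ X) 1) :=
  S.pushGammaC (strOne γ) (isLocalHomeomorph_strOne γ) (tau 1)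

/-- The map `Γ_c(X; S^•) → Γ_c(𝒢⁽¹⁾; S₁^•)` to the column `p = 1` of the double complex that
places a section on the arrows given by `γ`. -/
def SoftResolution.colOne (R : SoftResolution.{u, v, w, w'} A) (γ : Γ) :
    (⨁ q, R.Sec q) →+ ⨁ pq, R.Entry pq :=
  DirectSum.toAddMonoid fun q => (DirectSum.of R.Entry (1, q)).comp (toStrOne (R.S q) γ)

end Action

end CMHom

end

/-! Existence of resolutions. The germs of arbitrary integer valued functions of n + 1 variables,
with no continuity condition, form the Alexander–Spanier sheaves, on which the group acts by
translating all variables. Freezing the first variable of a cocycle at x exhibits it near x as a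
coboundary, so the stalks are exact. A cochain can be multiplied by the indicator function of any
set, so sections can be cut off, and the sheaves are c-soft (`alexanderSpanierResolution`).

The bar complex. As Γ is discrete, the space of strings of length p is a disjoint union of open
copies of X (sheets), one for each tuple of labels in Γᵖ, and a compact set meets only finitely many
of them. With M = Γ_c(X; S), the sections over this space are therefore the finitely supported
functions Γᵖ → M (`chainEquiv`), and δ becomes the bar differential of group homology with
coefficients in M (`bar_sheet`, `bar_chainEquiv`).

Contraction for Γ = ℤ. Let t be the generator. The bar complex retracts onto the two-term complex
t⁻¹ - 1 : M → M, formed by degree zero and the chains [t]m in degree one. The homotopy sends [x |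
tᵏ], up to sign, to ∑_{0 ≤ j < k} [x | tʲ | t] - [x | 1 | 1], whose boundary telescopes
(`diff_homotopy`, `diff_homotopy_one`). The projection in degree one sends [tᵏ]m to ∑_{0 ≤ j < k}
t⁻ʲ m (`toGenerator_diff`, `diff_zero_eq`).

Total complex. All of this is natural in M, so it commutes with the differential of the resolution
and yields a homotopy on the total complex (`totalD_totalHomotopy`). Hence every cycle is homologous
to a pair (w, z), with w in the column p = 0 and z on the generator arrows, and such pairs have
differential (d w + (t⁻¹ z - z), -d z). This is the mapping cone of t⁻¹ - 1 on Γ_c(X; S^•). Its long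
exact sequence breaks up into short ones whose outer terms are the cokernel and the kernel of t⁻¹ -
1 on cohomology. Since t⁻¹ generates ℤ, these are the coinvariants and the invariants. The
statements for n ≥ 1 follow from the vanishing of H_c in negative degrees. -/

noncomputable section

namespace CMHom

open EtaleGroupoid

/-! ## Alexander–Spanier cochains -/

/-- Integer valued functions of `n + 1` variables in `X`, in curried form. -/
def Cochain (X : Type u) : ℕ → Type u
  | 0 => X → ℤ
  | n + 1 => X → Cochain X n

namespace Cochain

variable {X : Type u}

instance instAddCommGroup : ∀ n, AddCommGroup (Cochain X n)
  | 0 => inferInstanceAs (AddCommGroup (X → ℤ))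
  | n + 1 => @Pi.addCommGroup X (fun _ => Cochain X n) fun _ => instAddCommGroup n

/-- The cochains that vanish on `U × ⋯ × U`. -/
def vanishing (U : Set X) : ∀ n, AddSubgroup (Cochain X n)
  | 0 =>
    { carrier := {f | ∀ x ∈ U, f x = 0}
      zero_mem' := fun _ _ => rfl
      add_mem' := fun {f g} hf hg x hx => by
        change f x + g x = 0
        rw [hf x hx, hg x hx, add_zero]
      neg_mem' := fun {f} hf x hx => by
        change -f x = 0
        rw [hf x hx, neg_zero] }
  | n + 1 =>
    { carrier := {f | ∀ x ∈ U, f x ∈ vanishing U n}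
      zero_mem' := fun _ _ => zero_mem _
      add_mem' := fun hf hg x hx => add_mem (hf x hx) (hg x hx)
      neg_mem' := fun hf x hx => neg_mem (hf x hx) }

theorem vanishing_anti {U V : Set X} (h : U ⊆ V) : ∀ n, vanishing V n ≤ vanishing U n
  | 0 => fun _ hf x hx => hf x (h hx)
  | n + 1 => fun _ hf x hx => vanishing_anti h n (hf x (h hx))

/-- The constant cochain. -/
def const : ℤ →+ Cochain X 0 where
  toFun c := fun _ => c
  map_zero' := rfl
  map_add' _ _ := rfl

/-- The Alexander–Spanier differential. -/
def d : ∀ n, Cochain X n →+ Cochain X (n + 1)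
  | 0 =>
    { toFun := fun f x => f - const (f x)
      map_zero' := funext fun _ => sub_zero _
      map_add' := fun f g => funext fun x => by
        change f + g - const (f x + g x) = (f - const (f x)) + (g - const (g x))
        rw [map_add]; abel }
  | n + 1 =>
    -- Recursion on the first variable: `f` is the summand in which it is omitted, and the other
    -- summands form the differential of `f x`, with the opposite sign.
    { toFun := fun f x => f - d n (f x)
      map_zero' := funext fun x => by
        change (0 : Cochain X (n + 1)) - d n 0 = 0
        rw [map_zero, sub_zero]
      map_add' := fun f g => funext fun x => by
        change f + g - d n (f x + g x) = (f - d n (f x)) + (g - d n (g x))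
        rw [map_add]; abel }

theorem d_zero_apply (f : Cochain X 0) (x : X) : d 0 f x = f - const (f x) := rfl

theorem d_succ_apply (n : ℕ) (f : Cochain X (n + 1)) (x : X) :
    d (n + 1) f x = f - d n (f x) := rfl

theorem d_const (c : ℤ) : d 0 (const c : Cochain X 0) = 0 :=
  funext fun x => by
    rw [d_zero_apply]
    exact sub_self _

/-- By induction on the number of variables: at `x` one gets d f - d (f - d (f x)), which leaves d
(d (f x)). -/
theorem d_d : ∀ n (f : Cochain X n), d (n + 1) (d n f) = 0
  | 0, f => funext fun x => by
    rw [d_succ_apply, d_zero_apply, map_sub, d_const, sub_zero, sub_self]; rfl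
  | n + 1, f => funext fun x => by
    rw [d_succ_apply, d_succ_apply, map_sub, d_d n, sub_zero, sub_self]; rfl

/-- This locality lets the differential act on germs. -/
theorem d_mem_vanishing {U : Set X} : ∀ {n} {f : Cochain X n}, f ∈ vanishing U n →
    d n f ∈ vanishing U (n + 1)
  | 0, f, hf => fun x hx => by
    rw [d_zero_apply, hf x hx, map_zero, sub_zero]; exact hf
  | n + 1, f, hf => fun x hx => by
    rw [d_succ_apply]; exact sub_mem hf (d_mem_vanishing (hf x hx))

/-- Multiplication by the indicator function of `V` in the first variable. -/
def cutOff (V : Set X) : ∀ n, Cochain X n →+ Cochain X n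
  | 0 =>
    { toFun := V.indicator (M := ℤ)
      map_zero' := Set.indicator_zero ℤ V
      map_add' := Set.indicator_add V }
  | n + 1 =>
    { toFun := V.indicator (M := Cochain X n)
      map_zero' := Set.indicator_zero _ V
      map_add' := Set.indicator_add V }

theorem cutOff_apply_of_mem {V : Set X} {x : X} (hx : x ∈ V) {n : ℕ} (f : Cochain X (n + 1)) :
    cutOff V (n + 1) f x = f x :=
  Set.indicator_of_mem hx (f : X → Cochain X n)

theorem cutOff_apply_of_notMem {V : Set X} {x : X} (hx : x ∉ V) {n : ℕ} (f : Cochain X (n + 1)) :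
    cutOff V (n + 1) f x = 0 :=
  Set.indicator_of_notMem hx (f : X → Cochain X n)

theorem cutOff_mem_vanishing {V U : Set X} : ∀ {n} {f : Cochain X n},
    f ∈ vanishing U n → cutOff V n f ∈ vanishing U n
  | 0, _, hf => fun x hx => Set.indicator_apply_eq_zero.2 fun _ => hf x hx
  | n + 1, f, hf => fun x hx => by
    by_cases h : x ∈ V
    · rw [cutOff_apply_of_mem h]; exact hf x hx
    · rw [cutOff_apply_of_notMem h]; exact zero_mem _

/-- Hence cutting off does not change germs at interior points of `V`. -/
theorem cutOff_sub_mem_vanishing {V : Set X} : ∀ {n} (f : Cochain X n),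
    cutOff V n f - f ∈ vanishing V n
  | 0, f => fun _ hx => sub_eq_zero.2 (Set.indicator_of_mem hx (f : X → ℤ))
  | n + 1, f => fun x hx => by
    change cutOff V (n + 1) f x - f x ∈ _
    rw [cutOff_apply_of_mem hx, sub_self]
    exact zero_mem _

/-- Hence the cut-off has zero germ at every point outside the closure of `V`. -/
theorem cutOff_mem_vanishing_of_disjoint {V U : Set X} (h : Disjoint U V) :
    ∀ {n} (f : Cochain X n), cutOff V n f ∈ vanishing U n
  | 0, f => fun _ hx => Set.indicator_of_notMem (Set.disjoint_left.1 h hx) (f : X → ℤ)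
  | n + 1, f => fun x hx => by
    rw [cutOff_apply_of_notMem (Set.disjoint_left.1 h hx)]
    exact zero_mem _

/-! ### The group action on cochains -/

section Translate

variable {Γ : Type v} [Group Γ] [MulAction Γ X]

/-- The action of a group element on cochains by `(γ f)(x, …) = f (γ⁻¹ x, …)`. -/
def translate (γ : Γ) : ∀ n, Cochain X n →+ Cochain X n
  | 0 =>
    { toFun := fun f x => f (γ⁻¹ • x)
      map_zero' := rfl
      map_add' := fun _ _ => rfl }
  | n + 1 =>
    { toFun := fun f x => translate γ n (f (γ⁻¹ • x))
      map_zero' := funext fun _ => map_zero (translate γ n)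
      map_add' := fun _ _ => funext fun _ => map_add (translate γ n) _ _ }

theorem translate_succ_apply (γ : Γ) (n : ℕ) (f : Cochain X (n + 1)) (x : X) :
    translate γ (n + 1) f x = translate γ n (f (γ⁻¹ • x)) := rfl

theorem translate_one : ∀ n (f : Cochain X n), translate (1 : Γ) n f = f
  | 0, f => funext fun x => by
    change f ((1 : Γ)⁻¹ • x) = f x
    rw [inv_one, one_smul]
  | n + 1, f => funext fun x => by
    rw [translate_succ_apply, translate_one n, inv_one, one_smul]

theorem translate_mul (γ δ : Γ) : ∀ n (f : Cochain X n),
    translate (γ * δ) n f = translate γ n (translate δ n f)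
  | 0, f => funext fun x => by
    change f ((γ * δ)⁻¹ • x) = f (δ⁻¹ • γ⁻¹ • x)
    rw [mul_inv_rev, mul_smul]
  | n + 1, f => funext fun x => by
    simp only [translate_succ_apply]
    rw [translate_mul γ δ n, mul_inv_rev, mul_smul]

theorem translate_const (γ : Γ) (c : ℤ) :
    translate γ 0 (const c : Cochain X 0) = const c := rfl

theorem d_translate (γ : Γ) : ∀ n (f : Cochain X n),
    d n (translate γ n f) = translate γ (n + 1) (d n f)
  | 0, f => funext fun x => by
    rw [translate_succ_apply, d_zero_apply, d_zero_apply, map_sub, translate_const]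
    rfl
  | n + 1, f => funext fun x => by
    rw [translate_succ_apply, d_succ_apply, d_succ_apply, map_sub, translate_succ_apply,
      d_translate γ n]

/-- The set of vanishing moves with `γ`, so germs at `x` are sent to germs at `γ x`. -/
theorem translate_mem_vanishing (γ : Γ) {U : Set X} : ∀ {n} {f : Cochain X n},
    f ∈ vanishing U n → translate γ n f ∈ vanishing ((γ⁻¹ • ·) ⁻¹' U) n
  | 0, _, hf => fun x hx => hf (γ⁻¹ • x) hx
  | _ + 1, _, hf => fun x hx => translate_mem_vanishing γ (hf (γ⁻¹ • x) hx)

end Translate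

/-! ### Germs of cochains, their étale space, and softness -/

section Germs

variable [TopologicalSpace X]

/-- The cochains whose germ at `x` vanishes. -/
def nullAt (n : ℕ) (x : X) : AddSubgroup (Cochain X n) where
  carrier := {f | ∃ U ∈ 𝓝 x, f ∈ vanishing U n}
  zero_mem' := ⟨Set.univ, Filter.univ_mem, zero_mem _⟩
  add_mem' := fun ⟨U, hU, hf⟩ ⟨V, hV, hg⟩ => ⟨U ∩ V, Filter.inter_mem hU hV,
    add_mem (vanishing_anti Set.inter_subset_left _ hf)
      (vanishing_anti Set.inter_subset_right _ hg)⟩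
  neg_mem' := fun ⟨U, hU, hf⟩ => ⟨U, hU, neg_mem hf⟩

theorem isOpen_nullAt {n : ℕ} (f : Cochain X n) : IsOpen {x | f ∈ nullAt n x} := by
  refine isOpen_iff_mem_nhds.2 fun x ⟨U, hU, hf⟩ => ?_
  filter_upwards [eventually_mem_nhds_iff.2 hU] with y hy
  exact ⟨U, hy, hf⟩

variable (X) in
/-- The stalk at `x` of the Alexander–Spanier sheaf. -/
abbrev Stalk (n : ℕ) (x : X) : Type u := Cochain X n ⧸ nullAt n x

/-- The germ of a cochain. -/
abbrev germ {n : ℕ} (f : Cochain X n) (x : X) : Stalk X n x := QuotientAddGroup.mk f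

theorem germ_eq_iff {n : ℕ} {f g : Cochain X n} {x : X} :
    germ f x = germ g x ↔ g - f ∈ nullAt n x := by
  rw [QuotientAddGroup.eq, neg_add_eq_sub]

theorem isOpen_germ_eq {n : ℕ} (f g : Cochain X n) : IsOpen {x | germ f x = germ g x} := by
  simp only [germ_eq_iff]
  exact isOpen_nullAt _

/-- The section of the Alexander–Spanier sheaf determined by a cochain. -/
def toEt {n : ℕ} (f : Cochain X n) (x : X) : EtSpace (Stalk X n) := ⟨x, germ f x⟩

/-- The final topology for all the sections `toEt f`, so that openness of sets and continuity of
maps out of the étale space can be tested on cochains. -/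
instance (n : ℕ) : TopologicalSpace (EtSpace (Stalk X n)) :=
  ⨆ f : Cochain X n, TopologicalSpace.coinduced (toEt f) inferInstance

theorem isOpen_et_iff {n : ℕ} {W : Set (EtSpace (Stalk X n))} :
    IsOpen W ↔ ∀ f : Cochain X n, IsOpen (toEt f ⁻¹' W) := by
  simp only [isOpen_iSup_iff, isOpen_coinduced]

theorem continuous_toEt {n : ℕ} (f : Cochain X n) : Continuous (toEt f) :=
  ⟨fun _ hW => isOpen_et_iff.1 hW f⟩

theorem continuous_et_iff {n : ℕ} {Y : Type*} [TopologicalSpace Y]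
    {φ : EtSpace (Stalk X n) → Y} :
    Continuous φ ↔ ∀ f : Cochain X n, Continuous fun x => φ (toEt f x) := by
  simp only [continuous_def, isOpen_et_iff]
  exact ⟨fun h f s hs => h s hs f, fun h s hs f => h f s hs⟩

theorem continuous_base (n : ℕ) : Continuous (EtSpace.base : EtSpace (Stalk X n) → X) :=
  continuous_et_iff.2 fun _ => continuous_id

/-- Its preimage under `toEt g` is the set where `f` and `g` have the same germ, and this set is
open. -/
theorem isOpen_range_toEt {n : ℕ} (f : Cochain X n) : IsOpen (Set.range (toEt f)) := by
  refine isOpen_et_iff.2 fun g => ?_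
  convert isOpen_germ_eq f g using 1
  ext x
  refine ⟨?_, fun h => ⟨x, congrArg (EtSpace.mk x) h⟩⟩
  rintro ⟨y, hy⟩
  obtain rfl : y = x := congrArg EtSpace.base hy
  exact eq_of_heq (EtSpace.mk.inj hy).2

theorem toEt_surjective {n : ℕ} (e : EtSpace (Stalk X n)) : ∃ f, toEt f e.base = e := by
  obtain ⟨x, a⟩ := e
  obtain ⟨f, rfl⟩ := QuotientAddGroup.mk_surjective a
  exact ⟨f, rfl⟩

theorem germ_eq_of_mem_range {n : ℕ} {f : Cochain X n} {e : EtSpace (Stalk X n)}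
    (h : e ∈ Set.range (toEt f)) : e.germ = germ f e.base := by
  obtain ⟨x, rfl⟩ := h; rfl

theorem isLocalHomeomorph_base (n : ℕ) :
    IsLocalHomeomorph (EtSpace.base : EtSpace (Stalk X n) → X) := by
  refine isLocalHomeomorph_of_local_sections (continuous_base n) (fun e => ?_) (fun e => ?_)
  · obtain ⟨f, hf⟩ := toEt_surjective e
    refine ⟨_, isOpen_range_toEt f, ⟨_, hf⟩, ?_⟩
    rintro _ ⟨x, rfl⟩ _ ⟨y, rfl⟩ (h : x = y)
    rw [h]
  · obtain ⟨f, hf⟩ := toEt_surjective e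
    exact ⟨Set.univ, toEt f, isOpen_univ, trivial, (continuous_toEt f).continuousOn, hf,
      fun _ _ => rfl⟩

/-- The map on stalks induced by a local operator on cochains. -/
def stalkMap {n m : ℕ} (φ : Cochain X n →+ Cochain X m)
    (hφ : ∀ {U : Set X} {f}, f ∈ vanishing U n → φ f ∈ vanishing U m) (x : X) :
    Stalk X n x →+ Stalk X m x :=
  QuotientAddGroup.map _ _ φ fun _ ⟨U, hU, hf⟩ => ⟨U, hU, hφ hf⟩

theorem continuous_stalkMap {n m : ℕ} (φ : Cochain X n →+ Cochain X m)
    (hφ : ∀ {U : Set X} {f}, f ∈ vanishing U n → φ f ∈ vanishing U m) :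
    Continuous fun e : EtSpace (Stalk X n) =>
      (⟨e.base, stalkMap φ hφ e.base e.germ⟩ : EtSpace (Stalk X m)) :=
  continuous_et_iff.2 fun f => continuous_toEt (φ f)

/-- The section is multiplied by the indicator function of the interior of a compact neighbourhood
`L` of `K` inside `U`. Cochains need not be continuous, so this is a morphism of sheaves. It is the
identity over the interior of `L` and zero off the closure of that interior, so the product extends
by zero from `U` to all of `X`. -/
theorem exists_section_eqOn_nhds [T2Space X] [LocallyCompactSpace X] {n : ℕ} {K U : Set X}
    (hK : IsCompact K) (hU : IsOpen U) (hKU : K ⊆ U) (s : ∀ x, Stalk X n x)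
    (hs : ContinuousOn (fun x => (⟨x, s x⟩ : EtSpace (Stalk X n))) U) :
    ∃ V, IsOpen V ∧ K ⊆ V ∧ V ⊆ U ∧ ∃ t : ∀ x, Stalk X n x,
      Continuous (fun x => (⟨x, t x⟩ : EtSpace (Stalk X n))) ∧ ∀ x ∈ V, t x = s x := by
  obtain ⟨L, hL, hKL, hLU⟩ := exists_compact_between hK hU hKU
  have hcl : closure (interior L) ⊆ L := closure_minimal interior_subset hL.isClosed
  let χ : ∀ x, Stalk (X) n x →+ Stalk (X) n x :=
    stalkMap (cutOff (interior L) n) cutOff_mem_vanishing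
  have h1 : ∀ x ∈ interior L, ∀ a, χ x a = a := fun x hx a => by
    obtain ⟨f, rfl⟩ := QuotientAddGroup.mk_surjective a
    exact (germ_eq_iff.2 ⟨_, isOpen_interior.mem_nhds hx, cutOff_sub_mem_vanishing f⟩).symm
  have h0 : ∀ x ∈ (closure (interior L))ᶜ, ∀ a, χ x a = 0 := fun x hx a => by
    obtain ⟨f, rfl⟩ := QuotientAddGroup.mk_surjective a
    exact (QuotientAddGroup.eq_zero_iff _).2 ⟨_, isClosed_closure.isOpen_compl.mem_nhds hx,
      cutOff_mem_vanishing_of_disjoint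
        (Set.disjoint_compl_left_iff_subset.2 subset_closure) f⟩
  classical
  refine ⟨interior L, isOpen_interior, hKL, interior_subset.trans hLU,
    fun x => if x ∈ U then χ x (s x) else 0, ?_, ?_⟩
  · refine continuous_iff_continuousAt.2 fun x => ?_
    by_cases hx : x ∈ U
    · refine (((continuous_stalkMap (cutOff (interior L) n) cutOff_mem_vanishing).continuousAt).comp
        (hs.continuousAt (hU.mem_nhds hx))).congr (Filter.eventually_of_mem (hU.mem_nhds hx) ?_)
      intro y hy
      exact congrArg (EtSpace.mk y) (if_pos hy).symm
    -- A point off `U` has a neighbourhood that avoids the closure of the interior of `L`, and there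
    -- the new section is zero on both branches of the definition.
    · have hx' : x ∈ (closure (interior L))ᶜ := fun h => hx (hLU (hcl h))
      refine ((continuous_toEt (0 : Cochain X n)).continuousAt).congr
        (Filter.eventually_of_mem (isClosed_closure.isOpen_compl.mem_nhds hx') ?_)
      intro y hy
      refine congrArg (EtSpace.mk y) ?_
      by_cases hyU : y ∈ U
      · exact (h0 y hy _).symm.trans (if_pos hyU).symm
      · exact (if_neg hyU).symm
  · intro x hx
    exact (if_pos (hLU (interior_subset hx))).trans (h1 x hx _)

/-- The integer component is locally constant, so near each point the map is a single section
composed with the projection. -/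
theorem continuous_toEt_const :
    Continuous[TopologicalSpace.induced (fun e => (e.base, e.germ)) inferInstance, inferInstance]
      fun e : EtSpace fun _ : X => ℤ => toEt (const e.germ) e.base := by
  let _ : TopologicalSpace (EtSpace fun _ : X => ℤ) :=
    TopologicalSpace.induced (fun e => (e.base, e.germ)) inferInstance
  have hc : Continuous fun e : EtSpace fun _ : X => ℤ => (e.base, e.germ) :=
    continuous_induced_dom
  refine continuous_iff_continuousAt.2 fun e => ?_
  refine ((continuous_toEt (const e.germ)).comp
    (continuous_fst.comp hc)).continuousAt.congr (Filter.eventually_of_mem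
    (((isOpen_discrete {e.germ}).preimage (continuous_snd.comp hc)).mem_nhds rfl) ?_)
  intro e' (he' : e'.germ = e.germ)
  simp only [Function.comp_apply, he']

end Germs

end Cochain

/-! ## The Alexander–Spanier resolution -/

section AlexanderSpanier

open Cochain

variable (Γ : Type v) [Group Γ] (X : Type u) [TopologicalSpace X] [MulAction Γ X]
  [ContinuousConstSMul Γ X]

/-- The action of an arrow of the transformation groupoid on germs of cochains. -/
def stalkAct (n : ℕ) {x y : TransObj Γ X} (f : x ⟶ y) :
    Stalk (TransObj Γ X) n x →+ Stalk (TransObj Γ X) n y :=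
  QuotientAddGroup.map _ _ (Cochain.translate f.1 n) fun _ ⟨U, hU, hg⟩ =>
    ⟨_, (continuous_const_smul f.1⁻¹).continuousAt.preimage_mem_nhds
      (by rwa [inv_smul_eq_iff.2 f.2.symm]), translate_mem_vanishing f.1 hg⟩

variable [T2Space X] [LocallyCompactSpace X]

/-- The sheaf of germs of Alexander–Spanier cochains on `X`, as a `(Γ ⋉ X)`-sheaf. -/
def alexanderSpanier (n : ℕ) : GSheaf.{u, v, u} (transformationGroupoid Γ X) where
  Stalk := Stalk (TransObj Γ X) n
  top := inferInstance
  isLocalHomeomorph_base := isLocalHomeomorph_base n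
  continuous_zero := continuous_toEt 0
  continuous_neg := continuous_et_iff.2 fun f => continuous_toEt (-f)
  continuous_add := by
    let _ : TopologicalSpace (EtSpace fun x => Stalk (TransObj Γ X) n x × Stalk (TransObj Γ X) n x) :=
      TopologicalSpace.induced (fun p => ((⟨p.base, p.germ.1⟩, ⟨p.base, p.germ.2⟩) :
          EtSpace (Stalk (TransObj Γ X) n) × EtSpace (Stalk (TransObj Γ X) n))) inferInstance
    have hp : Continuous fun p : EtSpace fun x =>
        Stalk (TransObj Γ X) n x × Stalk (TransObj Γ X) n x =>
        ((⟨p.base, p.germ.1⟩, ⟨p.base, p.germ.2⟩) :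
          EtSpace (Stalk (TransObj Γ X) n) × EtSpace (Stalk (TransObj Γ X) n)) :=
      continuous_induced_dom
    -- Near `p` the two germs come from fixed cochains `f` and `g`, so the sum is given there by the
    -- section of `f + g`.
    refine continuous_iff_continuousAt.2 fun p => ?_
    obtain ⟨f, hf⟩ := toEt_surjective (⟨p.base, p.germ.1⟩ : EtSpace (Stalk (TransObj Γ X) n))
    obtain ⟨g, hg⟩ := toEt_surjective (⟨p.base, p.germ.2⟩ : EtSpace (Stalk (TransObj Γ X) n))
    have hO : IsOpen (Set.range (toEt f) ×ˢ Set.range (toEt g)) :=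
      (isOpen_range_toEt f).prod (isOpen_range_toEt g)
    have hs : Continuous fun p : EtSpace fun x =>
        Stalk (TransObj Γ X) n x × Stalk (TransObj Γ X) n x => toEt (f + g) p.base :=
      (continuous_toEt (f + g)).comp ((continuous_base n).comp (continuous_fst.comp hp))
    refine hs.continuousAt.congr (Filter.eventually_of_mem
      ((hO.preimage hp).mem_nhds ⟨⟨_, hf⟩, ⟨_, hg⟩⟩) ?_)
    rintro q ⟨h1, h2⟩
    have h1 := germ_eq_of_mem_range h1
    have h2 := germ_eq_of_mem_range h2
    exact congrArg (EtSpace.mk q.base) (congrArg₂ (· + ·) h1 h2).symm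
  act := stalkAct Γ X n
  act_id x a := by
    obtain ⟨f, rfl⟩ := QuotientAddGroup.mk_surjective a
    exact congrArg (germ · x) (Cochain.translate_one n f)
  act_comp {x y z} f g a := by
    obtain ⟨h, rfl⟩ := QuotientAddGroup.mk_surjective a
    exact congrArg (germ · z) (Cochain.translate_mul g.1 f.1 n h)
  continuous_act := by
    let _ : TopologicalSpace (ActPair (Stalk (TransObj Γ X) n)) := TopologicalSpace.induced
      (fun p => ((Arr.mk p.hom, ⟨p.x, p.germ⟩) :
        Arr (TransObj Γ X) × EtSpace (Stalk (TransObj Γ X) n))) inferInstance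
    have hp : Continuous fun p : ActPair (Stalk (TransObj Γ X) n) =>
        ((Arr.mk p.hom, ⟨p.x, p.germ⟩) :
        Arr (TransObj Γ X) × EtSpace (Stalk (TransObj Γ X) n)) := continuous_induced_dom
    -- Near `p` the arrow has constant label and the germ comes from a fixed cochain, so the action
    -- is given there by the section of the translated cochain.
    refine continuous_iff_continuousAt.2 fun p => ?_
    obtain ⟨f, hf⟩ := toEt_surjective (⟨p.x, p.germ⟩ : EtSpace (Stalk (TransObj Γ X) n))
    have hO : IsOpen ({a : Arr (TransObj Γ X) | a.hom.1 = p.hom.1} ×ˢ Set.range (toEt f)) :=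
      ((continuous_arr_iff.1 continuous_id).1 _).prod (isOpen_range_toEt f)
    have hs : Continuous fun q : ActPair (Stalk (TransObj Γ X) n) =>
        toEt (Cochain.translate p.hom.1 n f) q.y :=
      (continuous_toEt _).comp (continuous_arr_tgt.comp (continuous_fst.comp hp))
    refine hs.continuousAt.congr (Filter.eventually_of_mem
      ((hO.preimage hp).mem_nhds ⟨rfl, ⟨_, hf⟩⟩) ?_)
    rintro q ⟨h1, h2⟩
    have h1 : q.hom.1 = p.hom.1 := h1
    have h2 : q.germ = germ f q.x := germ_eq_of_mem_range h2
    change toEt (Cochain.translate p.hom.1 n f) q.y = ⟨q.y, stalkAct Γ X n q.hom q.germ⟩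
    rw [h2, ← h1]
    rfl

theorem isCSoft_alexanderSpanier (n : ℕ) : (alexanderSpanier Γ X n).IsCSoft :=
  fun _ _ hK hU hKU s hs => exists_section_eqOn_nhds (X := TransObj Γ X) hK hU hKU s hs

/-- The inclusion of locally constant functions into the functions of one variable. -/
def constHom : GSheaf.Hom (GSheaf.constInt (transformationGroupoid Γ X))
    (alexanderSpanier Γ X 0) where
  app x := (QuotientAddGroup.mk' _).comp const
  continuous_app := continuous_toEt_const (X := TransObj Γ X)
  app_act _ _ := rfl

/-- The Alexander–Spanier differential as a morphism of equivariant sheaves. -/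
def coboundaryHom (n : ℕ) :
    GSheaf.Hom (alexanderSpanier Γ X n) (alexanderSpanier Γ X (n + 1)) where
  app := stalkMap (d n) d_mem_vanishing
  continuous_app := continuous_stalkMap (d n) d_mem_vanishing
  app_act {x y} f a := by
    obtain ⟨g, rfl⟩ := QuotientAddGroup.mk_surjective a
    exact congrArg (germ · y) (d_translate f.1 n g)

/-- The resolution of the sheaf of locally constant integer valued functions by Alexander–Spanier
cochains. -/
def alexanderSpanierResolution :
    SoftResolution.{u, v, u, 0} (GSheaf.constInt (transformationGroupoid Γ X)) where
  S := alexanderSpanier Γ X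
  ε := constHom Γ X
  d := coboundaryHom Γ X
  isCSoft := isCSoft_alexanderSpanier Γ X
  injective x := by
    refine (injective_iff_map_eq_zero ((constHom Γ X).app x)).2 fun _ hc => ?_
    obtain ⟨_, hU, h⟩ := (QuotientAddGroup.eq_zero_iff _).1 hc
    exact h x (mem_of_mem_nhds hU)
  exact_zero x a := by
    constructor
    · obtain ⟨f, rfl⟩ := QuotientAddGroup.mk_surjective a
      intro hf
      obtain ⟨U, hU, h⟩ := (QuotientAddGroup.eq_zero_iff _).1 hf
      -- With the first variable of `d 0 f` frozen at `x`, its vanishing says that `f` equals the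
      -- constant `f x` near `x`.
      exact ⟨f x, germ_eq_iff.2 ⟨U, hU, h x (mem_of_mem_nhds hU)⟩⟩
    · rintro ⟨c, rfl⟩
      exact congrArg (germ · x) (d_const c)
  exact_succ q x a := by
    constructor
    · obtain ⟨f, rfl⟩ := QuotientAddGroup.mk_surjective a
      intro hf
      obtain ⟨U, hU, h⟩ := (QuotientAddGroup.eq_zero_iff _).1 hf
      -- The same freezing at `x` shows that `f - d (f x)` vanishes near `x`, so `f x` is a
      -- primitive.
      exact ⟨germ (f x) x, germ_eq_iff.2 ⟨U, hU, h x (mem_of_mem_nhds hU)⟩⟩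
    · rintro ⟨b, rfl⟩
      obtain ⟨g, rfl⟩ := QuotientAddGroup.mk_surjective b
      exact congrArg (germ · x) (d_d q g)

end AlexanderSpanier

/-! ## Sections supported on a sheet -/

namespace GSheaf

variable {𝒢 : EtaleGroupoid.{u, v}} {Y Z : Type*} [TopologicalSpace Y] [TopologicalSpace Z]

theorem comp_mem_Gamma (S : GSheaf.{u, v, w} 𝒢) {τ : C(Z, 𝒢.Obj)} {t : ∀ z, S.Stalk (τ z)}
    (ht : t ∈ S.Gamma τ) {f : Y → Z} (hf : Continuous f) :
    (fun y => t (f y)) ∈ S.Gamma (τ.comp ⟨f, hf⟩) :=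
  Continuous.comp (g := fun z => EtSpace.mk (τ z) (t z)) ht hf

theorem ite_mem_Gamma (S : GSheaf.{u, v, w} 𝒢) {τ : C(Y, 𝒢.Obj)} {P : Y → Prop}
    [DecidablePred P] (hP : IsClopen {y | P y}) {t : ∀ y, S.Stalk (τ y)} (ht : t ∈ S.Gamma τ) :
    (fun y => if P y then t y else 0) ∈ S.Gamma τ := by
  refine continuous_iff_continuousAt.2 fun y => ?_
  by_cases hy : P y
  · refine (continuous_iff_continuousAt.1 ht y).congr
      (Filter.eventually_of_mem (hP.isOpen.mem_nhds hy) fun y' hy' => ?_)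
    exact congrArg (EtSpace.mk (τ y')) (if_pos hy').symm
  · refine (continuous_iff_continuousAt.1 (zero_mem (S.Gamma τ)) y).congr
      (Filter.eventually_of_mem (hP.compl.isOpen.mem_nhds hy) fun y' hy' => ?_)
    exact congrArg (EtSpace.mk (τ y')) (if_neg hy').symm

/-- Fibrewise summation of a section supported on the image of `f`, for `d ∘ f` injective. -/
theorem pushGammaC_eq [T2Space Y] [T2Space Z] (S : GSheaf.{u, v, w} 𝒢) {W : Type*} {d : Y → Z}
    (hd : IsLocalHomeomorph d) (τ : C(Z, 𝒢.Obj)) (f : W → Y)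
    (t : S.GammaC (τ.comp ⟨d, hd.continuous⟩)) (r : S.GammaC τ)
    (hinj : Function.Injective (d ∘ f)) (ht : ∀ y ∉ Set.range f, t.1 y = 0)
    (hr : ∀ x, r.1 (d (f x)) = t.1 (f x)) (hr0 : ∀ z ∉ Set.range (d ∘ f), r.1 z = 0) :
    S.pushGammaC d hd τ t = r := by
  refine Subtype.ext (funext fun z => ?_)
  change S.fibreSum d τ t.1 z = r.1 z
  by_cases hz : z ∈ Set.range (d ∘ f)
  · obtain ⟨x, rfl⟩ := hz
    -- By injectivity of `d ∘ f` the fibre meets the range of `f` in one point only, and all other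
    -- summands vanish.
    refine (finsum_eq_single _ (⟨f x, rfl⟩ : {y // d y = d (f x)}) ?_).trans (hr x).symm
    rintro ⟨y, hy⟩ hne
    have h0 : t.1 y = 0 := ht y fun ⟨x', hx'⟩ => hne (Subtype.ext (by
      subst hx'
      exact congrArg f (hinj hy)))
    have hcast : ∀ (z : Z) (hy : d y = z),
        (congrArg (fun z => S.Stalk (τ z)) hy).mp (t.1 y) = 0 := by
      rintro _ rfl
      exact h0
    exact hcast _ hy
  · rw [hr0 z hz]
    refine finsum_eq_zero_of_forall_eq_zero ?_
    rintro ⟨y, rfl⟩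
    exact ht y fun ⟨x, hx⟩ => hz ⟨x, congrArg d hx⟩

end GSheaf

/-! ## Strings in a transformation groupoid -/

section Strings

variable {Γ : Type v} [Group Γ] {X : Type u} [TopologicalSpace X] [MulAction Γ X] [T2Space X]
  [LocallyCompactSpace X] [ContinuousConstSMul Γ X] {p : ℕ}

/-- The group elements that label the arrows `g₁, …, gₚ` of a string. -/
def labels (F : Str (transformationGroupoid Γ X) p) (i : Fin p) : Γ :=
  (F.arrow i.castSucc_le_succ).1

theorem arrow_label_mul (F : Str (transformationGroupoid Γ X) p) {i j k : Fin (p + 1)}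
    (h : i ≤ j) (h' : j ≤ k) :
    (F.arrow h).1 * (F.arrow h').1 = (F.arrow (h.trans h')).1 :=
  congrArg Subtype.val (F.arrow_comp h h')

theorem arrow_self_label (F : Str (transformationGroupoid Γ X) p) {i j : Fin (p + 1)}
    (h : i ≤ j) (hij : i = j) : (F.arrow h).1 = 1 := by
  subst hij
  exact congrArg Subtype.val (F.arrow_self i)

theorem arrow_label_eq (F : Str (transformationGroupoid Γ X) p) (j : Fin (p + 1)) :
    (F.arrow (Fin.zero_le j)).1 = Fin.partialProd (labels F) j := by
  induction j using Fin.induction with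
  | zero => rw [Fin.partialProd_zero, arrow_self_label F _ rfl]
  | succ j ih =>
    rw [Fin.partialProd_succ, ← ih, ← arrow_label_mul F (Fin.zero_le j.castSucc)
      j.castSucc_le_succ]
    rfl

/-- The arrow from xᵢ to x₀ has the partial product of the labels as its group element, and this
together with x₀ determines xᵢ. -/
theorem str_ext {F F' : Str (transformationGroupoid Γ X) p} (h : F.vertex 0 = F'.vertex 0)
    (hl : labels F = labels F') : F = F' := by
  refine Str.ext_of_between 0 fun i => ?_
  rw [← Str.arrow_eq_between F (Fin.zero_le i), ← Str.arrow_eq_between F' (Fin.zero_le i)]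
  have h1 : (F.arrow (Fin.zero_le i)).1 = (F'.arrow (Fin.zero_le i)).1 := by
    rw [arrow_label_eq, arrow_label_eq, hl]
  refine (arrEquiv Γ X).injective (Prod.ext h1 ?_)
  have h2 := (F.arrow (Fin.zero_le i)).2
  have h3 := (F'.arrow (Fin.zero_le i)).2
  rw [← h1, ← h] at h3
  exact smul_left_cancel _ (h2.trans h3.symm)

/-- The string `x ← ⋯` with given first vertex and labels. -/
def strOf (g : Fin p → Γ) (x : TransObj Γ X) : Str (transformationGroupoid Γ X) p :=
  Str.ofStar (c := x)
    (x := Fin.cases x fun j => (Fin.partialProd g j.succ)⁻¹ • x)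
    (Fin.cases (𝟙 x) fun j => arrowTo (Fin.partialProd g j.succ) x)

theorem strOf_arrow_label (g : Fin p → Γ) (x : TransObj Γ X) (j : Fin (p + 1)) :
    ((strOf g x).arrow (Fin.zero_le j)).1 = Fin.partialProd g j := by
  induction j using Fin.cases with
  | zero => rw [arrow_self_label _ _ rfl, Fin.partialProd_zero]
  | succ j =>
    change ((arrowTo (Fin.partialProd g j.succ) x) ≫ inv (𝟙 x)).1 = _
    rw [IsIso.inv_id, Category.comp_id]
    rfl

theorem labels_strOf (g : Fin p → Γ) (x : TransObj Γ X) : labels (strOf g x) = g := by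
  funext i
  have h := arrow_label_mul (strOf g x) (Fin.zero_le i.castSucc) i.castSucc_le_succ
  rw [strOf_arrow_label, strOf_arrow_label, Fin.partialProd_succ] at h
  exact mul_left_cancel h

theorem strOf_labels (F : Str (transformationGroupoid Γ X) p) :
    strOf (labels F) (F.vertex 0) = F :=
  str_ext rfl (labels_strOf _ _)

theorem exists_eq_strOf (F : Str (transformationGroupoid Γ X) p) : ∃ g x, F = strOf g x :=
  ⟨_, _, (strOf_labels F).symm⟩

theorem continuous_strOf (g : Fin p → Γ) : Continuous (strOf (X := X) g) := by
  have hv : ∀ i, Continuous fun x : TransObj Γ X => (strOf g x).vertex i :=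
    Fin.cases continuous_id fun _ => continuous_const_smul _
  refine Str.continuous_iff.2 ⟨hv, fun i => continuous_arr_iff.2 ⟨fun γ => ?_, hv i.succ⟩⟩
  have : {x : TransObj Γ X | labels (strOf g x) i = γ} = {_x | g i = γ} := by
    simp only [labels_strOf]
  change IsOpen {x : TransObj Γ X | labels (strOf g x) i = γ}
  rw [this]
  exact isOpen_const

theorem isOpen_labels_eq (g : Fin p → Γ) :
    IsOpen {F : Str (transformationGroupoid Γ X) p | labels F = g} := by
  have : {F : Str (transformationGroupoid Γ X) p | labels F = g} =
      ⋂ i, {F | labels F i = g i} := by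
    ext F
    simp only [Set.mem_ofPred_eq, Set.mem_iInter]
    exact funext_iff
  rw [this]
  refine isOpen_iInter_of_finite fun i => ?_
  exact (continuous_arr_iff (Γ := Γ) (X := X)
    (f := fun F : Str (transformationGroupoid Γ X) p => Arr.mk (F.arrow i.castSucc_le_succ))).1
      (Str.continuous_arrow i.castSucc_le_succ) |>.1 (g i)

/-- The complement is the union of the other sheets, each of which is open. -/
theorem isClopen_labels_eq (g : Fin p → Γ) :
    IsClopen {F : Str (transformationGroupoid Γ X) p | labels F = g} := by
  refine ⟨isOpen_compl_iff.1 ?_, isOpen_labels_eq g⟩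
  have : {F : Str (transformationGroupoid Γ X) p | labels F = g}ᶜ =
      ⋃ g' ∈ ({g}ᶜ : Set (Fin p → Γ)), {F | labels F = g'} := by
    ext F
    simp
  rw [this]
  exact isOpen_biUnion fun g' _ => isOpen_labels_eq g'

/-- The sheets form an open cover of the compact set `K`. -/
theorem finite_image_labels {K : Set (Str (transformationGroupoid Γ X) p)} (hK : IsCompact K) :
    (labels '' K).Finite := by
  obtain ⟨A, hA⟩ := hK.elim_finite_subcover (fun g : Fin p → Γ => {F | labels F = g})
    isOpen_labels_eq fun F _ => Set.mem_iUnion.2 ⟨labels F, rfl⟩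
  refine A.finite_toSet.subset ?_
  rintro _ ⟨F, hF, rfl⟩
  obtain ⟨g, hg, hFg⟩ := Set.mem_iUnion₂.1 (hA hF)
  exact (show labels F = g from hFg) ▸ hg

theorem arrow_label (F : Str (transformationGroupoid Γ X) p) {i j : Fin (p + 1)} (h : i ≤ j) :
    (F.arrow h).1 = (Fin.partialProd (labels F) i)⁻¹ * Fin.partialProd (labels F) j := by
  rw [← arrow_label_eq, ← arrow_label_eq, ← arrow_label_mul F (Fin.zero_le i) h,
    inv_mul_cancel_left]

theorem labels_face_zero (F : Str (transformationGroupoid Γ X) (p + 1)) :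
    labels (F.face 0) = fun i => labels F i.succ := rfl

/-- Labels are quotients of consecutive partial products, and deleting a vertex deletes one partial
product. `Fin.contractNth` covers both the merging of two labels and, at the last vertex, the loss
of the last label. -/
theorem labels_face_succ (j : Fin (p + 1)) (F : Str (transformationGroupoid Γ X) (p + 1)) :
    labels (F.face j.succ) = Fin.contractNth j (· * ·) (labels F) := by
  funext k
  rw [← Fin.inv_partialProd_mul_eq_contractNth, ← Fin.succ_succAbove_succ]
  exact arrow_label F ((Fin.succAboveOrderEmb j.succ).monotone k.castSucc_le_succ)

/-! ## Sections over strings with given labels -/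

open Classical in
/-- The section that is equal to `m` (at the first vertex) on the strings with labels `g`, and
vanishes on all other strings. -/
def sheet (S : GSheaf.{u, v, w} (transformationGroupoid Γ X)) (g : Fin p → Γ) :
    S.GammaC (ContinuousMap.id (TransObj Γ X)) →+
      S.GammaC (tau (𝒢 := transformationGroupoid Γ X) p) where
  toFun m := ⟨fun F => if labels F = g then m.1 (F.vertex 0) else 0,
    S.ite_mem_Gamma (isClopen_labels_eq g)
      (S.comp_mem_Gamma m.2.1 (Str.continuous_vertex 0)), by
    obtain ⟨K, hK, h0⟩ := m.2.2
    refine ⟨strOf g '' K, hK.image (continuous_strOf g), fun F hF => ?_⟩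
    by_cases h : labels F = g
    · refine (if_pos h).trans (h0 _ fun hK => hF ⟨_, hK, ?_⟩)
      rw [← h]
      exact strOf_labels F
    · exact if_neg h⟩
  map_zero' := Subtype.ext (funext fun F => ite_self _)
  map_add' _ _ := Subtype.ext (funext fun _ => ite_add_zero)

section Sheet

variable (S : GSheaf.{u, v, w} (transformationGroupoid Γ X))

theorem sheet_apply_of_eq {g : Fin p → Γ} (m : S.GammaC (ContinuousMap.id (TransObj Γ X)))
    {F : Str (transformationGroupoid Γ X) p} (h : labels F = g) :
    (sheet S g m).1 F = m.1 (F.vertex 0) := if_pos h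

theorem sheet_apply_of_ne {g : Fin p → Γ} (m : S.GammaC (ContinuousMap.id (TransObj Γ X)))
    {F : Str (transformationGroupoid Γ X) p} (h : labels F ≠ g) :
    (sheet S g m).1 F = 0 := if_neg h

/-- The restriction of a section over `𝒢⁽ᵖ⁾` to the strings with labels `g`. -/
def restrictSheet (g : Fin p → Γ) : S.GammaC (tau (𝒢 := transformationGroupoid Γ X) p) →+
    S.GammaC (ContinuousMap.id (TransObj Γ X)) where
  toFun t := ⟨fun x => t.1 (strOf g x),
    S.comp_mem_Gamma t.2.1 (continuous_strOf g), by
    obtain ⟨K, hK, h0⟩ := t.2.2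
    exact ⟨Str.vertex 0 '' K, hK.image (Str.continuous_vertex 0),
      fun x hx => h0 _ fun h => hx ⟨_, h, rfl⟩⟩⟩
  map_zero' := rfl
  map_add' _ _ := rfl

theorem finite_restrictSheet (t : S.GammaC (tau (𝒢 := transformationGroupoid Γ X) p)) :
    (Function.support fun g => restrictSheet S g t).Finite := by
  obtain ⟨K, hK, h0⟩ := t.2.2
  refine (finite_image_labels hK).subset fun g hg => by_contra fun h => hg ?_
  exact Subtype.ext (funext fun x => h0 _ fun hx => h ⟨_, hx, labels_strOf g x⟩)

/-- The section over `𝒢⁽ᵖ⁾` with given restrictions to the sheets. -/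
def ofChain : ((Fin p → Γ) →₀ S.GammaC (ContinuousMap.id (TransObj Γ X))) →+
    S.GammaC (tau (𝒢 := transformationGroupoid Γ X) p) :=
  Finsupp.liftAddHom (sheet S)

theorem ofChain_single (g : Fin p → Γ) (m : S.GammaC (ContinuousMap.id (TransObj Γ X))) :
    ofChain S (Finsupp.single g m) = sheet S g m :=
  Finsupp.liftAddHom_apply_single _ _ _

theorem ofChain_apply (c : (Fin p → Γ) →₀ S.GammaC (ContinuousMap.id (TransObj Γ X)))
    (F : Str (transformationGroupoid Γ X) p) :
    (ofChain S c).1 F = (c (labels F)).1 (F.vertex 0) := by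
  induction c using Finsupp.induction_linear with
  | zero => rw [map_zero]; rfl
  | add c c' h h' =>
    rw [map_add]
    exact congrArg₂ (· + ·) h h'
  | single g m =>
    rw [ofChain_single]
    by_cases h : labels F = g
    · rw [h, Finsupp.single_eq_same, sheet_apply_of_eq S m h]
    · rw [Finsupp.single_eq_of_ne h, sheet_apply_of_ne S m h]
      rfl

/-- Sections over `𝒢⁽ᵖ⁾` are finite sums of sections over the base, one for each `g ∈ Γᵖ`. -/
def chainEquiv (p : ℕ) : ((Fin p → Γ) →₀ S.GammaC (ContinuousMap.id (TransObj Γ X))) ≃+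
    S.GammaC (tau (𝒢 := transformationGroupoid Γ X) p) :=
  { ofChain S with
    invFun := fun t => Finsupp.ofSupportFinite (fun g => restrictSheet S g t)
      (finite_restrictSheet S t)
    left_inv := fun c => Finsupp.ext fun g => Subtype.ext (funext fun x => by
      refine (ofChain_apply S c (strOf g x)).trans ?_
      rw [labels_strOf]
      rfl)
    right_inv := fun t => Subtype.ext (funext fun F => by
      refine (ofChain_apply S _ F).trans ?_
      obtain ⟨g, x, rfl⟩ := exists_eq_strOf F
      rw [labels_strOf]
      rfl) }

theorem chainEquiv_single (g : Fin p → Γ) (m : S.GammaC (ContinuousMap.id (TransObj Γ X))) :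
    chainEquiv S p (Finsupp.single g m) = sheet S g m :=
  ofChain_single S g m

variable {S}

theorem mapGammaC_sheet {T : GSheaf.{u, v, w'} (transformationGroupoid Γ X)} (φ : GSheaf.Hom S T)
    (g : Fin p → Γ) (m : S.GammaC (ContinuousMap.id (TransObj Γ X))) :
    φ.mapGammaC _ (sheet S g m) = sheet T g (φ.mapGammaC _ m) := by
  refine Subtype.ext (funext fun F => ?_)
  by_cases h : labels F = g
  · exact (congrArg (φ.app _) (sheet_apply_of_eq S m h)).trans
      (sheet_apply_of_eq T (φ.mapGammaC _ m) h).symm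
  · exact (congrArg (φ.app _) (sheet_apply_of_ne S m h)).trans
      ((map_zero _).trans (sheet_apply_of_ne T (φ.mapGammaC _ m) h).symm)

variable (S)

theorem toStrZero_eq_sheet (g : Fin 0 → Γ) (m : S.GammaC (ContinuousMap.id (TransObj Γ X))) :
    toStrZero S m = sheet S g m :=
  Subtype.ext (funext fun _ => (sheet_apply_of_eq S m (Subsingleton.elim _ _)).symm)

theorem labels_strOne (γ : Γ) (x : TransObj Γ X) : labels (strOne γ x) = fun _ => γ := by
  funext i
  obtain rfl : i = 0 := Fin.fin_one_eq_zero i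
  exact congrArg Subtype.val (strOne_arrow γ x)

theorem toStrOne_eq_sheet (γ : Γ) (m : S.GammaC (ContinuousMap.id (TransObj Γ X))) :
    toStrOne S γ m = sheet S (fun _ : Fin 1 => γ) m := by
  refine S.pushGammaC_eq (isLocalHomeomorph_strOne γ) (tau 1) id m _
    (fun x x' h => congrArg (Str.vertex 0) h) (fun x hx => absurd ⟨x, rfl⟩ hx)
    (fun x => sheet_apply_of_eq S m (labels_strOne γ x))
    (fun F hF => sheet_apply_of_ne S m fun h => hF ⟨F.vertex 0, ?_⟩)
  exact str_ext rfl ((labels_strOne γ _).trans h.symm)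

theorem act_label {x y : TransObj Γ X} (f : x ⟶ y) {γ : Γ} (hγ : f.1 = γ)
    (m : S.GammaC (ContinuousMap.id (TransObj Γ X))) :
    S.act (inv f) (m.1 y) = (translate S γ⁻¹ m).1 x := by
  subst hγ
  rw [translate_apply]
  refine act_congr S m.1 (inv f) (arrowTo f.1⁻¹ x) ?_ ?_
  · rw [inv_inv, f.2]
  · rw [← Groupoid.inv_eq_inv]; rfl

/-- The face of a string on the sheet `g` has first vertex γ⁻¹ x₀. So the face map sends this sheet
bijectively onto the sheet `g'`: each fibre sum has one term, and only the transport of the germ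
remains. -/
theorem faceSum_sheet (i : Fin (p + 2)) {g : Fin (p + 1) → Γ} {g' : Fin p → Γ} {γ : Γ}
    (hg : ∀ F : Str (transformationGroupoid Γ X) (p + 1), labels F = g → labels (F.face i) = g')
    (hγ : ∀ F : Str (transformationGroupoid Γ X) (p + 1), labels F = g →
      (F.arrow (Fin.zero_le (i.succAbove 0))).1 = γ)
    (m : S.GammaC (ContinuousMap.id (TransObj Γ X))) :
    faceSum S p i (sheet S g m) = sheet S g' (translate S γ⁻¹ m) := by
  have hv : ∀ x, γ • (strOf g x).vertex (i.succAbove 0) = x := fun x => by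
    rw [← hγ _ (labels_strOf g x)]
    exact ((strOf g x).arrow (Fin.zero_le (i.succAbove 0))).2
  refine S.pushGammaC_eq (Str.isLocalHomeomorph_face i) (tau p) (strOf g) _ _ ?_ ?_ ?_ ?_
  · intro x x' h
    rw [← hv x, ← hv x']
    exact congrArg (γ • ·) (congrArg (Str.vertex 0) h)
  · intro F hF
    refine (congrArg (S.act _) (sheet_apply_of_ne S m fun h => hF ⟨F.vertex 0, ?_⟩)).trans
      (map_zero _)
    rw [← h]
    exact strOf_labels F
  · intro x
    refine (sheet_apply_of_eq S _ (hg _ (labels_strOf g x))).trans ?_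
    refine (act_label S _ (hγ _ (labels_strOf g x)) m).symm.trans ?_
    exact congrArg (S.act _) (sheet_apply_of_eq S m (labels_strOf g x)).symm
  · intro F hF
    refine sheet_apply_of_ne S _ fun h => hF ⟨γ • F.vertex 0, ?_⟩
    refine str_ext ?_ ((hg _ (labels_strOf g _)).trans h.symm)
    exact smul_left_cancel γ (hv (γ • F.vertex 0))

theorem faceSum_zero_sheet (g : Fin (p + 1) → Γ)
    (m : S.GammaC (ContinuousMap.id (TransObj Γ X))) :
    faceSum S p 0 (sheet S g m) = sheet S (fun i => g i.succ) (translate S (g 0)⁻¹ m) :=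
  faceSum_sheet S 0 (fun F h => by rw [labels_face_zero, h]) (fun F h => congrFun h 0) m

/-- The vertex x₀ survives, so the germ is not transported. -/
theorem faceSum_succ_sheet (j : Fin (p + 1)) (g : Fin (p + 1) → Γ)
    (m : S.GammaC (ContinuousMap.id (TransObj Γ X))) :
    faceSum S p j.succ (sheet S g m) = sheet S (Fin.contractNth j (· * ·) g) m := by
  rw [faceSum_sheet S j.succ (g' := Fin.contractNth j (· * ·) g) (γ := 1)
    (fun F h => by rw [labels_face_succ, h])
    (fun F h => arrow_self_label F _ (Fin.succ_succAbove_zero j).symm) m, inv_one, translate_one]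

/-- This identifies δ with the bar differential of group homology, with coefficients in the
compactly supported sections over the base. -/
theorem bar_sheet (g : Fin (p + 1) → Γ) (m : S.GammaC (ContinuousMap.id (TransObj Γ X))) :
    bar S p (sheet S g m) = sheet S (fun i => g i.succ) (translate S (g 0)⁻¹ m) +
      ∑ j : Fin (p + 1), (-1 : ℤ) ^ ((j : ℕ) + 1) • sheet S (Fin.contractNth j (· * ·) g) m := by
  rw [bar, AddMonoidHom.finsetSum_apply, Fin.sum_univ_succ]
  refine congrArg₂ (· + ·) ?_ (Finset.sum_congr rfl fun j _ => ?_)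
  · rw [Fin.val_zero, pow_zero, one_smul, faceSum_zero_sheet]
  · rw [← faceSum_succ_sheet, Fin.val_succ]; rfl

end Sheet

end Strings

/-! ## Sums over intervals of integers -/

section IntSum

variable {A B : Type*} [AddCommGroup A] [AddCommGroup B]

/-- The sum `∑_{0 ≤ j < k} f j`, with the convention `-∑_{k ≤ j < 0} f j` for `k < 0`. -/
def intSum (f : ℤ → A) : ℤ → A
  | Int.ofNat n => ∑ i ∈ Finset.range n, f i
  | Int.negSucc n => -∑ i ∈ Finset.range (n + 1), f (-(i + 1))

theorem intSum_zero (f : ℤ → A) : intSum f 0 = 0 := Finset.sum_range_zero _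

theorem intSum_succ (f : ℤ → A) (k : ℤ) : intSum f (k + 1) = intSum f k + f k := by
  obtain n | n := k
  · exact Finset.sum_range_succ (fun i : ℕ => f i) n
  · obtain _ | n := n
    · change ∑ i ∈ Finset.range 0, f i = -∑ i ∈ Finset.range 1, f (-(i + 1)) + f (-1)
      simp
    · change -∑ i ∈ Finset.range (n + 1), f (-(i + 1)) =
        -∑ i ∈ Finset.range (n + 1 + 1), f (-(i + 1)) + f (Int.negSucc (n + 1))
      rw [Finset.sum_range_succ _ (n + 1)]
      have : Int.negSucc (n + 1) = -(((n + 1 : ℕ) : ℤ) + 1) := by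
        rw [Int.negSucc_eq]
      rw [this]
      abel

/-- Telescoping. Identities for `intSum` are later proved by supplying an antidifference `F` and
checking one increment, which handles both signs of `k` at once. -/
theorem intSum_eq_sub {f F : ℤ → A} (h : ∀ k, F (k + 1) = F k + f k) (k : ℤ) :
    intSum f k = F k - F 0 := by
  induction k using Int.induction_on with
  | zero => rw [intSum_zero, sub_self]
  | succ k ih => rw [intSum_succ, ih, h]; abel
  | pred k ih =>
    have h1 := intSum_succ f (-k - 1)
    have h2 := h (-k - 1)
    rw [sub_add_cancel] at h1 h2
    rw [← add_right_cancel_iff (a := f (-k - 1)), ← h1, ih, h2]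
    abel

theorem intSum_one (f : ℤ → A) : intSum f 1 = f 0 := by
  rw [← zero_add (1 : ℤ), intSum_succ, intSum_zero, zero_add]

theorem intSum_add_sub (f : ℤ → A) (c k : ℤ) :
    intSum f (c + k) - intSum f c = intSum (fun j => f (c + j)) k := by
  rw [intSum_eq_sub (f := fun j => f (c + j)) (F := fun k => intSum f (c + k)), add_zero]
  intro k
  rw [← add_assoc, intSum_succ]

theorem map_intSum (φ : A →+ B) (f : ℤ → A) (k : ℤ) :
    φ (intSum f k) = intSum (fun j => φ (f j)) k := by
  rw [intSum_eq_sub (F := fun k => φ (intSum f k)), intSum_zero, map_zero, sub_zero]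
  intro k
  rw [intSum_succ, map_add]

end IntSum

/-! ## The bar complex -/

/-- The degree `p` part of the (unnormalised) bar complex of `Γ` with coefficients in `M`. -/
abbrev BarChain (Γ : Type*) (M : Type*) [AddCommGroup M] (p : ℕ) : Type _ := (Fin p → Γ) →₀ M

namespace BarChain

variable {Γ : Type*} {M : Type*} [AddCommGroup M] {p : ℕ}

/-- Appending a group element. -/
def append (u : Γ) : BarChain Γ M p →+ BarChain Γ M (p + 1) :=
  Finsupp.mapDomain.addMonoidHom fun g => Fin.snoc (α := fun _ => Γ) g u

theorem append_single (u : Γ) (g : Fin p → Γ) (m : M) :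
    append u (Finsupp.single g m) = Finsupp.single (Fin.snoc (α := fun _ => Γ) g u) m :=
  Finsupp.mapDomain_single

/-- Deleting the last group element. -/
def deleteLast : BarChain Γ M (p + 1) →+ BarChain Γ M p :=
  Finsupp.mapDomain.addMonoidHom fun g => Fin.init (α := fun _ => Γ) g

theorem deleteLast_single (g : Fin (p + 1) → Γ) (m : M) :
    deleteLast (Finsupp.single g m) = Finsupp.single (Fin.init (α := fun _ => Γ) g) m :=
  Finsupp.mapDomain_single

theorem deleteLast_append (u : Γ) (x : BarChain Γ M p) : deleteLast (append u x) = x := by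
  induction x using Finsupp.induction_linear with
  | zero => simp
  | add x y hx hy => simp [hx, hy]
  | single g m => rw [append_single, deleteLast_single, Fin.init_snoc]

theorem hom_zsmul {q : ℕ} (φ : BarChain Γ M p →+ BarChain Γ M q) (k : ℤ) (x : BarChain Γ M p) :
    φ (k • x) = k • φ x := map_zsmul φ k x

@[elab_as_elim]
-- The homotopy acts on the last label, so chains are treated in the form [x | u].
theorem append_induction {P : BarChain Γ M (p + 1) → Prop} (x : BarChain Γ M (p + 1))
    (zero : P 0) (add : ∀ x y, P x → P y → P (x + y)) (append : ∀ u x, P (append u x)) : P x := by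
  induction x using Finsupp.induction_linear with
  | zero => exact zero
  | add x y hx hy => exact add x y hx hy
  | single g m =>
    have := append (g (Fin.last p)) (Finsupp.single (Fin.init (α := fun _ => Γ) g) m)
    rwa [append_single, Fin.snoc_init_self] at this

theorem mapRange_append {M' : Type*} [AddCommGroup M'] (φ : M →+ M') (u : Γ)
    (x : BarChain Γ M p) :
    Finsupp.mapRange.addMonoidHom φ (append u x) =
      append u (Finsupp.mapRange.addMonoidHom φ x) := by
  induction x using Finsupp.induction_linear with
  | zero => simp
  | add x y hx hy => simp only [map_add, hx, hy]
  | single g m =>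
    rw [append_single, Finsupp.mapRange.addMonoidHom_apply, Finsupp.mapRange.addMonoidHom_apply,
      Finsupp.mapRange_single, Finsupp.mapRange_single, append_single]

variable [Group Γ] (ρ : Γ → M →+ M)

/-- The bar differential. -/
def diff (p : ℕ) : BarChain Γ M (p + 1) →+ BarChain Γ M p :=
  Finsupp.liftAddHom fun g =>
    (Finsupp.singleAddHom fun i => g i.succ : M →+ BarChain Γ M p).comp (ρ (g 0)⁻¹) +
      ∑ j : Fin (p + 1), (-1 : ℤ) ^ ((j : ℕ) + 1) •
        (Finsupp.singleAddHom (Fin.contractNth j (· * ·) g) : M →+ BarChain Γ M p)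

theorem diff_single (g : Fin (p + 1) → Γ) (m : M) : diff ρ p (Finsupp.single g m) =
    Finsupp.single (fun i => g i.succ) (ρ (g 0)⁻¹ m) + ∑ j : Fin (p + 1),
      (-1 : ℤ) ^ ((j : ℕ) + 1) • Finsupp.single (Fin.contractNth j (· * ·) g) m := by
  rw [diff, Finsupp.liftAddHom_apply_single, AddMonoidHom.add_apply,
    AddMonoidHom.finsetSum_apply]
  rfl

/-- Multiplying the last group element by `u` from the right. -/
def mulLast (u : Γ) : BarChain Γ M (p + 1) →+ BarChain Γ M (p + 1) :=
  Finsupp.mapDomain.addMonoidHom fun g =>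
    Fin.snoc (α := fun _ => Γ) (Fin.init (α := fun _ => Γ) g) (g (Fin.last p) * u)

theorem mulLast_append (u v : Γ) (x : BarChain Γ M p) :
    mulLast u (append v x) = append (v * u) x := by
  induction x using Finsupp.induction_linear with
  | zero => simp
  | add x y hx hy => simp only [map_add, hx, hy]
  | single g m =>
    rw [append_single, append_single]
    refine Finsupp.mapDomain_single.trans ?_
    rw [Fin.init_snoc, Fin.snoc_last]

theorem contractNth_last (g : Fin (p + 1) → Γ) :
    Fin.contractNth (Fin.last p) (· * ·) g = Fin.init (α := fun _ => Γ) g :=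
  funext fun k => Fin.contractNth_apply_of_lt _ _ _ _ k.isLt

theorem contractNth_castSucc_snoc (j : Fin p) (g : Fin (p + 1) → Γ) (u : Γ) :
    Fin.contractNth j.castSucc.castSucc (· * ·) (Fin.snoc (α := fun _ => Γ) g u) =
      Fin.snoc (α := fun _ => Γ) (Fin.contractNth j.castSucc (· * ·) g) u := by
  funext k
  induction k using Fin.lastCases with
  | last =>
    rw [Fin.snoc_last, Fin.contractNth_apply_of_gt _ _ _ _ (by simp), Fin.succ_last,
      Fin.snoc_last]
  | cast k =>
    rw [Fin.snoc_castSucc]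
    simp only [Fin.contractNth, Fin.val_castSucc, ← Fin.castSucc_succ, Fin.snoc_castSucc]

theorem contractNth_castSucc_last_snoc (g : Fin (p + 1) → Γ) (u : Γ) :
    Fin.contractNth (Fin.last p).castSucc (· * ·) (Fin.snoc (α := fun _ => Γ) g u) =
      Fin.snoc (α := fun _ => Γ) (Fin.init (α := fun _ => Γ) g) (g (Fin.last p) * u) := by
  funext k
  induction k using Fin.lastCases with
  | last =>
    rw [Fin.snoc_last, Fin.contractNth_apply_of_eq _ _ _ _ (by simp), Fin.succ_last,
      Fin.snoc_last, Fin.snoc_castSucc]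
  | cast k =>
    rw [Fin.snoc_castSucc, Fin.contractNth_apply_of_lt _ _ _ _ (by simp), Fin.snoc_castSucc]
    rfl

theorem diff_append_zero (u : Γ) (x : BarChain Γ M 0) :
    diff ρ 0 (append u x) = Finsupp.mapRange.addMonoidHom (ρ u⁻¹) x - x := by
  induction x using Finsupp.induction_linear with
  | zero => simp
  | add x y hx hy => simp only [map_add, hx, hy]; abel
  | single g m =>
    rw [append_single, diff_single, Fin.sum_univ_one, Finsupp.mapRange.addMonoidHom_apply,
      Finsupp.mapRange_single, sub_eq_add_neg]
    refine congrArg₂ (· + ·) ?_ ?_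
    · exact congrArg (Finsupp.single · _) (Subsingleton.elim _ _)
    · refine (neg_one_zsmul _).trans (congrArg (- ·) ?_)
      exact congrArg (Finsupp.single · _) (Subsingleton.elim _ _)

/-- The faces of [x | u] are those of `x` with `u` appended, except that the last face of `x` is
replaced by two: the one that multiplies `u` into the last label, and the one that drops `u`. The
term with `deleteLast` removes the superfluous last face. -/
theorem diff_append_succ (u : Γ) (x : BarChain Γ M (p + 1)) :
    diff ρ (p + 1) (append u x) = append u (diff ρ p x) +
      (-1 : ℤ) ^ p • (append u (deleteLast x) - mulLast u x + x) := by
  induction x using Finsupp.induction_linear with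
  | zero => simp
  | add x y hx hy => simp only [map_add, hx, hy, smul_add, smul_sub]; abel
  | single g m =>
    have h0 : (fun i : Fin (p + 1) => Fin.snoc (α := fun _ => Γ) g u i.succ) =
        Fin.snoc (α := fun _ => Γ) (fun i : Fin p => g i.succ) u := by
      funext k
      induction k using Fin.lastCases with
      | last => rw [Fin.succ_last, Fin.snoc_last, Fin.snoc_last]
      | cast k => rw [← Fin.castSucc_succ, Fin.snoc_castSucc, Fin.snoc_castSucc]
    have h1 : Fin.snoc (α := fun _ => Γ) g u 0 = g 0 :=
      Fin.snoc_castSucc (α := fun _ => Γ) u g 0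
    have h2 : mulLast u (Finsupp.single g m) = Finsupp.single (Fin.snoc (α := fun _ => Γ)
      (Fin.init (α := fun _ => Γ) g) (g (Fin.last p) * u)) m := Finsupp.mapDomain_single
    rw [append_single, diff_single, diff_single, Fin.sum_univ_castSucc, Fin.sum_univ_castSucc,
      Fin.sum_univ_castSucc, contractNth_last, contractNth_castSucc_last_snoc, contractNth_last,
      deleteLast_single, h0, h1, h2, Fin.init_snoc]
    simp only [contractNth_castSucc_snoc, map_add, map_sum, hom_zsmul, append_single,
      Fin.val_castSucc, Fin.val_last, pow_succ, mul_neg, mul_one, neg_smul, neg_neg, smul_add,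
      smul_sub, map_neg]
    abel

theorem mulLast_one (x : BarChain Γ M (p + 1)) : mulLast 1 x = x := by
  induction x using append_induction with
  | zero => simp
  | add x y hx hy => simp only [map_add, hx, hy]
  | append u x => rw [mulLast_append, mul_one]

/-- For `u = tʲ` and `v = t` the last two terms are [x | tʲ⁺¹] - [x | tʲ], the source of all
telescoping below. -/
theorem diff_append_append (u v : Γ) (x : BarChain Γ M (p + 1)) :
    diff ρ (p + 2) (append v (append u x)) = append v (append u (diff ρ p x)) +
      (-1 : ℤ) ^ p • (append v (append u (deleteLast x)) - append v (mulLast u x) +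
        append (u * v) x - append u x) := by
  rw [diff_append_succ, diff_append_succ, deleteLast_append, mulLast_append, map_add, hom_zsmul,
    map_add, map_sub, pow_succ, mul_neg, mul_one, neg_smul, ← sub_eq_add_neg, add_sub_assoc,
    ← smul_sub]
  congr 2
  abel

theorem diff_append_append_zero (u v : Γ) (x : BarChain Γ M 0) :
    diff ρ 1 (append v (append u x)) = append v (Finsupp.mapRange.addMonoidHom (ρ u⁻¹) x) -
      append (u * v) x + append u x := by
  rw [diff_append_succ, diff_append_zero, deleteLast_append, mulLast_append, map_sub, pow_zero,
    one_smul]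
  abel

end BarChain

/-! ## The contraction of the bar complex of `ℤ` -/

namespace BarChain

variable {M : Type*} [AddCommGroup M] {p : ℕ}

local notation "ℤₘ" => Multiplicative ℤ

/-- The operator `x ↦ ∑_{0 ≤ j < k} [x | tʲ | t] - [x | 1 | 1]`, where `t` is the generator. -/
def appendTwo (g : ℤₘ) : BarChain ℤₘ M p →+ BarChain ℤₘ M (p + 2) :=
  intSum (fun j => (append (Multiplicative.ofAdd 1)).comp (append (Multiplicative.ofAdd j)))
    g.toAdd - (append 1).comp (append 1)

theorem appendTwo_apply (g : ℤₘ) (x : BarChain ℤₘ M p) : appendTwo g x =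
    intSum (fun j => append (Multiplicative.ofAdd (1 : ℤ)) (append (Multiplicative.ofAdd j) x))
      g.toAdd - append 1 (append 1 x) := by
  rw [appendTwo, AddMonoidHom.sub_apply]
  exact congrArg (· - append 1 (append 1 x))
    (map_intSum (AddMonoidHom.eval (N := BarChain ℤₘ M (p + 2)) x) _ _)

/-- The contracting homotopy of the bar complex of `ℤ` in degrees greater than one. -/
def homotopy : ∀ p, BarChain ℤₘ M p →+ BarChain ℤₘ M (p + 1)
  -- The column of degree zero is kept unchanged by the retraction.
  | 0 => 0
  -- The sign makes [x | g] occur with coefficient one in the boundary of its image.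
  | p + 1 => (-1 : ℤ) ^ (p + 1) • Finsupp.liftAddHom fun g =>
    (appendTwo (g (Fin.last p))).comp (Finsupp.singleAddHom (Fin.init (α := fun _ => ℤₘ) g))

theorem homotopy_append (g : ℤₘ) (x : BarChain ℤₘ M p) :
    homotopy (p + 1) (append g x) = (-1 : ℤ) ^ (p + 1) • appendTwo g x := by
  induction x using Finsupp.induction_linear with
  | zero => simp
  | add x y hx hy => simp only [map_add, hx, hy, smul_add]
  | single f m =>
    rw [append_single, homotopy, AddMonoidHom.smul_apply, Finsupp.liftAddHom_apply_single,
      Fin.snoc_last, Fin.init_snoc]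
    rfl

/-- The homotopy touches only the labels. Naturality in the coefficients will make it commute with
the vertical differential. -/
theorem mapRange_homotopy {M' : Type*} [AddCommGroup M'] (φ : M →+ M') (x : BarChain ℤₘ M p) :
    Finsupp.mapRange.addMonoidHom φ (homotopy p x) =
      homotopy p (Finsupp.mapRange.addMonoidHom φ x) := by
  cases p with
  | zero => exact map_zero _
  | succ p =>
    induction x using append_induction with
    | zero => simp
    | add x y hx hy => simp only [map_add, hx, hy]
    | append g x =>
      rw [homotopy_append, mapRange_append, homotopy_append, map_zsmul, appendTwo_apply,
        appendTwo_apply, map_sub, map_intSum]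
      simp only [mapRange_append]

/-- For `x = [y | tᶜ]` and `g = tᵏ` the difference is the part c ≤ j < c + k of the defining sum;
the correction [y | 1 | 1] cancels. -/
theorem homotopy_mulLast_sub (g : ℤₘ) (x : BarChain ℤₘ M (p + 1)) :
    homotopy (p + 1) (mulLast g x) - homotopy (p + 1) x = (-1 : ℤ) ^ (p + 1) •
      intSum (fun j => append (Multiplicative.ofAdd (1 : ℤ)) (mulLast (Multiplicative.ofAdd j) x))
        g.toAdd := by
  induction x using append_induction with
  | zero =>
    simp only [map_zero, sub_zero]
    rw [intSum_eq_sub (F := 0) (by simp)]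
    simp
  | add x y hx hy =>
    rw [map_add, map_add, map_add, add_sub_add_comm, hx, hy, ← smul_add]
    congr 1
    rw [intSum_eq_sub (f := fun j => append (Multiplicative.ofAdd (1 : ℤ))
      (mulLast (Multiplicative.ofAdd j) (x + y))) (F := fun k =>
      intSum (fun j => append (Multiplicative.ofAdd (1 : ℤ)) (mulLast (Multiplicative.ofAdd j) x)) k
      + intSum (fun j => append (Multiplicative.ofAdd (1 : ℤ))
        (mulLast (Multiplicative.ofAdd j) y)) k), intSum_zero, intSum_zero, add_zero, sub_zero]
    intro k
    rw [intSum_succ, intSum_succ, map_add, map_add]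
    abel
  | append c x =>
    simp only [mulLast_append]
    rw [homotopy_append, homotopy_append, ← smul_sub, appendTwo_apply, appendTwo_apply,
      sub_sub_sub_cancel_right, toAdd_mul, intSum_add_sub]
    rfl

variable (ρ : ℤₘ → M →+ M)

/-- For `g = tᵏ` the boundary of the sum telescopes to [x | tᵏ] - [x | 1], up to sign and the terms
built from `x`. The subtracted chain [x | 1 | 1] is there because its boundary removes the leftover
[x | 1]. -/
theorem diff_appendTwo (g : ℤₘ) (x : BarChain ℤₘ M (p + 1)) :
    diff ρ (p + 2) (appendTwo g x) = appendTwo g (diff ρ p x) + (-1 : ℤ) ^ p •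
      (appendTwo g (deleteLast x) - intSum (fun j => append (Multiplicative.ofAdd (1 : ℤ))
        (mulLast (Multiplicative.ofAdd j) x)) g.toAdd + append g x) := by
  simp only [appendTwo_apply]
  rw [map_sub, map_intSum, intSum_eq_sub (F := fun k =>
      intSum (fun j => append (Multiplicative.ofAdd (1 : ℤ))
        (append (Multiplicative.ofAdd j) (diff ρ p x))) k +
      (-1 : ℤ) ^ p • (intSum (fun j => append (Multiplicative.ofAdd (1 : ℤ))
        (append (Multiplicative.ofAdd j) (deleteLast x))) k -
        intSum (fun j => append (Multiplicative.ofAdd (1 : ℤ))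
          (mulLast (Multiplicative.ofAdd j) x)) k + append (Multiplicative.ofAdd k) x)),
    diff_append_append, mulLast_one, mul_one]
  · simp only [intSum_zero, ofAdd_zero, ofAdd_toAdd, zero_add, sub_zero]
    simp only [smul_add, smul_sub]
    abel
  · intro k
    rw [diff_append_append, intSum_succ, intSum_succ, intSum_succ, ofAdd_add]
    simp only [smul_add, smul_sub]
    abel

/-- On [a | g] the terms that involve the boundary of `a`, and those that involve `deleteLast a`,
cancel in pairs. The remaining sum ∑ [a tʲ | t] is cancelled by the change of the homotopy when `g`
is multiplied into the last label of `a`. -/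
theorem diff_homotopy (x : BarChain ℤₘ M (p + 2)) :
    diff ρ (p + 2) (homotopy (p + 2) x) + homotopy (p + 1) (diff ρ (p + 1) x) = x := by
  induction x using append_induction with
  | zero => simp
  | add x y hx hy =>
    simp only [map_add]
    rw [add_add_add_comm, hx, hy]
  | append g a =>
    have h := sub_eq_iff_eq_add.1 (homotopy_mulLast_sub g a)
    rw [homotopy_append, hom_zsmul, diff_appendTwo, diff_append_succ, map_add, homotopy_append,
      hom_zsmul, map_add, map_sub, homotopy_append, h]
    obtain hp | hp := neg_one_pow_eq_or ℤ p <;>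
    · simp only [pow_succ, hp, mul_neg, mul_one, one_smul, neg_smul, neg_neg]
      abel

/-! ### The retraction in degrees one and zero -/

/-- The map `[tᵏ] m ↦ ∑_{0 ≤ j < k} t⁻ʲ m`, where `t` is the generator. -/
def toGenerator : BarChain ℤₘ M 1 →+ M :=
  Finsupp.liftAddHom fun g => intSum (fun j => ρ (Multiplicative.ofAdd j)⁻¹) (g 0).toAdd

theorem toGenerator_single (g : Fin 1 → ℤₘ) (m : M) : toGenerator ρ (Finsupp.single g m) =
    intSum (fun j => ρ (Multiplicative.ofAdd j)⁻¹ m) (g 0).toAdd := by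
  rw [toGenerator, Finsupp.liftAddHom_apply_single]
  exact map_intSum (AddMonoidHom.eval (N := M) m) _ _

theorem toGenerator_single_generator (hρ : ∀ m, ρ 1 m = m) (m : M) :
    toGenerator ρ (Finsupp.single (fun _ => Multiplicative.ofAdd (1 : ℤ)) m) = m := by
  rw [toGenerator_single, toAdd_ofAdd, intSum_one, ofAdd_zero, inv_one, hρ]

/-- In this lowest degree the zeroth face of [tʲ | t]m is [t] t⁻ʲ m. These faces do not telescope
and add up to the part supported on the generator. -/
theorem diff_homotopy_one (hρ : ∀ m, ρ 1 m = m) (x : BarChain ℤₘ M 1) :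
    diff ρ 1 (homotopy 1 x) =
      x - Finsupp.single (fun _ => Multiplicative.ofAdd (1 : ℤ)) (toGenerator ρ x) := by
  induction x using Finsupp.induction_linear with
  | zero => simp
  | add x y hx hy =>
    rw [map_add, map_add, map_add, Finsupp.single_add, hx, hy]
    abel
  | single g m =>
    have happ : ∀ (f : Fin 1 → ℤₘ) (m : M),
        Finsupp.single f m = append (f 0) (Finsupp.single (fun i => i.elim0) m) := by
      intro f m
      rw [append_single]
      refine congrArg (Finsupp.single · m) (funext fun i => ?_)
      obtain rfl : i = Fin.last 0 := Subsingleton.elim _ _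
      rw [Fin.snoc_last]
      rfl
    have hone : ∀ x : BarChain ℤₘ M 0, Finsupp.mapRange.addMonoidHom (ρ 1) x = x := fun x =>
      Finsupp.ext fun g => hρ _
    have hsum : ∀ k, Finsupp.single (fun _ : Fin 1 => Multiplicative.ofAdd (1 : ℤ))
        (intSum (fun j => ρ (Multiplicative.ofAdd j)⁻¹ m) k) =
        intSum (fun j => append (Multiplicative.ofAdd (1 : ℤ)) (Finsupp.mapRange.addMonoidHom
          (ρ (Multiplicative.ofAdd j)⁻¹) (Finsupp.single (fun i : Fin 0 => i.elim0) m))) k := by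
      intro k
      refine (map_intSum (Finsupp.singleAddHom _) _ k).trans (congrArg (intSum · k) ?_)
      funext j
      rw [Finsupp.mapRange.addMonoidHom_apply, Finsupp.mapRange_single]
      exact happ _ _
    -- The antidifference is the sum of the zeroth faces minus [tᵏ]m; its value -[1]m at zero is
    -- offset by the boundary of [1 | 1]m.
    rw [toGenerator_single, hsum, happ g m, homotopy_append, hom_zsmul, appendTwo_apply, map_sub,
      map_intSum, intSum_eq_sub (F := fun k => intSum (fun j => append (Multiplicative.ofAdd (1 : ℤ))
        (Finsupp.mapRange.addMonoidHom (ρ (Multiplicative.ofAdd j)⁻¹)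
          (Finsupp.single (fun i : Fin 0 => i.elim0) m))) k -
        append (Multiplicative.ofAdd k) (Finsupp.single (fun i : Fin 0 => i.elim0) m)),
      diff_append_append_zero, inv_one, hone, mul_one, intSum_zero, ofAdd_zero, ofAdd_toAdd]
    · simp only [zero_add, pow_one, neg_smul, one_smul]
      abel
    · intro k
      rw [diff_append_append_zero, intSum_succ, ofAdd_add]
      abel

theorem mapRange_toGenerator {M' : Type*} [AddCommGroup M'] {ρ' : ℤₘ → M' →+ M'} (φ : M →+ M')
    (hφ : ∀ g m, φ (ρ g m) = ρ' g (φ m)) (x : BarChain ℤₘ M 1) :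
    φ (toGenerator ρ x) = toGenerator ρ' (Finsupp.mapRange.addMonoidHom φ x) := by
  induction x using Finsupp.induction_linear with
  | zero => simp only [map_zero]
  | add x y hx hy => simp only [map_add, hx, hy]
  | single g m =>
    rw [Finsupp.mapRange.addMonoidHom_apply, Finsupp.mapRange_single, toGenerator_single,
      toGenerator_single, map_intSum]
    simp only [hφ]

variable {ρ}

/-- The geometric sum: (t⁻¹ - 1) ∑_{0 ≤ j < k} t⁻ʲ m = t⁻ᵏ m - m. -/
theorem diff_zero_eq (hone : ∀ m, ρ 1 m = m) (hmul : ∀ g h m, ρ (g * h) m = ρ g (ρ h m))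
    (x : BarChain ℤₘ M 1) (e : Fin 0 → ℤₘ) :
    diff ρ 0 x = Finsupp.single e
      (ρ (Multiplicative.ofAdd (1 : ℤ))⁻¹ (toGenerator ρ x) - toGenerator ρ x) := by
  induction x using Finsupp.induction_linear with
  | zero => simp
  | add x y hx hy =>
    rw [map_add, map_add, map_add, hx, hy, ← Finsupp.single_add]
    congr 1
    abel
  | single g m =>
    have key : ρ (Multiplicative.ofAdd (1 : ℤ))⁻¹ (toGenerator ρ (Finsupp.single g m)) -
        toGenerator ρ (Finsupp.single g m) = ρ (g 0)⁻¹ m - m := by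
      rw [toGenerator_single, map_intSum, sub_eq_iff_eq_add, intSum_eq_sub (F := fun k =>
        ρ (Multiplicative.ofAdd k)⁻¹ m - m +
          intSum (fun j => ρ (Multiplicative.ofAdd j)⁻¹ m) k), intSum_zero, ofAdd_zero, inv_one,
        hone, sub_self, add_zero, sub_zero, ofAdd_toAdd]
      intro k
      rw [intSum_succ, ofAdd_add, mul_comm, mul_inv_rev, mul_comm, hmul]
      abel
    rw [key, diff_single, Fin.sum_univ_one, Finsupp.single_sub, sub_eq_add_neg]
    refine congrArg₂ (· + ·) ?_ ?_
    · exact congrArg (Finsupp.single · _) (Subsingleton.elim _ _)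
    · refine (neg_one_zsmul _).trans (congrArg (- ·) ?_)
      exact congrArg (Finsupp.single · _) (Subsingleton.elim _ _)

/-- A crossed homomorphism identity: for [tᵏ | tˡ]m, the sum over 0 ≤ j < k + l splits at k, and its
second part is the sum of length l applied to t⁻ᵏ m. -/
theorem toGenerator_diff (hmul : ∀ g h m, ρ (g * h) m = ρ g (ρ h m)) (x : BarChain ℤₘ M 2) :
    toGenerator ρ (diff ρ 1 x) = 0 := by
  induction x using Finsupp.induction_linear with
  | zero => simp only [map_zero]
  | add x y hx hy => simp only [map_add, hx, hy, add_zero]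
  | single g m =>
    have h := intSum_add_sub (fun j => ρ (Multiplicative.ofAdd j)⁻¹ m) (g 0).toAdd (g 1).toAdd
    have h' : (fun j => ρ (Multiplicative.ofAdd j)⁻¹ (ρ (g 0)⁻¹ m)) =
        fun j => ρ (Multiplicative.ofAdd ((g 0).toAdd + j))⁻¹ m := by
      funext j
      rw [← hmul, ofAdd_add, ofAdd_toAdd, mul_inv_rev]
    rw [diff_single, Fin.sum_univ_two, map_add, map_add, toGenerator_single]
    have e0 : toGenerator ρ ((-1 : ℤ) ^ (((0 : Fin 2) : ℕ) + 1) •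
        Finsupp.single (Fin.contractNth 0 (· * ·) g) m) =
        -intSum (fun j => ρ (Multiplicative.ofAdd j)⁻¹ m) ((g 0).toAdd + (g 1).toAdd) := by
      refine (map_zsmul (toGenerator ρ) _ _).trans ((neg_one_zsmul _).trans ?_)
      rw [toGenerator_single]
      rfl
    have e1 : toGenerator ρ ((-1 : ℤ) ^ (((1 : Fin 2) : ℕ) + 1) •
        Finsupp.single (Fin.contractNth 1 (· * ·) g) m) =
        intSum (fun j => ρ (Multiplicative.ofAdd j)⁻¹ m) (g 0).toAdd := by
      refine (map_zsmul (toGenerator ρ) _ _).trans ((one_zsmul _).trans ?_)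
      rw [toGenerator_single]
      rfl
    rw [e0, e1, h']
    refine (congrArg (· + _) h.symm).trans ?_
    abel

end BarChain

/-! ## Maps on homology -/

section Graded

variable {I J : Type*} [DecidableEq I] [DecidableEq J] {A : I → Type*} {B : J → Type*}
  [∀ i, AddCommGroup (A i)] [∀ j, AddCommGroup (B j)]

theorem of_mem_degPart {deg : I → ℤ} {n : ℤ} {i : I} (h : deg i = n) (a : A i) :
    DirectSum.of A i a ∈ degPart A deg n :=
  fun _ hj => DirectSum.of_eq_of_ne _ _ _ fun hij => hj (hij ▸ h)

theorem map_mem_degPart {deg : I → ℤ} {deg' : J → ℤ} {n m : ℤ} (φ : (⨁ i, A i) →+ ⨁ j, B j)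
    (h : ∀ i a, deg i = n → φ (DirectSum.of A i a) ∈ degPart B deg' m) {c : ⨁ i, A i}
    (hc : c ∈ degPart A deg n) : φ c ∈ degPart B deg' m := by
  classical
  rw [← DirectSum.sum_support_of c, map_sum]
  refine sum_mem fun i hi => h i _ ?_
  by_contra hne
  exact DFinsupp.mem_support_iff.1 hi (hc i hne)

theorem eq_zero_of_mem_degPart {deg : I → ℤ} {n : ℤ} (h : ∀ i, deg i ≠ n) {c : ⨁ i, A i}
    (hc : c ∈ degPart A deg n) : c = 0 :=
  DFinsupp.ext fun i => hc i (h i)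

namespace Homology

variable {deg : I → ℤ} {D : (⨁ i, A i) →+ ⨁ i, A i} {m n : ℤ}
  {deg' : J → ℤ} {D' : (⨁ j, B j) →+ ⨁ j, B j} {m' n' : ℤ}

theorem exists_eq_cls (x : Homology deg D m n) : ∃ c, ∃ hc : c ∈ cycles deg D n, x = cls c hc := by
  obtain ⟨⟨c, hc⟩, rfl⟩ := QuotientAddGroup.mk_surjective x
  exact ⟨c, hc, rfl⟩

theorem cls_congr {c c' : ⨁ i, A i} (h : c = c') (hc : c ∈ cycles deg D n)
    (hc' : c' ∈ cycles deg D n) : (cls c hc : Homology deg D m n) = cls c' hc' := by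
  subst h; rfl

theorem cls_eq_zero_iff {c : ⨁ i, A i} (hc : c ∈ cycles deg D n) :
    (cls c hc : Homology deg D m n) = 0 ↔ ∃ b ∈ degPart A deg m, D b = c :=
  QuotientAddGroup.eq_zero_iff _

theorem cls_eq_cls_iff {c c' : ⨁ i, A i} (hc : c ∈ cycles deg D n) (hc' : c' ∈ cycles deg D n) :
    (cls c hc : Homology deg D m n) = cls c' hc' ↔ ∃ b ∈ degPart A deg m, D b = c - c' := by
  rw [← sub_eq_zero]
  exact cls_eq_zero_iff (sub_mem hc hc')

/-- The map on homology induced by a homomorphism that preserves cycles and boundaries. -/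
def induced (φ : (⨁ i, A i) →+ ⨁ j, B j) (hφ : ∀ c ∈ cycles deg D n, φ c ∈ cycles deg' D' n')
    (hb : ∀ b ∈ degPart A deg m, ∃ b' ∈ degPart B deg' m', D' b' = φ (D b)) :
    Homology deg D m n →+ Homology deg' D' m' n' :=
  QuotientAddGroup.map _ _
    ((φ.comp (cycles deg D n).subtype).codRestrict (cycles deg' D' n') fun c => hφ _ c.2)
    (by
      rintro ⟨c, hc⟩ ⟨b, hb', hbc⟩
      simp only [AddSubgroup.coe_subtype] at hbc
      subst hbc
      exact hb b hb')

theorem subsingleton_of_forall_ne (h : ∀ i, deg i ≠ n) : Subsingleton (Homology deg D m n) := by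
  refine subsingleton_of_forall_eq 0 fun x => ?_
  obtain ⟨c, hc, rfl⟩ := exists_eq_cls x
  obtain rfl := eq_zero_of_mem_degPart h hc.1
  rfl

end Homology

end Graded

/-! ## The contraction on sections over strings -/

section SectionHomotopy

variable {X : Type u} [TopologicalSpace X] [T2Space X] [LocallyCompactSpace X]
    [MulAction (Multiplicative ℤ) X] [ContinuousConstSMul (Multiplicative ℤ) X]
    (S : GSheaf.{u, 0, w} (transformationGroupoid (Multiplicative ℤ) X)) {p : ℕ}

theorem bar_chainEquiv (x : BarChain (Multiplicative ℤ) _ (p + 1)) :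
    bar S p (chainEquiv S (p + 1) x) = chainEquiv S p (BarChain.diff (translate S) p x) := by
  induction x using Finsupp.induction_linear with
  | zero => simp only [map_zero]
  | add x y hx hy => simp only [map_add, hx, hy]
  | single g m =>
    rw [chainEquiv_single, bar_sheet, BarChain.diff_single, map_add, chainEquiv_single, map_sum]
    refine congrArg (_ + ·) (Finset.sum_congr rfl fun j _ => ?_)
    rw [← chainEquiv_single]
    exact (map_zsmul _ _ _).symm

theorem mapGammaC_chainEquiv {S} {T : GSheaf.{u, 0, w'} (transformationGroupoid (Multiplicative ℤ) X)}
    (φ : GSheaf.Hom S T) (x : BarChain (Multiplicative ℤ) _ p) :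
    φ.mapGammaC _ (chainEquiv S p x) =
      chainEquiv T p (Finsupp.mapRange.addMonoidHom (φ.mapGammaC _) x) := by
  induction x using Finsupp.induction_linear with
  | zero => simp only [map_zero]
  | add x y hx hy => simp only [map_add, hx, hy]
  | single g m =>
    rw [chainEquiv_single, mapGammaC_sheet, Finsupp.mapRange.addMonoidHom_apply,
      Finsupp.mapRange_single, chainEquiv_single]

/-- The contracting homotopy of the bar complex, on sections over strings. -/
def secHomotopy (p : ℕ) : S.GammaC (tau (𝒢 := transformationGroupoid (Multiplicative ℤ) X) p) →+
    S.GammaC (tau (𝒢 := transformationGroupoid (Multiplicative ℤ) X) (p + 1)) :=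
  (chainEquiv S (p + 1)).toAddMonoidHom.comp
    ((BarChain.homotopy p).comp (chainEquiv S p).symm.toAddMonoidHom)

theorem secHomotopy_chainEquiv (x : BarChain (Multiplicative ℤ) _ p) :
    secHomotopy S p (chainEquiv S p x) = chainEquiv S (p + 1) (BarChain.homotopy p x) :=
  congrArg (fun x => chainEquiv S (p + 1) (BarChain.homotopy p x))
    ((chainEquiv S p).symm_apply_apply x)

/-- Applied to the differentials of the resolution: the horizontal homotopy commutes with the
vertical differential. -/
theorem mapGammaC_secHomotopy {S}
    {T : GSheaf.{u, 0, w'} (transformationGroupoid (Multiplicative ℤ) X)} (φ : GSheaf.Hom S T)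
    (t : S.GammaC (tau (𝒢 := transformationGroupoid (Multiplicative ℤ) X) p)) :
    φ.mapGammaC _ (secHomotopy S p t) = secHomotopy T p (φ.mapGammaC _ t) := by
  obtain ⟨x, rfl⟩ := (chainEquiv S p).surjective t
  rw [secHomotopy_chainEquiv, mapGammaC_chainEquiv, mapGammaC_chainEquiv, secHomotopy_chainEquiv,
    BarChain.mapRange_homotopy]

theorem secHomotopy_zero
    (t : S.GammaC (tau (𝒢 := transformationGroupoid (Multiplicative ℤ) X) 0)) :
    secHomotopy S 0 t = 0 :=
  map_zero (chainEquiv S 1)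

/-- The coefficient of the generator, after contraction. -/
def secGenerator : S.GammaC (tau (𝒢 := transformationGroupoid (Multiplicative ℤ) X) 1) →+
    S.GammaC (ContinuousMap.id (TransObj (Multiplicative ℤ) X)) :=
  (BarChain.toGenerator (translate S)).comp (chainEquiv S 1).symm.toAddMonoidHom

theorem secGenerator_chainEquiv (x : BarChain (Multiplicative ℤ) _ 1) :
    secGenerator S (chainEquiv S 1 x) = BarChain.toGenerator (translate S) x :=
  congrArg (BarChain.toGenerator (translate S)) ((chainEquiv S 1).symm_apply_apply x)

theorem secGenerator_toStrOne
    (z : S.GammaC (ContinuousMap.id (TransObj (Multiplicative ℤ) X))) :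
    secGenerator S (toStrOne S (Multiplicative.ofAdd (1 : ℤ)) z) = z := by
  rw [toStrOne_eq_sheet, ← chainEquiv_single, secGenerator_chainEquiv,
    BarChain.toGenerator_single_generator _ (translate_one S)]

theorem bar_secHomotopy_one
    (t : S.GammaC (tau (𝒢 := transformationGroupoid (Multiplicative ℤ) X) 1)) :
    bar S 1 (secHomotopy S 1 t) =
      t - toStrOne S (Multiplicative.ofAdd (1 : ℤ)) (secGenerator S t) := by
  obtain ⟨x, rfl⟩ := (chainEquiv S 1).surjective t
  rw [secHomotopy_chainEquiv, bar_chainEquiv, BarChain.diff_homotopy_one _ (translate_one S),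
    map_sub, chainEquiv_single, secGenerator_chainEquiv, toStrOne_eq_sheet]

theorem bar_secHomotopy
    (t : S.GammaC (tau (𝒢 := transformationGroupoid (Multiplicative ℤ) X) (p + 2))) :
    bar S (p + 2) (secHomotopy S (p + 2) t) + secHomotopy S (p + 1) (bar S (p + 1) t) = t := by
  obtain ⟨x, rfl⟩ := (chainEquiv S (p + 2)).surjective t
  rw [secHomotopy_chainEquiv, bar_chainEquiv, bar_chainEquiv, secHomotopy_chainEquiv, ← map_add,
    BarChain.diff_homotopy]

/-- The inverse of `toStrZero`. -/
def fromStrZero : S.GammaC (tau (𝒢 := transformationGroupoid (Multiplicative ℤ) X) 0) →+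
    S.GammaC (ContinuousMap.id (TransObj (Multiplicative ℤ) X)) :=
  restrictSheet S fun i => i.elim0

theorem fromStrZero_toStrZero
    (z : S.GammaC (ContinuousMap.id (TransObj (Multiplicative ℤ) X))) :
    fromStrZero S (toStrZero S z) = z := rfl

theorem toStrZero_fromStrZero
    (t : S.GammaC (tau (𝒢 := transformationGroupoid (Multiplicative ℤ) X) 0)) :
    toStrZero S (fromStrZero S t) = t := by
  refine Subtype.ext (funext fun F => ?_)
  obtain ⟨g, x, rfl⟩ := exists_eq_strOf F
  obtain rfl : g = fun i => i.elim0 := Subsingleton.elim _ _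
  rfl

theorem bar_toStrOne (γ : Multiplicative ℤ)
    (z : S.GammaC (ContinuousMap.id (TransObj (Multiplicative ℤ) X))) :
    bar S 0 (toStrOne S γ z) = toStrZero S (translate S γ⁻¹ z - z) := by
  rw [toStrOne_eq_sheet, bar_sheet, Fin.sum_univ_one, map_sub, sub_eq_add_neg]
  refine congrArg₂ (· + ·) (toStrZero_eq_sheet S _ _).symm ?_
  refine (neg_one_zsmul _).trans (congrArg (- ·) ?_)
  exact (toStrZero_eq_sheet S _ _).symm

theorem mapGammaC_secGenerator {S}
    {T : GSheaf.{u, 0, w'} (transformationGroupoid (Multiplicative ℤ) X)} (φ : GSheaf.Hom S T)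
    (t : S.GammaC (tau (𝒢 := transformationGroupoid (Multiplicative ℤ) X) 1)) :
    φ.mapGammaC _ (secGenerator S t) = secGenerator T (φ.mapGammaC _ t) := by
  obtain ⟨x, rfl⟩ := (chainEquiv S 1).surjective t
  rw [mapGammaC_chainEquiv, secGenerator_chainEquiv, secGenerator_chainEquiv]
  exact BarChain.mapRange_toGenerator _ _ (mapGammaC_translate φ) x

theorem secGenerator_bar
    (t : S.GammaC (tau (𝒢 := transformationGroupoid (Multiplicative ℤ) X) 2)) :
    secGenerator S (bar S 1 t) = 0 := by
  obtain ⟨x, rfl⟩ := (chainEquiv S 2).surjective t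
  rw [bar_chainEquiv, secGenerator_chainEquiv, BarChain.toGenerator_diff (translate_mul S)]

theorem fromStrZero_bar
    (t : S.GammaC (tau (𝒢 := transformationGroupoid (Multiplicative ℤ) X) 1)) :
    fromStrZero S (bar S 0 t) =
      translate S (Multiplicative.ofAdd (1 : ℤ))⁻¹ (secGenerator S t) - secGenerator S t := by
  obtain ⟨x, rfl⟩ := (chainEquiv S 1).surjective t
  rw [bar_chainEquiv, secGenerator_chainEquiv, BarChain.diff_zero_eq (translate_one S)
    (translate_mul S) x (fun i => i.elim0), chainEquiv_single, ← toStrZero_eq_sheet,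
    fromStrZero_toStrZero]

end SectionHomotopy

/-! ## The total complex -/

namespace SoftResolution

variable {X : Type u} [TopologicalSpace X] [T2Space X] [LocallyCompactSpace X]
  [MulAction (Multiplicative ℤ) X] [ContinuousConstSMul (Multiplicative ℤ) X]
  {A : GSheaf.{u, 0, w'} (transformationGroupoid (Multiplicative ℤ) X)}
  (R : SoftResolution.{u, 0, w, w'} A)

local notation "𝓉" => Multiplicative.ofAdd (1 : ℤ)

/-- The homotopy on the total complex. -/
def totalHomotopy : (⨁ pq, R.Entry pq) →+ ⨁ pq, R.Entry pq :=
  DirectSum.toAddMonoid fun pq =>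
    (DirectSum.of R.Entry (pq.1 + 1, pq.2)).comp (secHomotopy (R.S pq.2) pq.1)

theorem totalHomotopy_of (p q : ℕ) (t : R.Entry (p, q)) :
    R.totalHomotopy (DirectSum.of R.Entry (p, q) t) =
      DirectSum.of R.Entry (p + 1, q) (secHomotopy (R.S q) p t) :=
  DirectSum.toAddMonoid_of _ _ t

/-- The entries of the projection to the column `p = 0`. -/
def colZeroProjEntry : ∀ pq : ℕ × ℕ, R.Entry pq →+ ⨁ q, R.Sec q
  | (0, q) => (DirectSum.of R.Sec q).comp (fromStrZero (R.S q))
  | (_ + 1, _) => 0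

/-- The projection to the column `p = 0`. -/
def colZeroProj : (⨁ pq, R.Entry pq) →+ ⨁ q, R.Sec q :=
  DirectSum.toAddMonoid R.colZeroProjEntry

theorem colZeroProj_of (pq : ℕ × ℕ) (t : R.Entry pq) :
    R.colZeroProj (DirectSum.of R.Entry pq t) = R.colZeroProjEntry pq t :=
  DirectSum.toAddMonoid_of _ _ t

/-- The entries of the projection to the arrows in the column `p = 1` given by the generator. -/
def colOneProjEntry : ∀ pq : ℕ × ℕ, R.Entry pq →+ ⨁ q, R.Sec q
  | (1, q) => (DirectSum.of R.Sec q).comp (secGenerator (R.S q))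
  | (0, _) => 0
  | (_ + 2, _) => 0

/-- The projection to the arrows in the column `p = 1` given by the generator. -/
def colOneProj : (⨁ pq, R.Entry pq) →+ ⨁ q, R.Sec q :=
  DirectSum.toAddMonoid R.colOneProjEntry

theorem colOneProj_of (pq : ℕ × ℕ) (t : R.Entry pq) :
    R.colOneProj (DirectSum.of R.Entry pq t) = R.colOneProjEntry pq t :=
  DirectSum.toAddMonoid_of _ _ t

theorem colOne_of (γ : Multiplicative ℤ) (q : ℕ) (z : R.Sec q) :
    R.colOne γ (DirectSum.of R.Sec q z) =
      DirectSum.of R.Entry (1, q) (toStrOne (R.S q) γ z) :=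
  DirectSum.toAddMonoid_of _ q z

theorem colZeroProj_colZero (c : ⨁ q, R.Sec q) : R.colZeroProj (R.colZero c) = c := by
  induction c using DirectSum.induction_on with
  | zero => simp
  | add a b ha hb => simp only [map_add, ha, hb]
  | of q z => rw [colZero_of, colZeroProj_of]; rfl

theorem colOneProj_colZero (c : ⨁ q, R.Sec q) : R.colOneProj (R.colZero c) = 0 := by
  induction c using DirectSum.induction_on with
  | zero => simp
  | add a b ha hb => simp only [map_add, ha, hb, add_zero]
  | of q z => rw [colZero_of, colOneProj_of]; rfl

theorem colZeroProj_colOne (c : ⨁ q, R.Sec q) : R.colZeroProj (R.colOne 𝓉 c) = 0 := by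
  induction c using DirectSum.induction_on with
  | zero => simp
  | add a b ha hb => simp only [map_add, ha, hb, add_zero]
  | of q z => rw [colOne_of, colZeroProj_of]; rfl

theorem colOneProj_colOne (c : ⨁ q, R.Sec q) : R.colOneProj (R.colOne 𝓉 c) = c := by
  induction c using DirectSum.induction_on with
  | zero => simp
  | add a b ha hb => simp only [map_add, ha, hb]
  | of q z =>
    rw [colOne_of, colOneProj_of]
    exact congrArg (DirectSum.of R.Sec q) (secGenerator_toStrOne (R.S q) z)

theorem totalD_of_zero (q : ℕ) (t : R.Entry (0, q)) :
    R.totalD (DirectSum.of R.Entry (0, q) t) =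
      DirectSum.of R.Entry (0, q + 1) ((R.d q).mapGammaC _ t) := by
  rw [totalD_of]
  change 0 + (-1 : ℤ) ^ 0 • _ = _
  rw [pow_zero, one_smul, zero_add]
  rfl

theorem totalD_of_succ (p q : ℕ) (t : R.Entry (p + 1, q)) :
    R.totalD (DirectSum.of R.Entry (p + 1, q) t) =
      DirectSum.of R.Entry (p, q) (bar (R.S q) p t) + (-1 : ℤ) ^ (p + 1) •
        DirectSum.of R.Entry (p + 1, q + 1) ((R.d q).mapGammaC (tau (p + 1)) t) :=
  R.totalD_of _ t

/-- The sections on generator arrows are not a subcomplex by themselves; together with the column p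
= 0 they span the mapping cone of `t⁻¹ - 1`. The minus sign is (-1)ᵖ for p = 1. -/
theorem totalD_colOne (c : ⨁ q, R.Sec q) : R.totalD (R.colOne 𝓉 c) =
    R.colZero (R.chainAction 𝓉⁻¹ c - c) - R.colOne 𝓉 (R.secD c) := by
  induction c using DirectSum.induction_on with
  | zero => simp
  | add a b ha hb => simp only [map_add, map_sub, ha, hb]; abel
  | of q z =>
    rw [colOne_of, totalD_of_succ, bar_toStrOne, chainAction_of, ← map_sub, colZero_of, secD_of,
      colOne_of]
    refine (congrArg (_ + ·) ?_).trans (sub_eq_add_neg _ _).symm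
    refine (neg_one_zsmul _).trans (congrArg (fun t => -DirectSum.of R.Entry (1, q + 1) t) ?_)
    rw [toStrOne_eq_sheet, toStrOne_eq_sheet]
    exact mapGammaC_sheet _ _ _

/-- The homotopy raises p by one, so the two vertical contributions to D H + H D carry opposite
signs and cancel. -/
theorem add_alternating_cancel {G : Type*} [AddCommGroup G] (n : ℕ) {a b e : G} (c : G)
    (h : a + b = e) : a + (-1 : ℤ) ^ (n + 1) • c + (b + (-1 : ℤ) ^ n • c) = e := by
  rw [pow_succ, mul_neg_one, neg_zsmul, ← h]
  abel

/-- The vertical parts cancel, so in each column only the identity for the bar complex is left. It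
shows that the total complex deforms onto the mapping cone spanned by `colZero` and `colOne`. -/
theorem totalD_totalHomotopy (y : ⨁ pq, R.Entry pq) :
    R.totalD (R.totalHomotopy y) + R.totalHomotopy (R.totalD y) =
      y - R.colZero (R.colZeroProj y) - R.colOne 𝓉 (R.colOneProj y) := by
  induction y using DirectSum.induction_on with
  | zero => simp
  | add a b ha hb =>
    simp only [map_add]
    rw [add_add_add_comm, ha, hb]
    abel
  | of pq t =>
    obtain ⟨p, q⟩ := pq
    rw [colZeroProj_of, colOneProj_of]
    match p with
    | 0 =>
      rw [totalD_of_zero, totalHomotopy_of, totalHomotopy_of, secHomotopy_zero, secHomotopy_zero,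
        map_zero, map_zero, map_zero]
      change (0 : ⨁ pq, R.Entry pq) + 0 = _ - R.colZero (DirectSum.of R.Sec q _) - R.colOne 𝓉 0
      rw [colZero_of, toStrZero_fromStrZero, map_zero, sub_self, sub_zero, add_zero]
    | 1 =>
      -- The horizontal differential lands in the column p = 0, where the homotopy is zero, so
      -- `bar_secHomotopy_one` alone accounts for the horizontal part.
      rw [totalHomotopy_of, totalD_of_succ, totalD_of_succ, map_add, map_zsmul, totalHomotopy_of,
        totalHomotopy_of, secHomotopy_zero, mapGammaC_secHomotopy, bar_secHomotopy_one, map_sub,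
        map_zero]
      change _ = _ - R.colZero 0 - R.colOne 𝓉 (DirectSum.of R.Sec q _)
      rw [colOne_of, map_zero, sub_zero, pow_succ, mul_neg, mul_one, neg_smul]
      abel
    | p + 2 =>
      have h0 : R.colZeroProjEntry (p + 2, q) t = 0 := rfl
      have h1 : R.colOneProjEntry (p + 2, q) t = 0 := rfl
      have h := congrArg (DirectSum.of R.Entry (p + 2, q)) (bar_secHomotopy (R.S q) t)
      rw [map_add] at h
      have hd := mapGammaC_secHomotopy (p := p + 2) (R.d q) t
      rw [h0, h1, map_zero, map_zero, sub_zero, sub_zero, R.totalHomotopy_of (p + 2) q t,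
        R.totalD_of_succ (p + 2) q, R.totalD_of_succ (p + 1) q t, map_add, map_zsmul,
        R.totalHomotopy_of (p + 1) q, R.totalHomotopy_of (p + 2) (q + 1), hd]
      exact add_alternating_cancel (p + 2) _ h

theorem totalHomotopy_mem_degPart {n : ℤ} {y : ⨁ pq, R.Entry pq}
    (hy : y ∈ degPart R.Entry totalDeg n) :
    R.totalHomotopy y ∈ degPart R.Entry totalDeg (n + 1) := by
  refine map_mem_degPart _ ?_ hy
  rintro ⟨p, q⟩ t h
  rw [totalHomotopy_of]
  refine of_mem_degPart ?_ _
  simp only [totalDeg] at h ⊢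
  push_cast
  omega

theorem colZeroProj_mem_degPart {n m : ℤ} {y : ⨁ pq, R.Entry pq}
    (hy : y ∈ degPart R.Entry totalDeg n) (hm : m = -n) :
    R.colZeroProj y ∈ degPart R.Sec (fun q : ℕ => (q : ℤ)) m := by
  refine map_mem_degPart _ ?_ hy
  rintro ⟨_ | p, q⟩ t h
  · rw [colZeroProj_of]
    refine of_mem_degPart ?_ _
    simp only [totalDeg] at h
    omega
  · rw [colZeroProj_of]
    exact zero_mem _

theorem colOneProj_mem_degPart {n m : ℤ} {y : ⨁ pq, R.Entry pq}
    (hy : y ∈ degPart R.Entry totalDeg n) (hm : m = 1 - n) :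
    R.colOneProj y ∈ degPart R.Sec (fun q : ℕ => (q : ℤ)) m := by
  refine map_mem_degPart _ ?_ hy
  rintro ⟨_ | _ | p, q⟩ t h
  · rw [colOneProj_of]
    exact zero_mem _
  · rw [colOneProj_of]
    refine of_mem_degPart ?_ _
    simp only [totalDeg] at h
    omega
  · rw [colOneProj_of]
    exact zero_mem _

theorem colOne_mem_degPart {n m : ℤ} {c : ⨁ q, R.Sec q}
    (hc : c ∈ degPart R.Sec (fun q : ℕ => (q : ℤ)) m) (hm : m = 1 - n) :
    R.colOne 𝓉 c ∈ degPart R.Entry totalDeg n := by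
  refine map_mem_degPart _ ?_ hc
  intro q z h
  rw [colOne_of]
  refine of_mem_degPart ?_ _
  simp only [totalDeg] at h ⊢
  omega

end SoftResolution

/-! ### The short exact sequence of the mapping cone -/

theorem mem_zpowers_generator_inv (x : Multiplicative ℤ) :
    x ∈ Subgroup.zpowers (Multiplicative.ofAdd (1 : ℤ))⁻¹ := by
  rw [Subgroup.zpowers_inv]
  refine ⟨x.toAdd, ?_⟩
  change Multiplicative.ofAdd (1 : ℤ) ^ x.toAdd = x
  rw [← ofAdd_zsmul, smul_eq_mul, mul_one, ofAdd_toAdd]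

/-- The group elements whose action is not seen by `f` form a subgroup, so it suffices that it
contains a generator. -/
theorem apply_representation_eq_of_forall_mem_zpowers {k G V W : Type*} [CommRing k] [Group G]
    [AddCommGroup V] [Module k V] [AddCommGroup W] [Module k W] (ρ : Representation k G V)
    (f : V →ₗ[k] W) (g : G) (hg : ∀ x, x ∈ Subgroup.zpowers g) (hf : ∀ v, f (ρ g v) = f v)
    (x : G) (v : V) : f (ρ x v) = f v := by
  let H : Subgroup G :=
    { carrier := {x | ∀ v, f (ρ x v) = f v}
      one_mem' := fun v => by rw [map_one]; rfl
      mul_mem' := fun {a b} ha hb v => by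
        rw [map_mul, Module.End.mul_apply, ha, hb]
      inv_mem' := fun {a} ha v => by
        rw [← ha (ρ a⁻¹ v), ← Module.End.mul_apply, ← map_mul, mul_inv_cancel, map_one]
        rfl }
  exact (Subgroup.zpowers_le (H := H)).2 hf (hg x) v

namespace SoftResolution

variable {X : Type u} [TopologicalSpace X] [T2Space X] [LocallyCompactSpace X]
  [MulAction (Multiplicative ℤ) X] [ContinuousConstSMul (Multiplicative ℤ) X]
  {A : GSheaf.{u, 0, w'} (transformationGroupoid (Multiplicative ℤ) X)}
  (R : SoftResolution.{u, 0, w, w'} A)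

local notation "𝓉" => Multiplicative.ofAdd (1 : ℤ)

/-- Together with `colOneProj_totalD` this makes the pair of projections a chain map to the mapping
cone of `t⁻¹ - 1`. The extra term comes from the column p = 1 through `fromStrZero_bar`. -/
theorem colZeroProj_totalD (y : ⨁ pq, R.Entry pq) :
    R.colZeroProj (R.totalD y) = R.secD (R.colZeroProj y) +
      (R.chainAction 𝓉⁻¹ (R.colOneProj y) - R.colOneProj y) := by
  induction y using DirectSum.induction_on with
  | zero => simp
  | add a b ha hb => simp only [map_add, ha, hb]; abel
  | of pq t =>
    obtain ⟨_ | _ | p, q⟩ := pq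
    · rw [totalD_of_zero, colZeroProj_of, colZeroProj_of, colOneProj_of]
      change DirectSum.of R.Sec (q + 1) _ = R.secD (DirectSum.of R.Sec q _) +
        (R.chainAction 𝓉⁻¹ 0 - 0)
      rw [secD_of, map_zero, sub_zero, add_zero]
      rfl
    · rw [totalD_of_succ, map_add, map_zsmul, colZeroProj_of, colZeroProj_of, colZeroProj_of,
        colOneProj_of]
      change DirectSum.of R.Sec q (fromStrZero (R.S q) (bar (R.S q) 0 t)) + (-1 : ℤ) ^ _ • 0 =
        R.secD 0 + (R.chainAction 𝓉⁻¹ (DirectSum.of R.Sec q (secGenerator (R.S q) t)) -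
          DirectSum.of R.Sec q (secGenerator (R.S q) t))
      rw [fromStrZero_bar, chainAction_of, map_sub, map_zero, smul_zero, zero_add, add_zero]
    · rw [totalD_of_succ, map_add, map_zsmul, colZeroProj_of, colZeroProj_of, colZeroProj_of,
        colOneProj_of]
      change (0 : ⨁ q, R.Sec q) + (-1 : ℤ) ^ _ • (0 : ⨁ q, R.Sec q) =
        R.secD 0 + (R.chainAction 𝓉⁻¹ 0 - 0)
      rw [smul_zero, map_zero, map_zero, sub_zero]

/-- The column p = 2 does not contribute, because the projection kills bar boundaries
(`secGenerator_bar`). -/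
theorem colOneProj_totalD (y : ⨁ pq, R.Entry pq) :
    R.colOneProj (R.totalD y) = -R.secD (R.colOneProj y) := by
  induction y using DirectSum.induction_on with
  | zero => simp
  | add a b ha hb => simp only [map_add, ha, hb, neg_add]
  | of pq t =>
    obtain ⟨_ | _ | _ | p, q⟩ := pq
    · rw [totalD_of_zero, colOneProj_of, colOneProj_of]
      change (0 : ⨁ q, R.Sec q) = -R.secD 0
      rw [map_zero, neg_zero]
    · rw [totalD_of_succ, map_add, map_zsmul, colOneProj_of, colOneProj_of, colOneProj_of]
      change (0 : ⨁ q, R.Sec q) + (-1 : ℤ) ^ 1 • DirectSum.of R.Sec (q + 1) _ =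
        -R.secD (DirectSum.of R.Sec q _)
      rw [secD_of, zero_add]
      refine (neg_one_zsmul _).trans
        (congrArg (fun t => -DirectSum.of R.Sec (q + 1) t) ?_)
      exact (mapGammaC_secGenerator (R.d q) t).symm
    · rw [totalD_of_succ, map_add, map_zsmul, colOneProj_of, colOneProj_of, colOneProj_of]
      change DirectSum.of R.Sec q (secGenerator (R.S q) (bar (R.S q) 1 t)) +
        (-1 : ℤ) ^ _ • (0 : ⨁ q, R.Sec q) = -R.secD 0
      rw [secGenerator_bar, smul_zero, map_zero, map_zero, neg_zero, add_zero]
    · rw [totalD_of_succ, map_add, map_zsmul, colOneProj_of, colOneProj_of, colOneProj_of]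
      change (0 : ⨁ q, R.Sec q) + (-1 : ℤ) ^ _ • (0 : ⨁ q, R.Sec q) = -R.secD 0
      rw [smul_zero, map_zero, neg_zero, add_zero]

theorem colOneProj_mem_cocycles {n : ℤ} {y : ⨁ pq, R.Entry pq} (hy : y ∈ R.totalCycles n) :
    R.colOneProj y ∈ R.cocycles (1 - n) := by
  refine ⟨R.colOneProj_mem_degPart hy.1 rfl, ?_⟩
  have h := R.colOneProj_totalD y
  rw [show R.totalD y = 0 from hy.2, map_zero] at h
  exact neg_eq_zero.1 h.symm

theorem chainAction_sub_mem_degPart {m : ℤ} {c : ⨁ q, R.Sec q} (γ : Multiplicative ℤ)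
    (hc : c ∈ degPart R.Sec (fun q : ℕ => (q : ℤ)) m) :
    R.chainAction γ c - c ∈ degPart R.Sec (fun q : ℕ => (q : ℤ)) m :=
  sub_mem (R.chainAction_mem γ m c hc) hc

/-- The map on homology induced by the inclusion of the column `p = 0`. -/
def colZeroHomology (n : ℤ) : R.CompactCohomology (-n) →+ R.GroupoidHomology n :=
  Homology.induced R.colZero (fun _ hc => R.colZero_mem_totalCycles hc) fun b hb =>
    ⟨R.colZero b, R.colZero_mem_degPart (by rwa [neg_add']), R.totalD_colZero b⟩

theorem chainAction_mem_cocycles {m : ℤ} (γ : Multiplicative ℤ) {c : ⨁ q, R.Sec q}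
    (hc : c ∈ R.cocycles m) : R.chainAction γ c ∈ R.cocycles m :=
  ⟨R.chainAction_mem γ m c hc.1, by
    change R.secD _ = 0
    rw [secD_chainAction, show R.secD c = 0 from hc.2, map_zero]⟩

/-- For a cocycle `c`, placing it on the generator arrows gives a chain with boundary `t⁻¹ c - c` in
the column p = 0. Since `t⁻¹` generates ℤ, the whole group acts trivially on the image. -/
theorem colZeroHomology_cohomologyAction (n : ℤ) (γ : Multiplicative ℤ)
    (x : R.CompactCohomology (-n)) :
    R.colZeroHomology n (R.cohomologyAction (-n) γ x) = R.colZeroHomology n x := by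
  refine apply_representation_eq_of_forall_mem_zpowers (R.cohomologyAction (-n))
    (R.colZeroHomology n).toIntLinearMap _ mem_zpowers_generator_inv (fun x => ?_) γ x
  obtain ⟨c, hc, rfl⟩ := Homology.exists_eq_cls x
  refine (Homology.cls_eq_cls_iff (R.colZero_mem_totalCycles (R.chainAction_mem_cocycles 𝓉⁻¹ hc))
    (R.colZero_mem_totalCycles hc)).2
    ⟨R.colOne 𝓉 c, R.colOne_mem_degPart hc.1 (by ring), ?_⟩
  rw [totalD_colOne, show R.secD c = 0 from hc.2, map_zero, sub_zero, map_sub]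

/-- The map `H_c^{-n}(X)_ℤ → H_n(ℤ ⋉ X)`. -/
def fromCoinvariants (n : ℤ) :
    (R.cohomologyAction (-n)).Coinvariants →+ R.GroupoidHomology n :=
  (Representation.Coinvariants.lift (R.cohomologyAction (-n))
    (R.colZeroHomology n).toIntLinearMap fun γ =>
      LinearMap.ext (R.colZeroHomology_cohomologyAction n γ)).toAddMonoidHom

theorem fromCoinvariants_mk (n : ℤ) {c : ⨁ q, R.Sec q} (hc : c ∈ R.cocycles (-n)) :
    R.fromCoinvariants n (Representation.Coinvariants.mk (R.cohomologyAction (-n))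
      (Homology.cls c hc)) = Homology.cls (R.colZero c) (R.colZero_mem_totalCycles hc) := rfl

/-- The map on homology induced by the projection to the generator. -/
def colOneHomology (n : ℤ) : R.GroupoidHomology n →+ R.CompactCohomology (1 - n) :=
  Homology.induced R.colOneProj (fun _ hy => R.colOneProj_mem_cocycles hy) fun b hb =>
    ⟨-R.colOneProj b, neg_mem (R.colOneProj_mem_degPart hb (by ring)), by
      rw [colOneProj_totalD, map_neg]⟩

/-- If w and z are the two projections of a cycle, the vanishing of its boundary in the column p = 0
reads t⁻¹ z - z = -d w. -/
theorem colOneHomology_mem_invariants (n : ℤ) (x : R.GroupoidHomology n) :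
    R.colOneHomology n x ∈ (R.cohomologyAction (1 - n)).invariants := by
  rw [Representation.mem_invariants_iff_of_forall_mem_zpowers _ _ mem_zpowers_generator_inv]
  obtain ⟨y, hy, rfl⟩ := Homology.exists_eq_cls x
  have hz := R.colOneProj_mem_cocycles hy
  refine (Homology.cls_eq_cls_iff (R.chainAction_mem_cocycles 𝓉⁻¹ hz) hz).2
    ⟨-R.colZeroProj y, neg_mem (R.colZeroProj_mem_degPart hy.1 (by ring)), ?_⟩
  have h := R.colZeroProj_totalD y
  rw [show R.totalD y = 0 from hy.2, map_zero] at h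
  rw [map_neg]
  exact neg_eq_of_add_eq_zero_right h.symm

/-- The map `H_n(ℤ ⋉ X) → H_c^{1-n}(X)^ℤ`. -/
def toInvariants (n : ℤ) :
    R.GroupoidHomology n →+ (R.cohomologyAction (1 - n)).invariants :=
  (R.colOneHomology n).codRestrict _ (R.colOneHomology_mem_invariants n)

theorem toInvariants_cls {n : ℤ} {y : ⨁ pq, R.Entry pq} (hy : y ∈ R.totalCycles n) :
    (R.toInvariants n (Homology.cls y hy) : R.CompactCohomology (1 - n)) =
      Homology.cls (R.colOneProj y) (R.colOneProj_mem_cocycles hy) := rfl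

theorem toInvariants_cls_add {n : ℤ} (w z : ⨁ q, R.Sec q) (hz : z ∈ R.cocycles (1 - n))
    (h : R.colZero w + R.colOne 𝓉 z ∈ R.totalCycles n) :
    (R.toInvariants n (Homology.cls _ h) : R.CompactCohomology (1 - n)) = Homology.cls z hz := by
  rw [toInvariants_cls]
  refine Homology.cls_congr ?_ _ _
  rw [map_add, colOneProj_colZero, colOneProj_colOne, zero_add]

/-- By the homotopy formula a cycle `y` differs from the sum of its two projections by the boundary
of `R.totalHomotopy y`. -/
theorem exists_representative {n : ℤ} (x : R.GroupoidHomology n) :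
    ∃ (w z : ⨁ q, R.Sec q) (_ : z ∈ R.cocycles (1 - n))
      (h : R.colZero w + R.colOne 𝓉 z ∈ R.totalCycles n), x = Homology.cls _ h := by
  obtain ⟨y, hy, rfl⟩ := Homology.exists_eq_cls x
  have hD : R.totalD y = 0 := hy.2
  have hh := R.totalD_totalHomotopy y
  rw [hD, map_zero, add_zero, sub_sub] at hh
  have hH := R.totalHomotopy_mem_degPart hy.1
  have heq : R.colZero (R.colZeroProj y) + R.colOne 𝓉 (R.colOneProj y) =
      y - R.totalD (R.totalHomotopy y) := by rw [hh, sub_sub_cancel]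
  refine ⟨R.colZeroProj y, R.colOneProj y, R.colOneProj_mem_cocycles hy, ⟨?_, ?_⟩,
    (Homology.cls_eq_cls_iff hy _).2 ⟨_, hH, hh⟩⟩
  · refine add_mem (R.colZero_mem_degPart (R.colZeroProj_mem_degPart hy.1 rfl))
      (R.colOne_mem_degPart (R.colOneProj_mem_degPart hy.1 rfl) rfl)
  · change R.totalD _ = 0
    -- The boundary of the sum is reassembled as the image of the two projections of `R.totalD y`,
    -- which is zero.
    rw [map_add, totalD_colZero, totalD_colOne, sub_eq_add_neg, ← add_assoc, ← map_add,
      ← colZeroProj_totalD, ← map_neg, ← colOneProj_totalD, hD, map_zero, map_zero, map_zero,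
      map_zero, add_zero]

/-- If `c` in the column p = 0 bounds `y`, the two projections of this equation say that c = d w +
(t⁻¹ z - z) with d z = 0. So the class of `c` is zero in the coinvariants. -/
theorem fromCoinvariants_injective (n : ℤ) : Function.Injective (R.fromCoinvariants n) := by
  refine (injective_iff_map_eq_zero _).2 fun x hx => ?_
  obtain ⟨x, rfl⟩ := Representation.Coinvariants.mk_surjective _ x
  obtain ⟨c, hc, rfl⟩ := Homology.exists_eq_cls x
  rw [fromCoinvariants_mk, Homology.cls_eq_zero_iff] at hx
  obtain ⟨y, hy, hyc⟩ := hx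
  have h0 := R.colZeroProj_totalD y
  have h1 := R.colOneProj_totalD y
  rw [hyc, colZeroProj_colZero] at h0
  rw [hyc, colOneProj_colZero] at h1
  have hz : R.colOneProj y ∈ R.cocycles (-n) :=
    ⟨R.colOneProj_mem_degPart hy (by ring), neg_eq_zero.1 h1.symm⟩
  have hcls : (Homology.cls c hc : R.CompactCohomology (-n)) =
      R.cohomologyAction (-n) 𝓉⁻¹ (Homology.cls _ hz) - Homology.cls _ hz := by
    refine (Homology.cls_eq_cls_iff hc
      (sub_mem (R.chainAction_mem_cocycles 𝓉⁻¹ hz) hz)).2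
      ⟨R.colZeroProj y, R.colZeroProj_mem_degPart hy (by ring), ?_⟩
    rw [h0, add_sub_cancel_right]
  rw [hcls, map_sub, Representation.Coinvariants.mk_self_apply, sub_self]

/-- If the class of z vanishes, z = d b, and adding the boundary of b placed on the generator arrows
moves w + z into the column p = 0, where it becomes w + (t⁻¹ b - b). -/
theorem exact_fromCoinvariants_toInvariants (n : ℤ) :
    Function.Exact (R.fromCoinvariants n) (R.toInvariants n) := by
  intro x
  constructor
  · intro hx
    obtain ⟨w, z, hz, h, rfl⟩ := R.exists_representative x
    have hx' : (R.toInvariants n (Homology.cls _ h) : R.CompactCohomology (1 - n)) = 0 :=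
      congrArg Subtype.val hx
    rw [toInvariants_cls_add R w z hz h, Homology.cls_eq_zero_iff] at hx'
    obtain ⟨b, hb, rfl⟩ := hx'
    have hb' : b ∈ degPart R.Sec (fun q : ℕ => (q : ℤ)) (-n) := by
      rwa [sub_sub_cancel_left] at hb
    have hD : R.totalD (R.colOne 𝓉 b) = R.colZero (w + (R.chainAction 𝓉⁻¹ b - b)) -
        (R.colZero w + R.colOne 𝓉 (R.secD b)) := by
      rw [totalD_colOne, map_add]; abel
    -- Projecting the cycle condition to the column p = 0 gives d w + (t⁻¹ - 1) d b = 0, which is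
    -- the cocycle condition needed here.
    have hc : w + (R.chainAction 𝓉⁻¹ b - b) ∈ R.cocycles (-n) := by
      have hw := R.colZeroProj_mem_degPart h.1 rfl
      have hdw := R.colZeroProj_totalD (R.colZero w + R.colOne 𝓉 (R.secD b))
      rw [show R.totalD (R.colZero w + R.colOne 𝓉 (R.secD b)) = 0 from h.2] at hdw
      simp only [map_zero, map_add, colZeroProj_colZero, colZeroProj_colOne, colOneProj_colZero,
        colOneProj_colOne, add_zero, zero_add] at hw hdw
      refine ⟨add_mem hw (R.chainAction_sub_mem_degPart _ hb'), ?_⟩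
      change R.secD _ = 0
      rw [map_add, map_sub, secD_chainAction, ← hdw]
    refine ⟨Representation.Coinvariants.mk _ (Homology.cls _ hc), ?_⟩
    rw [fromCoinvariants_mk]
    exact (Homology.cls_eq_cls_iff _ _).2 ⟨_, R.colOne_mem_degPart hb' (by ring), hD⟩
  · rintro ⟨x, rfl⟩
    obtain ⟨x, rfl⟩ := Representation.Coinvariants.mk_surjective _ x
    obtain ⟨c, hc, rfl⟩ := Homology.exists_eq_cls x
    refine Subtype.ext ?_
    rw [fromCoinvariants_mk, toInvariants_cls]
    exact (Homology.cls_eq_zero_iff _).2 ⟨0, zero_mem _, by rw [map_zero, colOneProj_colZero]⟩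

/-- Invariance of the class of z gives b with d b = t⁻¹ z - z, and then -b in the column p = 0
completes z to a cycle. -/
theorem toInvariants_surjective (n : ℤ) : Function.Surjective (R.toInvariants n) := by
  rintro ⟨x, hx⟩
  obtain ⟨z, hz, rfl⟩ := Homology.exists_eq_cls x
  obtain ⟨b, hb, hbz⟩ :=
    (Homology.cls_eq_cls_iff (R.chainAction_mem_cocycles 𝓉⁻¹ hz) hz).1 (hx 𝓉⁻¹)
  have hb' : -b ∈ degPart R.Sec (fun q : ℕ => (q : ℤ)) (-n) := by
    rw [sub_sub_cancel_left] at hb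
    exact neg_mem hb
  have h : R.colZero (-b) + R.colOne 𝓉 z ∈ R.totalCycles n := by
    refine ⟨add_mem (R.colZero_mem_degPart hb') (R.colOne_mem_degPart hz.1 rfl), ?_⟩
    change R.totalD _ = 0
    rw [map_add, totalD_colZero, totalD_colOne, show R.secD z = 0 from hz.2, ← hbz]
    simp
  exact ⟨Homology.cls _ h, Subtype.ext (R.toInvariants_cls_add _ z hz h)⟩

end SoftResolution

end CMHom

end

/-! ### The main theorem -/

theorem mainTheorem4 {X : Type u} [TopologicalSpace X] [T2Space X] [LocallyCompactSpace X]
    [MulAction (Multiplicative ℤ) X] [ContinuousConstSMul (Multiplicative ℤ) X] :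
    -- resolutions of `𝒵` by c-soft `(ℤ ⋉ X)`-sheaves exist
    Nonempty (CMHom.SoftResolution.{u, 0, u, 0}
      (CMHom.GSheaf.constInt (CMHom.transformationGroupoid (Multiplicative ℤ) X))) ∧
    -- whichever resolution is used to compute both theories, the exact sequence holds
    ∀ (R : CMHom.SoftResolution.{u, 0, w, 0}
        (CMHom.GSheaf.constInt (CMHom.transformationGroupoid (Multiplicative ℤ) X))) (n : ℤ),
      ∃ (ι : (R.cohomologyAction (-n)).Coinvariants →+ R.GroupoidHomology n)
        (π : R.GroupoidHomology n →+ (R.cohomologyAction (1 - n)).invariants),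
        -- `ι` is induced by the inclusion of the column `p = 0`
        (∀ (c : ⨁ q, R.Sec q) (hc : c ∈ R.cocycles (-n)),
          ι (Representation.Coinvariants.mk (R.cohomologyAction (-n))
              (CMHom.Homology.cls c hc)) =
            CMHom.Homology.cls (R.colZero c) (R.colZero_mem_totalCycles hc)) ∧
        -- `π` sends a cycle consisting of `w` in the column `p = 0`, and of `z` placed on the
        -- arrows `x ← (-1) x` given by the generator of `ℤ`, to the class of `z`
        (∀ (w z : ⨁ q, R.Sec q) (hz : z ∈ R.cocycles (1 - n))
          (h : R.colZero w + R.colOne (Multiplicative.ofAdd (1 : ℤ)) z ∈ R.totalCycles n),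
          (π (CMHom.Homology.cls _ h) : R.CompactCohomology (1 - n)) =
            CMHom.Homology.cls z hz) ∧
        -- every class is represented by such a cycle, so that `π` is determined by this
        (∀ c : R.GroupoidHomology n, ∃ (w z : ⨁ q, R.Sec q) (_ : z ∈ R.cocycles (1 - n))
          (h : R.colZero w + R.colOne (Multiplicative.ofAdd (1 : ℤ)) z ∈ R.totalCycles n),
          c = CMHom.Homology.cls _ h) ∧
        -- the sequence is short exact
        Function.Injective ι ∧ Function.Exact ι π ∧ Function.Surjective π ∧
        -- the special cases `n = 1` and `n > 1`
        (n = 1 → Function.Bijective π) ∧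
        (1 < n → Subsingleton (R.GroupoidHomology n)) := by
  refine ⟨⟨CMHom.alexanderSpanierResolution (Multiplicative ℤ) X⟩, fun R n =>
    ⟨R.fromCoinvariants n, R.toInvariants n, fun c hc => R.fromCoinvariants_mk n hc,
      fun w z hz h => R.toInvariants_cls_add w z hz h, fun c => R.exists_representative c,
      R.fromCoinvariants_injective n, R.exact_fromCoinvariants_toInvariants n,
      R.toInvariants_surjective n, fun hn => ⟨?_, R.toInvariants_surjective n⟩, fun hn => ?_⟩⟩
  -- For n = 1 the source of ι comes from cohomology in degree -1, which is zero because resolutions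
  -- start in degree 0.
  · have : Subsingleton (R.CompactCohomology (-n)) :=
      CMHom.Homology.subsingleton_of_forall_ne fun q => by omega
    refine (injective_iff_map_eq_zero _).2 fun x hx => ?_
    obtain ⟨c, rfl⟩ := (R.exact_fromCoinvariants_toInvariants n x).1 hx
    obtain ⟨c, rfl⟩ := Representation.Coinvariants.mk_surjective _ c
    rw [Subsingleton.elim c 0, map_zero, map_zero]
  -- For n > 1 both -n and 1 - n are negative, so both outer terms vanish.
  · have : Subsingleton (R.CompactCohomology (-n)) :=
      CMHom.Homology.subsingleton_of_forall_ne fun q => by omega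
    have : Subsingleton (R.CompactCohomology (1 - n)) :=
      CMHom.Homology.subsingleton_of_forall_ne fun q => by omega
    refine subsingleton_of_forall_eq 0 fun x => ?_
    obtain ⟨c, rfl⟩ := (R.exact_fromCoinvariants_toInvariants n x).1 (Subsingleton.elim _ _)
    obtain ⟨c, rfl⟩ := Representation.Coinvariants.mk_surjective _ c
    rw [Subsingleton.elim c 0, map_zero, map_zero]
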